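/- Consider the champagne bottle Hamiltonian $H=\tfrac12(y_1^2+y_2^2)-(x_1^2+x_2^2)+(x_1^2+x_2^2)^2$ on $\mathbb{R}^4$ with Poisson bracket $\{x_i,y_j\}=\delta_{ij}$. The linear symplectic change of variables $x_j=2^{-1/4}(q_j-p_j)/\sqrt2$, $y_j=2^{1/4}(q_j+p_j)/\sqrt2$ ($j=1,2$) brings its quadratic part at the focus-focus equilibrium $(0,0)$ to $\sqrt2\,J_1$, where $J_1=q_1p_1+q_2p_2$ and $J_2=q_1p_2-q_2p_1$; regard $H$ as a polynomial in $(q,p)$. A Birkhoff normal form of $H$ is a formal power series $\overline H(J_1,J_2)$ in $J_1,J_2$ for which there is a formal near-identity symplectic change of variables $\Phi$ (that is, $\Phi$ is the identity plus terms of degree at least $2$ and preserves the canonical Poisson brackets) with $H\circ\Phi=\overline H(J_1,J_2)$. For $W=\sum_{i\ge0}\frac{\varepsilon^i}{i!}W_{i+1}$, with $W_i$ a homogeneous polynomial of degree $i+2$ in $(q,p)$, and $F=\sum_{i\ge 0}\frac{\varepsilon^i}{i!}F_i^0$, put $F_j^i=F_{j+1}^{i-1}+\sum_{k=0}^{j}\binom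 jk\{F_{j-k}^{i-1},W_{k+1}\}$ for $i\ge1$, $j\ge0$. The Lie transform of $F$ generated by $W$ is $\sum_{i\ge 0}\frac{\varepsilon^i}{i!}F_0^i$ at $\varepsilon=1$; that of $H$ is computed from $\varepsilon^{-2}H(\varepsilon q,\varepsilon p)=\sum_{i\ge 0}\frac{\varepsilon^i}{i!}H_i^0$, and $\Phi_W$ denotes the change of variables formed by the Lie transforms of the four coordinate functions. Then $H$ has exactly one Birkhoff normal form $\overline H$. There is a $W$, with each $W_i$ in the range of $\{\sqrt2J_1,\cdot\}$ on the homogeneous polynomials of degree $i+2$ that Poisson commute with $J_2$, such that the Lie transform of $H$ generated by $W$ is $\overline H(J_1,J_2)$, $\Phi_W$ is near-identity and symplectic, and $H\circ\Phi_W=\overline H(J_1,J_2)$. Every $W$ for which the Lie transform of $H$ is a formal power series in $J_1,J_2$ yields the same $\overline H$. Moreover $$\overline H=\sqrt2\,J_1+\tfrac14(3J_1^2+J_2^2)-\tfrac{\sqrt2}{32}J_1(17J_1^2+9J_2^2)+\tfrac1{256}(375J_1^4+258J_1^2J_2^2+11J_2^4)-\tfrac{\sqrt2}{4096}J_1(10689J_1^4+8910J_1^2J_2^2+909J_2^4)+O(J^6),$$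 where $O(J^6)$ stands for terms of degree at least $6$ in $(J_1,J_2)$. -/

import Mathlib

namespace ChampagneBottle

noncomputable section

open MvPolynomial

/-- Labels of the four canonical coordinates: `Sum.inl j` is the position `q_j` (or `x_j`) and
`Sum.inr j` is the conjugate momentum `p_j` (or `y_j`); `j = 0, 1` stands for the index 1, 2. -/
abbrev Coord : Type := Fin 2 ⊕ Fin 2

/-- Polynomial functions on the phase space `ℝ⁴`. -/
abbrev Poly : Type := MvPolynomial Coord ℝ

/-- Formal power series in the four canonical coordinates. -/
abbrev Series : Type := MvPowerSeries Coord ℝ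

/-- The position coordinate `q_j`. -/
def q (j : Fin 2) : Poly := X (Sum.inl j)

/-- The momentum coordinate `p_j`. -/
def p (j : Fin 2) : Poly := X (Sum.inr j)

/-- `J₁ = q₁ p₁ + q₂ p₂`. -/
def J₁ : Poly := q 0 * p 0 + q 1 * p 1

/-- `J₂ = q₁ p₂ - q₂ p₁`. -/
def J₂ : Poly := q 0 * p 1 - q 1 * p 0

/-- The Poisson bracket of polynomials, normalised by `{q_i, p_j} = δ_ij`. -/
def bracket (f g : Poly) : Poly :=
  ∑ j : Fin 2, (pderiv (Sum.inl j) f * pderiv (Sum.inr j) g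
    - pderiv (Sum.inr j) f * pderiv (Sum.inl j) g)

/-- The Poisson bracket of formal power series. -/
def seriesBracket (f g : Series) : Series :=
  ∑ j : Fin 2, (MvPowerSeries.pderiv ℝ (Sum.inl j) f * MvPowerSeries.pderiv ℝ (Sum.inr j) g
    - MvPowerSeries.pderiv ℝ (Sum.inr j) f * MvPowerSeries.pderiv ℝ (Sum.inl j) g)

/-- The champagne bottle Hamiltonian in the original coordinates, `x_j = q j` and `y_j = p j`:
`H = (y₁² + y₂²) / 2 - (x₁² + x₂²) + (x₁² + x₂²)²`. -/
def hamiltonian : Poly :=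
  C (1 / 2) * (p 0 ^ 2 + p 1 ^ 2) - (q 0 ^ 2 + q 1 ^ 2) + (q 0 ^ 2 + q 1 ^ 2) ^ 2

/-- The linear symplectic change of variables that brings the quadratic part of the Hamiltonian
to `√2 J₁`: `x_j = 2^(-1/4) (q_j - p_j) / √2` and `y_j = 2^(1/4) (q_j + p_j) / √2`. -/
def williamson : Coord → Poly
  | Sum.inl j => C ((√√2)⁻¹ * (√2)⁻¹) * (q j - p j)
  | Sum.inr j => C (√√2 * (√2)⁻¹) * (q j + p j)

/-- The champagne bottle Hamiltonian in the coordinates `(q, p)`. -/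
def H : Poly := aeval williamson hamiltonian

/-- The coefficients `H_i⁰` of the scaled Hamiltonian
`ε⁻² H(ε q, ε p) = ∑ i, ε^i / i! * H_i⁰(q, p)` (for `H` without terms of degree 0 and 1). -/
def scaled (K : Poly) (i : ℕ) : Poly :=
  (i.factorial : ℝ) • homogeneousComponent (i + 2) K

/-- The Lie–Deprit triangle of `F = ∑ i, ε^i / i! * F_i` for the generating function
`W = ∑ i, ε^i / i! * W_{i+1}`: the value at `i`, `j` is `F_j^i`. (`W 0` is not used.) -/
def triangle (F : ℕ → Poly) (W : ℕ → Poly) : ℕ → ℕ → Poly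
  | 0, j => F j
  | i + 1, j => triangle F W i (j + 1)
      + ∑ k ∈ Finset.range (j + 1), (j.choose k : ℝ) • bracket (triangle F W i (j - k)) (W (k + 1))

/-- The Lie transform `∑ i, ε^i / i! * F_0^i` at `ε = 1`, as a formal power series. It is used only
where `F_0^i` is homogeneous of degree at least `i`, so that the coefficient of a monomial of
degree `d` receives no contribution from `i > d`. -/
def lieTransform (F : ℕ → Poly) (W : ℕ → Poly) : Series :=
  fun m => ∑ i ∈ Finset.range (m.degree + 1),
    ((i.factorial : ℝ))⁻¹ * coeff m (triangle F W i 0)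

/-- The formal change of variables generated by `W`: the Lie transforms of the four coordinate
functions (which do not depend on `ε`). -/
def lieChange (W : ℕ → Poly) (a : Coord) : Series :=
  lieTransform (fun i => if i = 0 then X a else 0) W

/-- `W = ∑ i, ε^i / i! * W_{i+1}` is a generating function: each `W_i`, `i ≥ 1`, is a homogeneous
polynomial of degree `i + 2`. -/
def IsGenerator (W : ℕ → Poly) : Prop :=
  ∀ i, 1 ≤ i → (W i).IsHomogeneous (i + 2)

/-- `W` has no resonant terms: each `W_i`, `i ≥ 1`, lies in the range of `{√2 J₁, ·}` acting on the
homogeneous polynomials of degree `i + 2` that Poisson commute with `J₂`. -/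
def IsNonresonant (W : ℕ → Poly) : Prop :=
  ∀ i, 1 ≤ i → ∃ V : Poly, V.IsHomogeneous (i + 2) ∧ bracket J₂ V = 0 ∧
    W i = bracket (C √2 * J₁) V

/-- `Φ` is a formal near-identity symplectic change of variables: `Φ_a` is the coordinate `a` plus
terms of degree at least 2, and the canonical bracket relations are preserved. -/
structure IsNearIdentitySymplectic (Φ : Coord → Series) : Prop where
  near_identity : ∀ (a : Coord) (m : Coord →₀ ℕ), m.degree ≤ 1 →
    MvPowerSeries.coeff m (Φ a) = MvPowerSeries.coeff m (MvPowerSeries.X a : Series)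
  bracket_q_q : ∀ i j : Fin 2, seriesBracket (Φ (Sum.inl i)) (Φ (Sum.inl j)) = 0
  bracket_p_p : ∀ i j : Fin 2, seriesBracket (Φ (Sum.inr i)) (Φ (Sum.inr j)) = 0
  bracket_q_p : ∀ i j : Fin 2,
    seriesBracket (Φ (Sum.inl i)) (Φ (Sum.inr j)) = if i = j then 1 else 0

/-- The formal power series `N(J₁, J₂)` in the canonical coordinates, for `N` a formal power
series in two variables. -/
def inJ (N : MvPowerSeries (Fin 2) ℝ) : Series :=
  MvPowerSeries.subst ![(J₁ : Series), (J₂ : Series)] N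

/-- `N` is a Birkhoff normal form of `K`: some formal near-identity symplectic change of
variables transforms `K` into `N(J₁, J₂)`. -/
def IsBirkhoffNormalForm (K : Poly) (N : MvPowerSeries (Fin 2) ℝ) : Prop :=
  ∃ Φ : Coord → Series, IsNearIdentitySymplectic Φ ∧ aeval Φ K = inJ N

/-- The polynomial of the normal form up to order five; `X 0` stands for `J₁` and `X 1` for
`J₂`. -/
def normalFormPoly : MvPolynomial (Fin 2) ℝ :=
  C √2 * X 0 + C (1 / 4) * (3 * X 0 ^ 2 + X 1 ^ 2)
    - C (√2 / 32) * X 0 * (17 * X 0 ^ 2 + 9 * X 1 ^ 2)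
    + C (1 / 256) * (375 * X 0 ^ 4 + 258 * X 0 ^ 2 * X 1 ^ 2 + 11 * X 1 ^ 4)
    - C (√2 / 4096) * X 0 * (10689 * X 0 ^ 4 + 8910 * X 0 ^ 2 * X 1 ^ 2 + 909 * X 1 ^ 4)

end

end ChampagneBottle

/-!
The Lie transform generated by `W` is a homomorphism. For the derivation `D = ∂/∂ε + {·, w}` of
power series in `ε`, the series `∑ εⁿ/n! (DⁿF)(0)` has the derivative `∑ εⁿ/n! (Dⁿ(DF))(0)`, and
induction on the order shows that `F ↦ ∑ εⁿ/n! (DⁿF)(0)` respects products and brackets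
(`depritTransform_mul`, `poisson_depritTransform`). Setting `ε = 1`, which is legitimate by
homogeneity (`dilate`), shows that the Lie transform of `H` is `H ∘ Φ_W` and that `Φ_W` is
symplectic (`lieTransform_scaled`, `isNearIdentitySymplectic_lieChange`). So every series produced
by a generating function is a Birkhoff normal form, and the last uniqueness claim is a case of the
first.

Existence: `H` is a polynomial in `|q|²`, `|p|²`, `J₁`, `J₂`, a family that is closed under brackets
up to linear combinations. The operator `{√2 J₁, ·}` is diagonal on monomials in these generators,
and its kernel consists of polynomials in `J₁` and `J₂` because `|q|² |p|² = J₁² + J₂²`; hence the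
homological equation can be solved at each order (`exists_homological`, `exists_generator`).

Uniqueness: two normal forms `N`, `N'` are related by a formal symplectic `χ` with
`N'(J₁, J₂) ∘ χ = N(J₁, J₂)`. Let `u` and `v` be the changes of `J₁` and `J₂` under `χ`. Since `χ`
maps eigenfunctions of `{·, J₁}` to eigenfunctions of `{·, J₁ + u}`, the lowest-order part of `u` has
no terms of weight zero, whereas `N - N' = √2 u + J₂ v / 2 + …` has no others. Comparing orders,
`u` is of higher order than `v`, and the lowest-order part of `v` commutes with `J₁` and `J₂`. It is
also, up to a factor, the bracket of some function with `J₂`, because `χ` maps the positions to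
functions rotated by `J₂ + v`. As `{·, J₂}` generates a periodic flow, its range and its kernel
meet in zero, so the order of `v` increases. By induction `N = N'` (`normalForm_step`). This uses the
coefficients `√2` of `J₁` and `1/4` of `J₂²`, both nonzero.

Coefficients: instead of carrying out the algorithm, moments are compared. On rotation-invariant
polynomials there is a functional that vanishes on all brackets (`leafIntegral`); it is the
integral over the compact real form of the symplectic leaf `J₂ = 1`. It is therefore unchanged by
the Lie transform, and it takes the same value on the powers of `H` as on the powers of the normal
form, order by order (`segmentIntegral_normalForm`). For the part `b l` of order `l + 1` of the
normal form at `J₂ = 1` this determines all the integrals of `s ^ j * b l` over the segment from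
`-i` to `i` beyond some `j`, and thereby `b l` (`eq_of_moments`). That the stated polynomials have the
right moments is checked by writing the differences as derivatives of multiples of `1 + s²`, a
polynomial that vanishes at both ends of the segment.
-/

namespace ChampagneBottle

noncomputable section

/-! ### Poisson brackets of commuting derivations -/

section PoissonAlgebra

variable {R : Type*} [CommRing R] [Algebra ℝ R]

/-- The Hamiltonian derivation `f ↦ {f, g}` of the Poisson bracket built from four derivations
`d a` of a commutative algebra, which play the role of the partial derivatives. -/
def poisson (d : Coord → Derivation ℝ R R) (g : R) : Derivation ℝ R R :=
  ∑ j : Fin 2, (d (Sum.inr j) g • d (Sum.inl j) - d (Sum.inl j) g • d (Sum.inr j))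

variable (d : Coord → Derivation ℝ R R)

theorem poisson_apply (f g : R) : poisson d g f =
    ∑ j : Fin 2, (d (Sum.inl j) f * d (Sum.inr j) g - d (Sum.inr j) f * d (Sum.inl j) g) := by
  simp [poisson, mul_comm]

theorem poisson_antisymm (f g : R) : poisson d g f = -poisson d f g := by
  simp only [poisson_apply, Fin.sum_univ_two]; ring

theorem poisson_add_right (f g h : R) : poisson d (g + h) f = poisson d g f + poisson d h f := by
  simp only [poisson_apply, Fin.sum_univ_two, map_add]; ring

theorem poisson_mul_right (f g h : R) :
    poisson d (g * h) f = g * poisson d h f + h * poisson d g f := by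
  rw [poisson_antisymm, Derivation.leibniz, poisson_antisymm d f h, poisson_antisymm d f g]
  simp only [smul_eq_mul]; ring

/-- The Jacobi identity: `{·, h}` is a derivation of the bracket. -/
theorem poisson_jacobi (hd : ∀ a b x, d a (d b x) = d b (d a x)) (f g h : R) :
    poisson d h (poisson d g f) = poisson d g (poisson d h f) + poisson d (poisson d h g) f := by
  simp only [poisson_apply, Fin.sum_univ_two, map_add, map_sub, Derivation.leibniz, smul_eq_mul]
  rw [hd (Sum.inr 0) (Sum.inl 0), hd (Sum.inr 0) (Sum.inl 0), hd (Sum.inr 0) (Sum.inl 0),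
    hd (Sum.inr 1) (Sum.inl 0), hd (Sum.inr 1) (Sum.inl 0), hd (Sum.inr 1) (Sum.inl 0),
    hd (Sum.inr 0) (Sum.inl 1), hd (Sum.inr 0) (Sum.inl 1), hd (Sum.inr 0) (Sum.inl 1),
    hd (Sum.inr 1) (Sum.inl 1), hd (Sum.inr 1) (Sum.inl 1), hd (Sum.inr 1) (Sum.inl 1),
    hd (Sum.inl 1) (Sum.inl 0), hd (Sum.inl 1) (Sum.inl 0), hd (Sum.inl 1) (Sum.inl 0),
    hd (Sum.inr 1) (Sum.inr 0), hd (Sum.inr 1) (Sum.inr 0), hd (Sum.inr 1) (Sum.inr 0)]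
  ring

/-- A ring homomorphism intertwining the derivations is a homomorphism of Poisson algebras. -/
theorem map_poisson {S : Type*} [CommRing S] [Algebra ℝ S] (e : Coord → Derivation ℝ S S)
    (φ : R →+* S) (h : ∀ a x, φ (d a x) = e a (φ x)) (f g : R) :
    φ (poisson d g f) = poisson e (φ g) (φ f) := by
  simp only [poisson_apply, map_sum, map_sub, map_mul, h]

/-- Derivations act coefficientwise on power series in an additional variable `ε`. -/
def coeffDerivation (δ : Derivation ℝ R R) :
    Derivation ℝ (PowerSeries R) (PowerSeries R) :=
  Derivation.mk'
    { toFun := fun F => PowerSeries.mk fun n => δ (PowerSeries.coeff n F)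
      map_add' := fun F G => by ext n; simp
      map_smul' := fun c F => by ext n; simp }
    fun F G => by
      ext n
      simp only [LinearMap.coe_mk, AddHom.coe_mk, PowerSeries.coeff_mk, PowerSeries.coeff_mul,
        map_sum, Derivation.leibniz, smul_eq_mul, map_add, Finset.sum_add_distrib]
      congr 1
      exact Finset.Nat.sum_antidiagonal_swap
        (f := fun x => PowerSeries.coeff x.1 G * δ (PowerSeries.coeff x.2 F))

@[simp]
theorem coeff_coeffDerivation (δ : Derivation ℝ R R) (F : PowerSeries R) (n : ℕ) :
    PowerSeries.coeff n (coeffDerivation δ F) = δ (PowerSeries.coeff n F) := by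
  simp [coeffDerivation]

theorem coeff_poisson_coeffDerivation (F G : PowerSeries R) (n : ℕ) :
    PowerSeries.coeff n (poisson (fun a => coeffDerivation (d a)) G F) =
      ∑ x ∈ Finset.HasAntidiagonal.antidiagonal n,
        poisson d (PowerSeries.coeff x.2 G) (PowerSeries.coeff x.1 F) := by
  simp only [poisson_apply, map_sum, map_sub, PowerSeries.coeff_mul, coeff_coeffDerivation]
  rw [Finset.sum_comm]
  refine Finset.sum_congr rfl fun j _ => ?_
  rw [Finset.sum_sub_distrib]

/-! ### The Lie transform as a homomorphism of Poisson algebras -/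

/-- The derivation `∂/∂ε + {·, w}` of the algebra of power series in `ε`, whose iterates generate
the Lie–Deprit triangle. -/
def depritDerivation (w : PowerSeries R) : Derivation ℝ (PowerSeries R) (PowerSeries R) :=
  (PowerSeries.derivative R).restrictScalars ℝ + poisson (fun a => coeffDerivation (d a)) w

theorem depritDerivation_apply (w F : PowerSeries R) : depritDerivation d w F =
    PowerSeries.derivative R F + poisson (fun a => coeffDerivation (d a)) w F := rfl

/-- The Lie transform `∑ n, ε ^ n / n! * (Dⁿ F)(0)`, for `D = ∂/∂ε + {·, w}`. -/
def depritTransform (w F : PowerSeries R) : PowerSeries R :=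
  PowerSeries.mk fun n => ((n.factorial : ℝ))⁻¹ •
    PowerSeries.coeff 0 ((depritDerivation d w)^[n] F)

theorem coeff_depritTransform (w F : PowerSeries R) (n : ℕ) :
    PowerSeries.coeff n (depritTransform d w F) = ((n.factorial : ℝ))⁻¹ •
      PowerSeries.coeff 0 ((depritDerivation d w)^[n] F) := by
  simp [depritTransform]

theorem coeff_zero_depritTransform (w F : PowerSeries R) :
    PowerSeries.coeff 0 (depritTransform d w F) = PowerSeries.coeff 0 F := by
  simp [depritTransform]

/-- The differential equation of the Lie transform. -/
theorem coeff_succ_depritTransform (w F : PowerSeries R) (n : ℕ) :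
    ((n : ℝ) + 1) • PowerSeries.coeff (n + 1) (depritTransform d w F) =
      PowerSeries.coeff n (depritTransform d w (depritDerivation d w F)) := by
  rw [coeff_depritTransform, coeff_depritTransform, Function.iterate_succ_apply, smul_smul,
    Nat.factorial_succ]
  congr 1
  push_cast
  field_simp

theorem derivative_depritTransform (w F : PowerSeries R) :
    PowerSeries.derivative R (depritTransform d w F) =
      depritTransform d w (depritDerivation d w F) := by
  ext n
  rw [← coeff_succ_depritTransform, PowerSeries.coeff_derivative, Algebra.smul_def, mul_comm]
  simp

theorem depritTransform_add (w F G : PowerSeries R) :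
    depritTransform d w (F + G) = depritTransform d w F + depritTransform d w G := by
  ext n
  simp only [coeff_depritTransform, map_add, iterate_map_add, smul_add]

theorem depritTransform_smul (w F : PowerSeries R) (c : ℝ) :
    depritTransform d w (c • F) = c • depritTransform d w F := by
  ext n
  have : (depritDerivation d w)^[n] (c • F) = c • (depritDerivation d w)^[n] F := by
    induction n generalizing F with
    | zero => rfl
    | succ n ih =>
      rw [Function.iterate_succ_apply, Derivation.map_smul, ih, Function.iterate_succ_apply]
  rw [coeff_depritTransform, this, PowerSeries.coeff_smul, PowerSeries.coeff_smul,
    coeff_depritTransform, smul_comm]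

/-- Two power series with the same constant coefficient and the same derivative up to order `n`
agree up to order `n`. -/
theorem coeff_eq_of_derivative {F G : PowerSeries R} {n : ℕ}
    (h : PowerSeries.coeff n (PowerSeries.derivative R F) =
      PowerSeries.coeff n (PowerSeries.derivative R G)) :
    PowerSeries.coeff (n + 1) F = PowerSeries.coeff (n + 1) G := by
  rw [PowerSeries.coeff_derivative, PowerSeries.coeff_derivative] at h
  have h2 : ((n : ℝ) + 1) • PowerSeries.coeff (n + 1) F =
      ((n : ℝ) + 1) • PowerSeries.coeff (n + 1) G := by
    simpa [Algebra.smul_def, mul_comm] using h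
  have h3 : ((n : ℝ) + 1) ≠ 0 := by positivity
  have := congrArg (((n : ℝ) + 1)⁻¹ • ·) h2
  simpa [smul_smul, inv_mul_cancel₀ h3] using this

theorem depritTransform_mul (w F G : PowerSeries R) :
    depritTransform d w (F * G) = depritTransform d w F * depritTransform d w G := by
  ext n
  induction n generalizing F G with
  | zero =>
    simp only [PowerSeries.coeff_mul, Finset.Nat.antidiagonal_zero, Finset.sum_singleton,
      coeff_zero_depritTransform]
  | succ n ih =>
    apply coeff_eq_of_derivative
    simp only [derivative_depritTransform, Derivation.leibniz, smul_eq_mul, depritTransform_add,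
      map_add, ih]

theorem poisson_depritTransform (hd : ∀ a b x, d a (d b x) = d b (d a x))
    (w F G : PowerSeries R) :
    depritTransform d w (poisson (fun a => coeffDerivation (d a)) G F) =
      poisson (fun a => coeffDerivation (d a)) (depritTransform d w G)
        (depritTransform d w F) := by
  have hd' : ∀ (a b : Coord) (x : PowerSeries R), coeffDerivation (d a) (coeffDerivation (d b) x) =
      coeffDerivation (d b) (coeffDerivation (d a) x) := by
    intro a b x; ext n; simp [hd a b]
  have hder : ∀ (a : Coord) (x : PowerSeries R), PowerSeries.derivative R (coeffDerivation (d a) x)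
      = coeffDerivation (d a) (PowerSeries.derivative R x) := by
    intro a x; ext n
    rw [PowerSeries.coeff_derivative, coeff_coeffDerivation, coeff_coeffDerivation,
      PowerSeries.coeff_derivative, Derivation.leibniz]
    have : d a ((n : R) + 1) = 0 := by
      rw [map_add, Derivation.map_natCast, Derivation.map_one_eq_zero, add_zero]
    rw [this, smul_zero, zero_add, smul_eq_mul, mul_comm]
  have hderP : ∀ F G : PowerSeries R, PowerSeries.derivative R
      (poisson (fun a => coeffDerivation (d a)) G F) =
      poisson (fun a => coeffDerivation (d a)) G (PowerSeries.derivative R F) +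
      poisson (fun a => coeffDerivation (d a)) (PowerSeries.derivative R G) F := by
    intro F G
    simp only [poisson_apply, Fin.sum_univ_two, map_add, map_sub, Derivation.leibniz, smul_eq_mul,
      hder]
    ring
  ext n
  induction n generalizing F G with
  | zero =>
    simp only [coeff_zero_depritTransform, coeff_poisson_coeffDerivation,
      Finset.Nat.antidiagonal_zero, Finset.sum_singleton]
  | succ n ih =>
    apply coeff_eq_of_derivative
    have hD : depritDerivation d w (poisson (fun a => coeffDerivation (d a)) G F) =
        poisson (fun a => coeffDerivation (d a)) G (depritDerivation d w F) +
        poisson (fun a => coeffDerivation (d a)) (depritDerivation d w G) F := by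
      simp only [depritDerivation_apply, hderP, map_add, poisson_add_right]
      rw [poisson_jacobi _ hd' F G w]
      ring
    rw [derivative_depritTransform, hD, depritTransform_add, map_add, ih, ih, hderP, map_add,
      derivative_depritTransform, derivative_depritTransform]

/-- The Lie transform as a homomorphism of algebras. -/
def depritHom (w : PowerSeries R) : PowerSeries R →ₐ[ℝ] PowerSeries R :=
  AlgHom.ofLinearMap
    { toFun := depritTransform d w
      map_add' := depritTransform_add d w
      map_smul' := fun c F => depritTransform_smul d w F c }
    (by
      ext n
      cases n with
      | zero => exact coeff_zero_depritTransform d w 1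
      | succ n =>
        simp [coeff_depritTransform, PowerSeries.coeff_one, Function.iterate_succ_apply,
          iterate_map_zero])
    (depritTransform_mul d w)

theorem depritHom_apply (w F : PowerSeries R) : depritHom d w F = depritTransform d w F := rfl

theorem depritHom_X (w : PowerSeries R) : depritHom d w PowerSeries.X = PowerSeries.X := by
  have hX : depritDerivation d w PowerSeries.X = 1 := by
    rw [depritDerivation_apply, PowerSeries.derivative_X, poisson_apply]
    have : ∀ a, coeffDerivation (d a) (PowerSeries.X : PowerSeries R) = 0 := by
      intro a; ext n
      rw [coeff_coeffDerivation, PowerSeries.coeff_X]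
      split_ifs <;> simp
    simp [this]
  rw [depritHom_apply]
  ext n
  match n with
  | 0 => simp [coeff_zero_depritTransform]
  | n + 1 =>
    apply coeff_eq_of_derivative
    rw [derivative_depritTransform, hX, PowerSeries.derivative_X, ← depritHom_apply, map_one]

end PoissonAlgebra

/-! ### The Lie–Deprit triangle -/

theorem bracket_eq_poisson (f g : Poly) : bracket f g = poisson MvPolynomial.pderiv g f := by
  rw [poisson_apply]; rfl

theorem seriesBracket_eq_poisson (f g : Series) :
    seriesBracket f g = poisson (MvPowerSeries.pderiv ℝ) g f := by
  rw [poisson_apply]; rfl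

/-- The exponential generating series `∑ i, ε ^ i / i! * F i`. -/
def expSeries (F : ℕ → Poly) : PowerSeries Poly :=
  PowerSeries.mk fun i => ((i.factorial : ℝ))⁻¹ • F i

@[simp]
theorem coeff_expSeries (F : ℕ → Poly) (n : ℕ) :
    PowerSeries.coeff n (expSeries F) = ((n.factorial : ℝ))⁻¹ • F n := by
  simp [expSeries]

theorem coeff_iterate_depritDerivation (F W : ℕ → Poly) (i j : ℕ) :
    PowerSeries.coeff j ((depritDerivation MvPolynomial.pderiv
      (expSeries fun k => W (k + 1)))^[i] (expSeries F)) =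
      ((j.factorial : ℝ))⁻¹ • triangle F W i j := by
  induction i generalizing j with
  | zero => simp [triangle]
  | succ i ih =>
    rw [Function.iterate_succ_apply', depritDerivation_apply, map_add,
      PowerSeries.coeff_derivative, ih, coeff_poisson_coeffDerivation, triangle, smul_add,
      Finset.smul_sum]
    congr 1
    · have : ((j : Poly) + 1) = algebraMap ℝ Poly (j + 1) := by simp
      rw [this, mul_comm, ← Algebra.smul_def, smul_smul, Nat.factorial_succ]
      congr 1
      push_cast
      field_simp
    · rw [← Finset.Nat.sum_antidiagonal_swap,
        Finset.Nat.sum_antidiagonal_eq_sum_range_succ_mk]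
      refine Finset.sum_congr rfl fun k hk => ?_
      have hk' : k ≤ j := by simpa [Nat.lt_succ_iff] using hk
      simp only [Prod.swap, ih, coeff_expSeries, bracket_eq_poisson]
      rw [Derivation.map_smul, poisson_antisymm, Derivation.map_smul, ← smul_neg,
        ← poisson_antisymm, smul_smul, smul_smul]
      congr 1
      rw [Nat.cast_choose ℝ hk']
      field_simp

theorem coeff_depritTransform_expSeries (F W : ℕ → Poly) (n : ℕ) :
    PowerSeries.coeff n (depritTransform MvPolynomial.pderiv
      (expSeries fun k => W (k + 1)) (expSeries F)) =
      ((n.factorial : ℝ))⁻¹ • triangle F W n 0 := by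
  rw [coeff_depritTransform, coeff_iterate_depritDerivation]
  simp

/-! ### Graded formal power series and evaluation at `ε = 1` -/

/-- The homomorphism `f(z) ↦ f(t z)` from formal power series to power series in `t`: the
coefficient of `t ^ i` is the homogeneous part of degree `i`. Its injectivity makes sense of
evaluation at `t = 1`. -/
def dilate : Series →ₐ[ℝ] PowerSeries Series :=
  AlgHom.ofLinearMap
    { toFun := fun f => PowerSeries.mk fun i => MvPowerSeries.homogeneousComponent i f
      map_add' := fun f g => by ext; simp
      map_smul' := fun c f => by ext; simp }
    (by
      ext i m
      classical
      simp only [LinearMap.coe_mk, AddHom.coe_mk, PowerSeries.coeff_mk,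
        MvPowerSeries.coeff_homogeneousComponent, MvPowerSeries.coeff_one, PowerSeries.coeff_one]
      by_cases hm : m = 0
      · subst hm
        by_cases hi : i = 0 <;> simp [hi, eq_comm]
      · by_cases hi : i = 0 <;> simp [hi, hm, MvPowerSeries.coeff_one])
    (fun f g => by
      ext i m
      classical
      simp only [LinearMap.coe_mk, AddHom.coe_mk, PowerSeries.coeff_mk, PowerSeries.coeff_mul,
        MvPowerSeries.coeff_homogeneousComponent, MvPowerSeries.coeff_mul, map_sum]
      rw [Finset.sum_comm]
      by_cases h : m.degree = i
      · rw [if_pos h]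
        refine Finset.sum_congr rfl fun x hx => ?_
        rw [Finset.sum_eq_single (x.1.degree, x.2.degree)]
        · simp
        · intro y _ hy
          by_cases h1 : x.1.degree = y.1
          · by_cases h2 : x.2.degree = y.2
            · exact absurd (Prod.ext h1 h2).symm hy
            · simp [h2]
          · simp [h1]
        · intro hn
          refine absurd ?_ hn
          rw [Finset.HasAntidiagonal.mem_antidiagonal] at hx ⊢
          rw [← h, ← hx, map_add]
      · rw [if_neg h]
        symm
        refine Finset.sum_eq_zero fun x hx => Finset.sum_eq_zero fun y hy => ?_
        rw [Finset.HasAntidiagonal.mem_antidiagonal] at hx hy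
        by_cases h1 : x.1.degree = y.1
        · by_cases h2 : x.2.degree = y.2
          · exact absurd (by rw [← hx, map_add, h1, h2, hy]) h
          · simp [h2]
        · simp [h1])

theorem coeff_coeff_dilate (f : Series) (i : ℕ) (m : Coord →₀ ℕ) :
    MvPowerSeries.coeff m (PowerSeries.coeff i (dilate f)) =
      if m.degree = i then MvPowerSeries.coeff m f else 0 := by
  simp [dilate, MvPowerSeries.coeff_homogeneousComponent]

theorem X_pow_mul_dilate_injective {n : ℕ} {f g : Series}
    (h : PowerSeries.X ^ n * dilate f = PowerSeries.X ^ n * dilate g) : f = g := by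
  ext m
  have := congrArg (fun F => MvPowerSeries.coeff m (PowerSeries.coeff (m.degree + n) F)) h
  simpa [PowerSeries.coeff_X_pow_mul, coeff_coeff_dilate] using this

theorem coeffDerivation_dilate (a : Coord) (f : Series) :
    coeffDerivation (MvPowerSeries.pderiv ℝ a) (dilate f) =
      PowerSeries.X * dilate (MvPowerSeries.pderiv ℝ a f) := by
  ext i m
  rw [coeff_coeffDerivation, MvPowerSeries.coeff_pderiv, coeff_coeff_dilate]
  cases i with
  | zero => simp
  | succ i =>
    rw [PowerSeries.coeff_succ_X_mul, coeff_coeff_dilate]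
    by_cases h : m.degree = i <;> simp [h, MvPowerSeries.coeff_pderiv]

theorem poisson_dilate (f g : Series) :
    poisson (fun a => coeffDerivation (MvPowerSeries.pderiv ℝ a)) (dilate g) (dilate f) =
      PowerSeries.X ^ 2 * dilate (seriesBracket f g) := by
  rw [seriesBracket_eq_poisson]
  simp only [poisson_apply, coeffDerivation_dilate, Fin.sum_univ_two, map_add, map_sub, map_mul]
  ring

/-- The inclusion of polynomials into formal power series, applied to coefficients. -/
def coeffCoe : PowerSeries Poly →ₐ[ℝ] PowerSeries Series :=
  PowerSeries.mapAlgHom (MvPolynomial.coeToMvPowerSeries.algHom ℝ)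

theorem coeff_coeffCoe (F : PowerSeries Poly) (n : ℕ) :
    PowerSeries.coeff n (coeffCoe F) = ((PowerSeries.coeff n F : Poly) : Series) := by
  rw [coeffCoe, PowerSeries.mapAlgHom_apply, PowerSeries.coeff_map]
  exact congrFun (congrArg DFunLike.coe MvPowerSeries.map_id) _

@[simp]
theorem coeffCoe_X : coeffCoe PowerSeries.X = PowerSeries.X := by
  rw [coeffCoe, PowerSeries.mapAlgHom_apply, PowerSeries.map_X]

theorem coeffCoe_poisson (F G : PowerSeries Poly) :
    coeffCoe (poisson (fun a => coeffDerivation (MvPolynomial.pderiv a)) G F) =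
      poisson (fun a => coeffDerivation (MvPowerSeries.pderiv ℝ a)) (coeffCoe G) (coeffCoe F) := by
  refine map_poisson _ _ (coeffCoe : PowerSeries Poly →+* PowerSeries Series) (fun a x => ?_) F G
  ext1 n
  simp only [RingHom.coe_coe, coeff_coeffCoe, coeff_coeffDerivation, MvPowerSeries.pderiv_coe]

/-! ### The change of variables generated by `W` -/

theorem isHomogeneous_bracket {f g : Poly} {a b : ℕ} (hf : f.IsHomogeneous (a + 1))
    (hg : g.IsHomogeneous (b + 1)) : (bracket f g).IsHomogeneous (a + b) := by
  refine MvPolynomial.IsHomogeneous.sum _ _ _ fun j _ => MvPolynomial.IsHomogeneous.sub ?_ ?_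
  · exact (hf.pderiv (i := Sum.inl j)).mul (hg.pderiv (i := Sum.inr j))
  · exact (hf.pderiv (i := Sum.inr j)).mul (hg.pderiv (i := Sum.inl j))

theorem isHomogeneous_triangle {F W : ℕ → Poly} {c : ℕ}
    (hF : ∀ i, (F i).IsHomogeneous (i + (c + 1))) (hW : IsGenerator W) (i j : ℕ) :
    (triangle F W i j).IsHomogeneous (i + j + (c + 1)) := by
  induction i generalizing j with
  | zero => simpa [triangle] using hF j
  | succ i ih =>
    rw [triangle]
    refine MvPolynomial.IsHomogeneous.add ?_ (MvPolynomial.IsHomogeneous.sum _ _ _ fun k hk => ?_)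
    · have := ih (j + 1)
      rwa [show i + (j + 1) + (c + 1) = i + 1 + j + (c + 1) by ring] at this
    · have hk' : k ≤ j := by simpa [Nat.lt_succ_iff] using hk
      rw [MvPolynomial.smul_eq_C_mul]
      have := isHomogeneous_bracket (a := i + (j - k) + c) (b := k + 2) (ih (j - k))
        (hW (k + 1) (by omega))
      have h2 := (MvPolynomial.isHomogeneous_C Coord ((j.choose k : ℕ) : ℝ)).mul this
      rwa [show 0 + (i + (j - k) + c + (k + 2)) = i + 1 + j + (c + 1) by omega] at h2

theorem dilate_lieTransform {F W : ℕ → Poly} {c : ℕ}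
    (hF : ∀ i, (F i).IsHomogeneous (i + (c + 1))) (hW : IsGenerator W) :
    dilate (lieTransform F W) = PowerSeries.X ^ (c + 1) * coeffCoe
      (depritTransform MvPolynomial.pderiv (expSeries fun k => W (k + 1)) (expSeries F)) := by
  ext i m
  rw [coeff_coeff_dilate, PowerSeries.coeff_X_pow_mul']
  have hcoeff : ∀ i, m.degree ≠ i + (c + 1) → MvPolynomial.coeff m (triangle F W i 0) = 0 :=
    fun i hi => (isHomogeneous_triangle hF hW i 0).coeff_eq_zero (by simpa using hi)
  have hlie : MvPowerSeries.coeff m (lieTransform F W) = ∑ i ∈ Finset.range (m.degree + 1),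
    ((i.factorial : ℝ))⁻¹ * MvPolynomial.coeff m (triangle F W i 0) := rfl
  by_cases hc : c + 1 ≤ i
  · rw [if_pos hc, coeff_coeffCoe, coeff_depritTransform_expSeries, MvPolynomial.coeff_coe,
      MvPolynomial.coeff_smul, smul_eq_mul]
    by_cases hm : m.degree = i
    · rw [if_pos hm, hlie, Finset.sum_eq_single (i - (c + 1))]
      · intro k _ hk
        rw [hcoeff k (by omega), mul_zero]
      · intro hn
        exact absurd (Finset.mem_range.2 (by omega)) hn
    · rw [if_neg hm, hcoeff _ (by omega), mul_zero]
  · rw [if_neg hc, map_zero]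
    by_cases hm : m.degree = i
    · rw [if_pos hm, hlie]
      exact Finset.sum_eq_zero fun k _ => by rw [hcoeff k (by omega), mul_zero]
    · rw [if_neg hm]

theorem expSeries_coordinate (a : Coord) :
    expSeries (fun i => if i = 0 then MvPolynomial.X a else 0) =
      PowerSeries.C (MvPolynomial.X a : Poly) := by
  ext1 n
  rw [coeff_expSeries, PowerSeries.coeff_C]
  split_ifs with h <;> simp [h]

theorem isHomogeneous_coordinate (a : Coord) (i : ℕ) :
    ((fun i => if i = 0 then MvPolynomial.X a else 0 : ℕ → Poly) i).IsHomogeneous (i + (0 + 1)) := by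
  by_cases h : i = 0
  · subst h; simpa using MvPolynomial.isHomogeneous_X ℝ a
  · simpa [h] using MvPolynomial.isHomogeneous_zero _ _ _

theorem dilate_lieChange {W : ℕ → Poly} (hW : IsGenerator W) (a : Coord) :
    dilate (lieChange W a) = coeffCoe (depritHom MvPolynomial.pderiv
      (expSeries fun k => W (k + 1)) (PowerSeries.X * PowerSeries.C (MvPolynomial.X a))) := by
  rw [lieChange, dilate_lieTransform (isHomogeneous_coordinate a) hW, expSeries_coordinate,
    map_mul, depritHom_X, map_mul, depritHom_apply,
    coeffCoe_X, zero_add, pow_one]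

theorem coeff_aeval_X_mul_C (K : Poly) (n : ℕ) :
    PowerSeries.coeff n (MvPolynomial.aeval
      (fun a => (PowerSeries.X * PowerSeries.C (MvPolynomial.X a) : PowerSeries Poly)) K) =
      MvPolynomial.homogeneousComponent n K := by
  induction K using MvPolynomial.induction_on' with
  | add p q hp hq => rw [map_add, map_add, map_add, hp, hq]
  | monomial d r =>
    have h1 : MvPolynomial.aeval
      (fun a => (PowerSeries.X * PowerSeries.C (MvPolynomial.X a) : PowerSeries Poly))
      (MvPolynomial.monomial d r) = PowerSeries.X ^ d.degree *
        PowerSeries.C (MvPolynomial.monomial d r) := by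
      rw [MvPolynomial.aeval_monomial, MvPolynomial.monomial_eq, map_mul, Finsupp.prod,
        Finsupp.prod, map_prod, Finsupp.degree_apply]
      simp only [mul_pow, Finset.prod_mul_distrib, Finset.prod_pow_eq_pow_sum, map_pow]
      rw [show algebraMap ℝ (PowerSeries Poly) r = PowerSeries.C (MvPolynomial.C r) from
        PowerSeries.algebraMap_apply]
      ring
    rw [h1, PowerSeries.coeff_X_pow_mul', PowerSeries.coeff_C]
    by_cases h : d.degree = n
    · rw [if_pos h.le, if_pos (by omega)]
      have : (MvPolynomial.monomial d r : Poly).IsHomogeneous n :=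
        MvPolynomial.isHomogeneous_monomial r h
      rw [MvPolynomial.homogeneousComponent_of_mem this, if_pos rfl]
    · have : (MvPolynomial.monomial d r : Poly).IsHomogeneous d.degree :=
        MvPolynomial.isHomogeneous_monomial r rfl
      rw [MvPolynomial.homogeneousComponent_of_mem this]
      split_ifs <;> first | rfl | omega

theorem aeval_X_mul_C (K : Poly) (h0 : MvPolynomial.homogeneousComponent 0 K = 0)
    (h1 : MvPolynomial.homogeneousComponent 1 K = 0) :
    MvPolynomial.aeval
      (fun a => (PowerSeries.X * PowerSeries.C (MvPolynomial.X a) : PowerSeries Poly)) K =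
      PowerSeries.X ^ 2 * expSeries (scaled K) := by
  ext1 n
  rw [coeff_aeval_X_mul_C]
  match n with
  | 0 => simp [h0, PowerSeries.coeff_X_pow_mul']
  | 1 => simp [h1, PowerSeries.coeff_X_pow_mul']
  | n + 2 =>
    rw [PowerSeries.coeff_X_pow_mul, coeff_expSeries, scaled, smul_smul,
      inv_mul_cancel₀ (by positivity), one_smul]

theorem isHomogeneous_scaled (K : Poly) (i : ℕ) : (scaled K i).IsHomogeneous (i + (1 + 1)) := by
  rw [scaled, MvPolynomial.smul_eq_C_mul]
  simpa using (MvPolynomial.isHomogeneous_C Coord ((i.factorial : ℕ) : ℝ)).mul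
    (MvPolynomial.homogeneousComponent_isHomogeneous (i + 2) K)

/-- The Lie transform of a function is its composition with the change of variables generated by
`W`. -/
theorem lieTransform_scaled {W : ℕ → Poly} (hW : IsGenerator W) (K : Poly)
    (h0 : MvPolynomial.homogeneousComponent 0 K = 0)
    (h1 : MvPolynomial.homogeneousComponent 1 K = 0) :
    lieTransform (scaled K) W = MvPolynomial.aeval (lieChange W) K := by
  apply X_pow_mul_dilate_injective (n := 0)
  rw [pow_zero, one_mul, one_mul, dilate_lieTransform (isHomogeneous_scaled K) hW,
    MvPolynomial.comp_aeval_apply]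
  have h2 : (fun a => dilate (lieChange W a)) = fun a => coeffCoe.comp (depritHom
      MvPolynomial.pderiv (expSeries fun k => W (k + 1)))
        (PowerSeries.X * PowerSeries.C (MvPolynomial.X a) : PowerSeries Poly) :=
    funext fun a => dilate_lieChange hW a
  rw [h2, ← MvPolynomial.comp_aeval_apply, aeval_X_mul_C K h0 h1, AlgHom.comp_apply, map_mul,
    map_pow, depritHom_X, map_mul, map_pow, coeffCoe_X, depritHom_apply]

theorem pderiv_comm (a b : Coord) (f : Poly) : MvPolynomial.pderiv a (MvPolynomial.pderiv b f) =
    MvPolynomial.pderiv b (MvPolynomial.pderiv a f) := by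
  ext m
  by_cases h : a = b
  · rw [h]
  · simp only [MvPolynomial.coeff_pderiv, Finsupp.add_apply, Finsupp.single_apply]
    rw [if_neg h, if_neg (Ne.symm h), add_right_comm]
    push_cast
    ring

theorem seriesBracket_lieChange {W : ℕ → Poly} (hW : IsGenerator W) (a b : Coord) {r : ℝ}
    (h : bracket (MvPolynomial.X a) (MvPolynomial.X b) = MvPolynomial.C r) :
    seriesBracket (lieChange W a) (lieChange W b) = algebraMap ℝ Series r := by
  apply X_pow_mul_dilate_injective (n := 2)
  rw [← poisson_dilate, dilate_lieChange hW, dilate_lieChange hW, ← coeffCoe_poisson,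
    depritHom_apply, depritHom_apply, ← poisson_depritTransform _ pderiv_comm]
  have h2 : poisson (fun a => coeffDerivation (MvPolynomial.pderiv a))
      (PowerSeries.X * PowerSeries.C (MvPolynomial.X b : Poly))
      (PowerSeries.X * PowerSeries.C (MvPolynomial.X a : Poly)) =
      PowerSeries.X ^ 2 * algebraMap ℝ (PowerSeries Poly) r := by
    have hd : ∀ c e, coeffDerivation (MvPolynomial.pderiv e)
        (PowerSeries.X * PowerSeries.C (MvPolynomial.X c : Poly)) =
        PowerSeries.X * PowerSeries.C (MvPolynomial.pderiv e (MvPolynomial.X c : Poly)) := by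
      intro c e; ext1 n
      rw [coeff_coeffDerivation, PowerSeries.coeff_mul_C, PowerSeries.coeff_mul_C,
        PowerSeries.coeff_X]; split_ifs <;> simp
    have h3 : algebraMap ℝ (PowerSeries Poly) r = PowerSeries.C (bracket (MvPolynomial.X a)
      (MvPolynomial.X b)) := by rw [h]; exact PowerSeries.algebraMap_apply
    rw [h3, bracket_eq_poisson, poisson_apply, poisson_apply]
    simp only [hd, Fin.sum_univ_two, map_add, map_sub, map_mul]
    ring
  rw [h2, ← depritHom_apply, map_mul, map_pow, depritHom_X, AlgHom.commutes, map_mul,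
    AlgHom.commutes, AlgHom.commutes, map_pow, coeffCoe_X]

/-- Any generating function generates a formal near-identity symplectic change of variables. -/
theorem isNearIdentitySymplectic_lieChange {W : ℕ → Poly} (hW : IsGenerator W) :
    IsNearIdentitySymplectic (lieChange W) where
  near_identity a m hm := by
    rw [MvPowerSeries.coeff_X]
    have hhom := fun i => (isHomogeneous_triangle (isHomogeneous_coordinate a) hW i 0).coeff_eq_zero
      (d := m)
    change ∑ i ∈ Finset.range (m.degree + 1), _ = _
    rw [Finset.sum_eq_single 0]
    · simp [triangle, MvPolynomial.coeff_X, eq_comm]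
    · intro i _ hi
      rw [hhom i (by omega), mul_zero]
    · simp
  bracket_q_q i j := by
    rw [seriesBracket_lieChange hW _ _ (r := 0), map_zero]
    simp [bracket, MvPolynomial.pderiv_X, Pi.single_apply]
  bracket_p_p i j := by
    rw [seriesBracket_lieChange hW _ _ (r := 0), map_zero]
    simp [bracket, MvPolynomial.pderiv_X, Pi.single_apply]
  bracket_q_p i j := by
    rw [seriesBracket_lieChange hW _ _ (r := if i = j then 1 else 0)]
    · split_ifs <;> simp
    · fin_cases i <;> fin_cases j <;> simp [bracket, MvPolynomial.pderiv_X, Pi.single_apply]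

/-! ### The filtration of formal power series by order -/

section Filtration

variable {σ τ : Type*}

/-- The ideal of the formal power series without terms of degree less than `n`. -/
def orderIdeal (σ : Type*) (n : ℕ) : Ideal (MvPowerSeries σ ℝ) where
  carrier := {f | (n : ℕ∞) ≤ f.order}
  zero_mem' := by simp
  add_mem' ha hb := le_trans (le_min ha hb) MvPowerSeries.min_order_le_add
  smul_mem' c f hf := le_trans (le_trans hf le_add_self) MvPowerSeries.le_order_mul

theorem mem_orderIdeal {n : ℕ} {f : MvPowerSeries σ ℝ} : f ∈ orderIdeal σ n ↔
    ∀ m : σ →₀ ℕ, m.degree < n → MvPowerSeries.coeff m f = 0 :=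
  ⟨fun h _ hm => MvPowerSeries.coeff_of_lt_order (lt_of_lt_of_le (by exact_mod_cast hm) h),
    fun h => MvPowerSeries.nat_le_order h⟩

theorem orderIdeal_mono {n k : ℕ} (h : n ≤ k) {f : MvPowerSeries σ ℝ} (hf : f ∈ orderIdeal σ k) :
    f ∈ orderIdeal σ n :=
  mem_orderIdeal.2 fun m hm => mem_orderIdeal.1 hf m (hm.trans_le h)

theorem mem_orderIdeal_zero (f : MvPowerSeries σ ℝ) : f ∈ orderIdeal σ 0 :=
  mem_orderIdeal.2 fun _ hm => absurd hm (Nat.not_lt_zero _)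

theorem mul_mem_orderIdeal {a b : ℕ} {f g : MvPowerSeries σ ℝ} (hf : f ∈ orderIdeal σ a)
    (hg : g ∈ orderIdeal σ b) : f * g ∈ orderIdeal σ (a + b) :=
  le_trans (by push_cast; exact add_le_add hf hg) MvPowerSeries.le_order_mul

theorem smul_mem_orderIdeal {n : ℕ} (c : ℝ) {f : MvPowerSeries σ ℝ} (hf : f ∈ orderIdeal σ n) :
    c • f ∈ orderIdeal σ n :=
  mem_orderIdeal.2 fun m hm => by rw [MvPowerSeries.coeff_smul, mem_orderIdeal.1 hf m hm, mul_zero]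

theorem pderiv_mem_orderIdeal {n : ℕ} {f : MvPowerSeries σ ℝ} (hf : f ∈ orderIdeal σ (n + 1))
    (a : σ) : MvPowerSeries.pderiv ℝ a f ∈ orderIdeal σ n :=
  mem_orderIdeal.2 fun m hm => by
    rw [MvPowerSeries.coeff_pderiv, mem_orderIdeal.1 hf, zero_mul]
    rw [map_add, Finsupp.degree_single]
    omega

theorem eq_of_forall_sub_mem_orderIdeal {f g : MvPowerSeries σ ℝ}
    (h : ∀ n, f - g ∈ orderIdeal σ n) : f = g := by
  ext m
  have := mem_orderIdeal.1 (h (m.degree + 1)) m (Nat.lt_succ_self _)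
  rwa [map_sub, sub_eq_zero] at this

theorem sub_truncTotal_mem_orderIdeal [Finite σ] (n : ℕ) (f : MvPowerSeries σ ℝ) :
    f - (MvPowerSeries.truncTotal n f : MvPolynomial σ ℝ) ∈ orderIdeal σ n :=
  mem_orderIdeal.2 fun m hm => by
    rw [map_sub, MvPolynomial.coeff_coe, MvPowerSeries.coeff_truncTotal _ hm, sub_self]

theorem X_mem_orderIdeal (a : σ) : (MvPowerSeries.X a : MvPowerSeries σ ℝ) ∈ orderIdeal σ 1 :=
  mem_orderIdeal.2 fun m hm => by
    classical
    rw [MvPowerSeries.coeff_X, if_neg]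
    rintro rfl
    simp at hm

/-! ### Substitution and the filtration -/

theorem hasSubst_of_mem [Finite σ] {A : σ → MvPowerSeries τ ℝ} {c : ℕ} (hc : 1 ≤ c)
    (hA : ∀ i, A i ∈ orderIdeal τ c) : MvPowerSeries.HasSubst A :=
  MvPowerSeries.hasSubst_of_constantCoeff_zero fun i => by
    rw [← MvPowerSeries.coeff_zero_eq_constantCoeff_apply]
    exact mem_orderIdeal.1 (hA i) 0 (by rw [map_zero]; exact hc)

theorem pow_mem_orderIdeal {c : ℕ} {f : MvPowerSeries σ ℝ} (hf : f ∈ orderIdeal σ c) (n : ℕ) :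
    f ^ n ∈ orderIdeal σ (c * n) := by
  induction n with
  | zero => exact mem_orderIdeal_zero _
  | succ n ih => rw [pow_succ]; exact mul_mem_orderIdeal ih hf

theorem prod_mem_orderIdeal {A : σ → MvPowerSeries τ ℝ} {c : ℕ}
    (hA : ∀ i, A i ∈ orderIdeal τ c) (m : σ →₀ ℕ) :
    (m.prod fun i e => A i ^ e) ∈ orderIdeal τ (c * m.degree) := by
  induction m using Finsupp.induction_linear with
  | zero => exact mem_orderIdeal_zero _
  | add f g hf hg =>
    rw [Finsupp.prod_add_index' (by simp) (by intros; rw [pow_add]), map_add, mul_add]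
    exact mul_mem_orderIdeal hf hg
  | single a b =>
    rw [Finsupp.prod_single_index (by simp), Finsupp.degree_single]
    exact pow_mem_orderIdeal (hA a) b

theorem mul_sub_mul_mem_orderIdeal {a b k : ℕ} {f f' g g' : MvPowerSeries σ ℝ}
    (hf' : f' ∈ orderIdeal σ a) (hg : g ∈ orderIdeal σ b)
    (hf : f' - f ∈ orderIdeal σ (a + k)) (hgg : g' - g ∈ orderIdeal σ (b + k)) :
    f' * g' - f * g ∈ orderIdeal σ (a + b + k) := by
  have h1 := mul_mem_orderIdeal hf' hgg
  have h2 := mul_mem_orderIdeal hf hg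
  rw [show a + (b + k) = a + b + k by ring] at h1
  rw [show a + k + b = a + b + k by ring] at h2
  have := add_mem h1 h2
  rwa [show f' * (g' - g) + (f' - f) * g = f' * g' - f * g by ring] at this

theorem prod_sub_prod_mem_orderIdeal {A B : σ → MvPowerSeries τ ℝ} {c k : ℕ}
    (hA : ∀ i, A i ∈ orderIdeal τ c) (hB : ∀ i, B i ∈ orderIdeal τ c)
    (hAB : ∀ i, B i - A i ∈ orderIdeal τ (c + k)) (m : σ →₀ ℕ) :
    (m.prod fun i e => B i ^ e) - (m.prod fun i e => A i ^ e) ∈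
      orderIdeal τ (c * m.degree + k) := by
  induction m using Finsupp.induction_linear with
  | zero => simp
  | add f g hf hg =>
    rw [Finsupp.prod_add_index' (by simp) (by intros; rw [pow_add]),
      Finsupp.prod_add_index' (by simp) (by intros; rw [pow_add]), map_add, mul_add]
    exact mul_sub_mul_mem_orderIdeal (prod_mem_orderIdeal hB f) (prod_mem_orderIdeal hA g) hf hg
  | single a b =>
    rw [Finsupp.prod_single_index (by simp), Finsupp.prod_single_index (by simp),
      Finsupp.degree_single]
    induction b with
    | zero => simp
    | succ b ih =>
      rw [pow_succ, pow_succ]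
      exact mul_sub_mul_mem_orderIdeal (pow_mem_orderIdeal (hB a) b) (hA a) ih (hAB a)

theorem subst_mem_orderIdeal [Finite σ] {A : σ → MvPowerSeries τ ℝ} {c r : ℕ} (hc : 1 ≤ c)
    (hA : ∀ i, A i ∈ orderIdeal τ c) {f : MvPowerSeries σ ℝ} (hf : f ∈ orderIdeal σ r) :
    MvPowerSeries.subst A f ∈ orderIdeal τ (c * r) :=
  mem_orderIdeal.2 fun m hm => by
    rw [MvPowerSeries.coeff_subst (hasSubst_of_mem hc hA)]
    refine finsum_eq_zero_of_forall_eq_zero fun d => ?_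
    by_cases hd : d.degree < r
    · rw [mem_orderIdeal.1 hf d hd, zero_smul]
    · rw [mem_orderIdeal.1 (prod_mem_orderIdeal hA d) m, smul_zero]
      exact lt_of_lt_of_le hm (Nat.mul_le_mul_left c (not_lt.1 hd))

/-- Changing the substituted series by terms of order `c + k` changes the result of the
substitution into a series of order `r` by terms of order `c * r + k`. -/
theorem subst_sub_subst_mem_orderIdeal [Finite σ] {A B : σ → MvPowerSeries τ ℝ} {c k r : ℕ}
    (hc : 1 ≤ c) (hA : ∀ i, A i ∈ orderIdeal τ c) (hB : ∀ i, B i ∈ orderIdeal τ c)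
    (hAB : ∀ i, B i - A i ∈ orderIdeal τ (c + k)) {f : MvPowerSeries σ ℝ}
    (hf : f ∈ orderIdeal σ r) :
    MvPowerSeries.subst B f - MvPowerSeries.subst A f ∈ orderIdeal τ (c * r + k) :=
  mem_orderIdeal.2 fun m hm => by
    rw [map_sub, MvPowerSeries.coeff_subst (hasSubst_of_mem hc hA),
      MvPowerSeries.coeff_subst (hasSubst_of_mem hc hB), sub_eq_zero]
    refine finsum_congr fun d => ?_
    by_cases hd : d.degree < r
    · rw [mem_orderIdeal.1 hf d hd, zero_smul, zero_smul]
    · have := mem_orderIdeal.1 (prod_sub_prod_mem_orderIdeal hA hB hAB d) m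
        (lt_of_lt_of_le hm (Nat.add_le_add_right (Nat.mul_le_mul_left c (not_lt.1 hd)) k))
      rw [map_sub, sub_eq_zero] at this
      rw [this]

end Filtration

theorem poisson_mem_orderIdeal {a b : ℕ} {f g : Series} (hf : f ∈ orderIdeal Coord (a + 1))
    (hg : g ∈ orderIdeal Coord (b + 1)) :
    poisson (MvPowerSeries.pderiv ℝ) g f ∈ orderIdeal Coord (a + b) := by
  rw [poisson_apply]
  exact sum_mem fun j _ => sub_mem
    (mul_mem_orderIdeal (pderiv_mem_orderIdeal hf _) (pderiv_mem_orderIdeal hg _))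
    (mul_mem_orderIdeal (pderiv_mem_orderIdeal hf _) (pderiv_mem_orderIdeal hg _))

/-! ### Formal symplectic changes of variables -/

/-- The chain rule. -/
theorem pderiv_subst {σ : Type*} [Fintype σ] {A : σ → Series}
    (hA : ∀ a, A a ∈ orderIdeal Coord 1) (k : Coord) (f : MvPowerSeries σ ℝ) :
    MvPowerSeries.pderiv ℝ k (MvPowerSeries.subst A f) =
      ∑ a, MvPowerSeries.subst A (MvPowerSeries.pderiv ℝ a f) *
        MvPowerSeries.pderiv ℝ k (A a) := by
  classical
  have hs : MvPowerSeries.HasSubst A := hasSubst_of_mem le_rfl hA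
  have hpoly : ∀ p : MvPolynomial σ ℝ,
      MvPowerSeries.pderiv ℝ k (MvPowerSeries.subst A (p : MvPowerSeries σ ℝ)) =
      ∑ a, MvPowerSeries.subst A (MvPowerSeries.pderiv ℝ a (p : MvPowerSeries σ ℝ)) *
        MvPowerSeries.pderiv ℝ k (A a) := by
    intro p
    simp only [MvPowerSeries.pderiv_coe, MvPowerSeries.subst_coe]
    induction p using MvPolynomial.induction_on with
    | C r => simp
    | add p q hp hq => simp only [map_add, hp, hq, add_mul, Finset.sum_add_distrib]
    | mul_X p b hp =>
      simp only [map_mul, Derivation.leibniz, smul_eq_mul, map_add, MvPolynomial.aeval_X, hp,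
        add_mul, Finset.sum_add_distrib, Finset.mul_sum, MvPolynomial.pderiv_X]
      congr 1
      · rw [Finset.sum_eq_single b]
        · simp
        · intro a _ hab; simp [Ne.symm hab]
        · simp
      · exact Finset.sum_congr rfl fun a _ => by ring
  apply eq_of_forall_sub_mem_orderIdeal
  intro n
  obtain ⟨p, r, hr, rfl⟩ : ∃ (p : MvPolynomial σ ℝ) (r : MvPowerSeries σ ℝ),
      r ∈ orderIdeal σ (n + 1) ∧ f = p + r :=
    ⟨_, _, sub_truncTotal_mem_orderIdeal (n + 1) f, by ring⟩
  simp only [map_add, MvPowerSeries.subst_add hs, hpoly, add_mul, Finset.sum_add_distrib]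
  rw [add_sub_add_left_eq_sub]
  refine sub_mem (pderiv_mem_orderIdeal ?_ k) (sum_mem fun a _ => Ideal.mul_mem_right _ _ ?_)
  · simpa using subst_mem_orderIdeal le_rfl hA hr
  · simpa using subst_mem_orderIdeal le_rfl hA (pderiv_mem_orderIdeal hr a)

theorem poisson_subst {σ : Type*} [Fintype σ] {A : σ → Series}
    (hA : ∀ a, A a ∈ orderIdeal Coord 1) (f : MvPowerSeries σ ℝ) (G : Series) :
    poisson (MvPowerSeries.pderiv ℝ) G (MvPowerSeries.subst A f) =
      ∑ a, MvPowerSeries.subst A (MvPowerSeries.pderiv ℝ a f) *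
        poisson (MvPowerSeries.pderiv ℝ) G (A a) := by
  simp only [poisson_apply, pderiv_subst hA _ f, Fin.sum_univ_two, Finset.sum_mul, mul_add,
    mul_sub, Finset.sum_add_distrib, Finset.sum_sub_distrib]
  congr 1 <;> congr 1 <;> exact Finset.sum_congr rfl fun _ _ => by ring

/-- The canonical brackets `{z_a, z_b}` of the coordinates. -/
def canonicalBracket (a b : Coord) : ℝ :=
  MvPolynomial.coeff 0 (bracket (MvPolynomial.X a) (MvPolynomial.X b))

theorem poisson_X_X (a b : Coord) : poisson (MvPowerSeries.pderiv ℝ)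
    (MvPowerSeries.X b : Series) (MvPowerSeries.X a : Series) =
      algebraMap ℝ Series (canonicalBracket a b) := by
  rcases a with a | a <;> rcases b with b | b <;> fin_cases a <;> fin_cases b <;>
    simp [poisson_apply, canonicalBracket, bracket, MvPowerSeries.pderiv_X,
      MvPolynomial.pderiv_X, Pi.single_apply]

theorem IsNearIdentitySymplectic.sub_mem {Φ : Coord → Series} (h : IsNearIdentitySymplectic Φ)
    (a : Coord) : Φ a - MvPowerSeries.X a ∈ orderIdeal Coord 2 :=
  mem_orderIdeal.2 fun m hm => by
    rw [map_sub, h.near_identity a m (by omega), sub_self]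

theorem IsNearIdentitySymplectic.poisson_eq {Φ : Coord → Series}
    (h : IsNearIdentitySymplectic Φ) (a b : Coord) :
    poisson (MvPowerSeries.pderiv ℝ) (Φ b) (Φ a) =
      algebraMap ℝ Series (canonicalBracket a b) := by
  rw [← poisson_X_X]
  have hqq := h.bracket_q_q
  have hpp := h.bracket_p_p
  have hqp := h.bracket_q_p
  simp only [seriesBracket_eq_poisson] at hqq hpp hqp
  rcases a with a | a <;> rcases b with b | b
  · rw [hqq, poisson_X_X]; simp [canonicalBracket, bracket, MvPolynomial.pderiv_X]
  · rw [hqp, poisson_X_X]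
    fin_cases a <;> fin_cases b <;>
      simp [canonicalBracket, bracket, MvPolynomial.pderiv_X, Pi.single_apply]
  · rw [poisson_antisymm, hqp, poisson_X_X]
    fin_cases a <;> fin_cases b <;>
      simp [canonicalBracket, bracket, MvPolynomial.pderiv_X, Pi.single_apply]
  · rw [hpp, poisson_X_X]; simp [canonicalBracket, bracket, MvPolynomial.pderiv_X]

/-- A family of formal power series that is the identity up to terms of order 2 and satisfies the
canonical relations, which are here indexed by pairs of coordinates. -/
structure IsCanonical (Φ : Coord → Series) : Prop where
  sub_mem : ∀ a, Φ a - MvPowerSeries.X a ∈ orderIdeal Coord 2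
  poisson_eq : ∀ a b, poisson (MvPowerSeries.pderiv ℝ) (Φ b) (Φ a) =
    algebraMap ℝ Series (canonicalBracket a b)

theorem IsNearIdentitySymplectic.isCanonical {Φ : Coord → Series}
    (h : IsNearIdentitySymplectic Φ) : IsCanonical Φ :=
  ⟨h.sub_mem, h.poisson_eq⟩

namespace IsCanonical

variable {Φ : Coord → Series} (h : IsCanonical Φ)

include h

theorem mem_one (a : Coord) : Φ a ∈ orderIdeal Coord 1 := by
  have := add_mem (orderIdeal_mono one_le_two (h.sub_mem a)) (X_mem_orderIdeal a)
  rwa [sub_add_cancel] at this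

theorem hasSubst : MvPowerSeries.HasSubst Φ := hasSubst_of_mem le_rfl h.mem_one

/-- A formal symplectic change of variables is a homomorphism of Poisson algebras. -/
theorem subst_poisson (f g : Series) :
    MvPowerSeries.subst Φ (poisson (MvPowerSeries.pderiv ℝ) g f) =
      poisson (MvPowerSeries.pderiv ℝ) (MvPowerSeries.subst Φ g) (MvPowerSeries.subst Φ f) := by
  rw [poisson_subst h.mem_one]
  have h2 : ∀ a, poisson (MvPowerSeries.pderiv ℝ) (MvPowerSeries.subst Φ g) (Φ a) =
      ∑ b, MvPowerSeries.subst Φ (MvPowerSeries.pderiv ℝ b g) *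
        algebraMap ℝ Series (canonicalBracket a b) := by
    intro a
    rw [poisson_antisymm, poisson_subst h.mem_one, ← Finset.sum_neg_distrib]
    refine Finset.sum_congr rfl fun b _ => ?_
    rw [poisson_antisymm, h.poisson_eq, mul_neg, neg_neg]
  simp only [h2]
  simp only [poisson_apply, Fintype.sum_sum_type, Fin.sum_univ_two,
    MvPowerSeries.subst_add h.hasSubst, MvPowerSeries.subst_sub h.hasSubst,
    MvPowerSeries.subst_mul h.hasSubst]
  simp [canonicalBracket, bracket, MvPolynomial.pderiv_X, Pi.single_apply]
  ring

theorem subst_sub_mem {n : ℕ} {f : Series} (hf : f ∈ orderIdeal Coord n) :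
    MvPowerSeries.subst Φ f - f ∈ orderIdeal Coord (n + 1) := by
  have := subst_sub_subst_mem_orderIdeal le_rfl X_mem_orderIdeal h.mem_one (k := 1) h.sub_mem hf
  rwa [MvPowerSeries.subst_self, id, one_mul] at this

theorem subst_injective {f g : Series}
    (hfg : MvPowerSeries.subst Φ f = MvPowerSeries.subst Φ g) : f = g := by
  apply eq_of_forall_sub_mem_orderIdeal
  intro n
  induction n with
  | zero => exact mem_orderIdeal_zero _
  | succ n ih =>
    have := h.subst_sub_mem ih
    rw [MvPowerSeries.subst_sub h.hasSubst, hfg, sub_self, zero_sub] at this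
    exact (neg_mem_iff).1 this

/-- Successive approximation solves `f ∘ Φ = g`. -/
theorem exists_subst_eq (g : Series) : ∃ f : Series, MvPowerSeries.subst Φ f = g := by
  let F : ℕ → Series := fun n => (fun f : Series => f + (g - MvPowerSeries.subst Φ f))^[n] 0
  have hF : ∀ n, F (n + 1) = F n + (g - MvPowerSeries.subst Φ (F n)) :=
    fun n => Function.iterate_succ_apply' _ _ _
  have h1 : ∀ n, g - MvPowerSeries.subst Φ (F n) ∈ orderIdeal Coord n := by
    intro n
    induction n with
    | zero => exact mem_orderIdeal_zero _
    | succ n ih =>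
      rw [hF, MvPowerSeries.subst_add h.hasSubst]
      have := neg_mem (h.subst_sub_mem ih)
      rw [neg_sub] at this
      rwa [sub_add_eq_sub_sub]
  have h2 : ∀ n k, F (n + k) - F n ∈ orderIdeal Coord n := by
    intro n k
    induction k with
    | zero => simp
    | succ k ih =>
      have := add_mem ih (orderIdeal_mono (Nat.le_add_right n k) (h1 (n + k)))
      rw [← add_assoc, hF]
      rwa [sub_add_eq_add_sub] at this
  let f : Series := fun m => MvPowerSeries.coeff m (F (m.degree + 1))
  have h3 : ∀ n, f - F n ∈ orderIdeal Coord n := fun n => mem_orderIdeal.2 fun m hm => by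
    obtain ⟨k, rfl⟩ := Nat.exists_eq_add_of_le (Nat.succ_le_of_lt hm)
    have := mem_orderIdeal.1 (h2 (m.degree + 1) k) m (Nat.lt_succ_self _)
    rw [map_sub, sub_eq_zero] at this ⊢
    exact this.symm
  refine ⟨f, ?_⟩
  apply eq_of_forall_sub_mem_orderIdeal
  intro n
  have h4 := subst_mem_orderIdeal le_rfl h.mem_one (h3 n)
  rw [one_mul, MvPowerSeries.subst_sub h.hasSubst] at h4
  have := _root_.sub_mem h4 (h1 n)
  rwa [show MvPowerSeries.subst Φ f - MvPowerSeries.subst Φ (F n) -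
    (g - MvPowerSeries.subst Φ (F n)) = MvPowerSeries.subst Φ f - g by ring] at this

end IsCanonical

/-- Two formal symplectic changes of variables differ by a third one. -/
theorem IsCanonical.exists_comp_eq {Φ Φ' : Coord → Series} (h : IsCanonical Φ)
    (h' : IsCanonical Φ') : ∃ χ, IsCanonical χ ∧
      ∀ f : Series, MvPowerSeries.subst χ (MvPowerSeries.subst Φ f) = MvPowerSeries.subst Φ' f := by
  choose Ψ hΨ using fun a => h.exists_subst_eq (MvPowerSeries.X a)
  have hΨX : ∀ a, Ψ a - MvPowerSeries.X a ∈ orderIdeal Coord 2 := by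
    have h0 : ∀ n, (∀ a, Ψ a ∈ orderIdeal Coord n) →
        ∀ a, Ψ a - MvPowerSeries.X a ∈ orderIdeal Coord (n + 1) := fun n hn a => by
      have := neg_mem (h.subst_sub_mem (hn a))
      rwa [hΨ, neg_sub] at this
    refine h0 1 fun a => ?_
    have := add_mem (h0 0 (fun a => mem_orderIdeal_zero _) a) (X_mem_orderIdeal a)
    rwa [sub_add_cancel] at this
  have hΨ1 : ∀ a, Ψ a ∈ orderIdeal Coord 1 := fun a => by
    have := add_mem (orderIdeal_mono one_le_two (hΨX a)) (X_mem_orderIdeal a)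
    rwa [sub_add_cancel] at this
  have hΨs : MvPowerSeries.HasSubst Ψ := hasSubst_of_mem le_rfl hΨ1
  have hinv : ∀ f : Series, MvPowerSeries.subst Ψ (MvPowerSeries.subst Φ f) = f := fun f => by
    apply h.subst_injective
    rw [MvPowerSeries.subst_comp_subst_apply hΨs h.hasSubst, funext hΨ, MvPowerSeries.subst_self,
      id]
  have hΨp : ∀ a b, poisson (MvPowerSeries.pderiv ℝ) (Ψ b) (Ψ a) =
      algebraMap ℝ Series (canonicalBracket a b) := fun a b => by
    apply h.subst_injective
    rw [h.subst_poisson, hΨ, hΨ, poisson_X_X, ← MvPowerSeries.coe_substAlgHom h.hasSubst,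
      AlgHom.commutes]
  refine ⟨fun a => MvPowerSeries.subst Φ' (Ψ a), ⟨fun a => ?_, fun a b => ?_⟩, fun f => ?_⟩
  · have := add_mem (h'.subst_sub_mem (hΨ1 a)) (hΨX a)
    rwa [sub_add_sub_cancel] at this
  · rw [← h'.subst_poisson, hΨp, ← MvPowerSeries.coe_substAlgHom h'.hasSubst, AlgHom.commutes]
  · rw [← MvPowerSeries.subst_comp_subst_apply hΨs h'.hasSubst, hinv]

/-! ### The actions of `J₁` and `J₂` -/

section SeriesInvariants

open MvPowerSeries (coeff subst)

local notation "∂" => MvPowerSeries.pderiv ℝ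

theorem coeff_single_add_X_mul {σ : Type*} (a : σ) (m : σ →₀ ℕ) (f : MvPowerSeries σ ℝ) :
    coeff (Finsupp.single a 1 + m) (MvPowerSeries.X a * f) = coeff m f := by
  rw [MvPowerSeries.X, MvPowerSeries.coeff_add_monomial_mul, one_mul]

theorem coeff_X_mul_of_eq_zero {σ : Type*} (a : σ) {m : σ →₀ ℕ} (hm : m a = 0)
    (f : MvPowerSeries σ ℝ) : coeff m (MvPowerSeries.X a * f) = 0 :=
  (MvPowerSeries.X_dvd_iff.1 (dvd_mul_right _ f)) m hm

theorem exists_eq_single_add {σ : Type*} {a : σ} {m : σ →₀ ℕ} (hm : m a ≠ 0) :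
    ∃ m', m = Finsupp.single a 1 + m' := by
  classical
  refine ⟨m - Finsupp.single a 1, (add_tsub_cancel_of_le ?_).symm⟩
  rw [Finsupp.single_le_iff]
  omega

theorem coeff_X_mul_pderiv (a : Coord) (m : Coord →₀ ℕ) (f : Series) :
    coeff m (MvPowerSeries.X a * ∂ a f) = m a * coeff m f := by
  by_cases h : m a = 0
  · rw [coeff_X_mul_of_eq_zero a h, h]; simp
  · obtain ⟨m', rfl⟩ := exists_eq_single_add h
    rw [coeff_single_add_X_mul, MvPowerSeries.coeff_pderiv, add_comm m', mul_comm]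
    congr 1
    simp [add_comm]

/-- The weight of a monomial under the hyperbolic flow of `J₁`: its degree in the positions minus
its degree in the momenta. -/
def hypWeight (m : Coord →₀ ℕ) : ℤ :=
  m (Sum.inl 0) + m (Sum.inl 1) - (m (Sum.inr 0) + m (Sum.inr 1))

theorem degree_coord (m : Coord →₀ ℕ) : m.degree =
    m (Sum.inl 0) + m (Sum.inl 1) + (m (Sum.inr 0) + m (Sum.inr 1)) := by
  rw [Finsupp.degree_eq_sum, Fintype.sum_sum_type, Fin.sum_univ_two, Fin.sum_univ_two]

theorem coe_J₁ : ((J₁ : Poly) : Series) = MvPowerSeries.X (Sum.inl 0) * MvPowerSeries.X (Sum.inr 0)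
    + MvPowerSeries.X (Sum.inl 1) * MvPowerSeries.X (Sum.inr 1) := by
  simp [J₁, q, p]

theorem coe_J₂ : ((J₂ : Poly) : Series) = MvPowerSeries.X (Sum.inl 0) * MvPowerSeries.X (Sum.inr 1)
    - MvPowerSeries.X (Sum.inl 1) * MvPowerSeries.X (Sum.inr 0) := by
  rw [eq_sub_iff_add_eq]
  have : (J₂ + q 1 * p 0 : Poly) = q 0 * p 1 := by rw [J₂]; ring
  simpa [q, p] using congrArg (fun f : Poly => (f : Series)) this

theorem J₁_mem : ((J₁ : Poly) : Series) ∈ orderIdeal Coord 2 := by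
  rw [coe_J₁]
  exact add_mem (mul_mem_orderIdeal (X_mem_orderIdeal _) (X_mem_orderIdeal _))
    (mul_mem_orderIdeal (X_mem_orderIdeal _) (X_mem_orderIdeal _))

theorem J₂_mem : ((J₂ : Poly) : Series) ∈ orderIdeal Coord 2 := by
  rw [coe_J₂]
  exact sub_mem (mul_mem_orderIdeal (X_mem_orderIdeal _) (X_mem_orderIdeal _))
    (mul_mem_orderIdeal (X_mem_orderIdeal _) (X_mem_orderIdeal _))

theorem poisson_J₁ (f : Series) : poisson ∂ (J₁ : Poly) f =
    MvPowerSeries.X (Sum.inl 0) * ∂ (Sum.inl 0) f + MvPowerSeries.X (Sum.inl 1) * ∂ (Sum.inl 1) f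
    - (MvPowerSeries.X (Sum.inr 0) * ∂ (Sum.inr 0) f +
      MvPowerSeries.X (Sum.inr 1) * ∂ (Sum.inr 1) f) := by
  rw [poisson_apply, coe_J₁]
  simp [MvPowerSeries.pderiv_X, Derivation.leibniz, Pi.single_apply, Fin.sum_univ_two]
  ring

theorem poisson_J₂ (f : Series) : poisson ∂ (J₂ : Poly) f =
    MvPowerSeries.X (Sum.inl 0) * ∂ (Sum.inl 1) f - MvPowerSeries.X (Sum.inl 1) * ∂ (Sum.inl 0) f
    + (MvPowerSeries.X (Sum.inr 0) * ∂ (Sum.inr 1) f -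
      MvPowerSeries.X (Sum.inr 1) * ∂ (Sum.inr 0) f) := by
  rw [poisson_apply, coe_J₂]
  simp [MvPowerSeries.pderiv_X, Derivation.leibniz, Pi.single_apply, Fin.sum_univ_two]
  ring

theorem coeff_poisson_J₁ (f : Series) (m : Coord →₀ ℕ) :
    coeff m (poisson ∂ (J₁ : Poly) f) = hypWeight m * coeff m f := by
  rw [poisson_J₁, map_sub, map_add, map_add]
  simp only [coeff_X_mul_pderiv, hypWeight]
  push_cast
  ring

theorem poisson_J₁_J₂ : poisson ∂ ((J₁ : Poly) : Series) ((J₂ : Poly) : Series) = 0 := by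
  rw [poisson_J₁, coe_J₂]
  simp [Derivation.leibniz]
  ring

/-! ### Power series in `J₁` and `J₂` -/

/-- The pair `(J₁, J₂)`, as formal power series. -/
def invariants : Fin 2 → Series := ![((J₁ : Poly) : Series), ((J₂ : Poly) : Series)]

theorem inJ_eq (N : MvPowerSeries (Fin 2) ℝ) : inJ N = subst invariants N := rfl

theorem invariants_mem (i : Fin 2) : invariants i ∈ orderIdeal Coord 2 := by
  fin_cases i
  exacts [J₁_mem, J₂_mem]

theorem hasSubst_invariants : MvPowerSeries.HasSubst invariants :=
  hasSubst_of_mem one_le_two invariants_mem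

theorem poisson_inJ_J₁ (N : MvPowerSeries (Fin 2) ℝ) : poisson ∂ (J₁ : Poly) (inJ N) = 0 := by
  rw [inJ_eq, poisson_subst (fun a => orderIdeal_mono one_le_two (invariants_mem a)),
    Fin.sum_univ_two]
  have h : poisson ∂ ((J₁ : Poly) : Series) ((J₁ : Poly) : Series) = 0 := by
    rw [poisson_apply]; simp [mul_comm]
  simp [invariants, poisson_J₁_J₂, h]

theorem poisson_inJ_J₂ (N : MvPowerSeries (Fin 2) ℝ) : poisson ∂ (J₂ : Poly) (inJ N) = 0 := by
  rw [inJ_eq, poisson_subst (fun a => orderIdeal_mono one_le_two (invariants_mem a)),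
    Fin.sum_univ_two]
  have h : poisson ∂ ((J₂ : Poly) : Series) ((J₂ : Poly) : Series) = 0 := by
    rw [poisson_apply]; simp [mul_comm]
  have h2 : poisson ∂ ((J₂ : Poly) : Series) ((J₁ : Poly) : Series) = 0 := by
    rw [poisson_antisymm, poisson_J₁_J₂, neg_zero]
  simp [invariants, h, h2]

/-- The exponent of the monomial `q₁ ^ (i + j) * p₁ ^ i * p₂ ^ j`, which occurs in no product of
powers of `J₁` and `J₂` other than `J₁ ^ i * J₂ ^ j`. -/
def leadingExponent (d : Fin 2 →₀ ℕ) : Coord →₀ ℕ :=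
  Finsupp.single (Sum.inl 0) (d 0 + d 1) + (Finsupp.single (Sum.inr 0) (d 0)
    + Finsupp.single (Sum.inr 1) (d 1))

theorem degree_fin_two (d : Fin 2 →₀ ℕ) : d.degree = d 0 + d 1 := by
  rw [Finsupp.degree_eq_sum, Fin.sum_univ_two]

theorem degree_leadingExponent (d : Fin 2 →₀ ℕ) : (leadingExponent d).degree = 2 * d.degree := by
  rw [leadingExponent, map_add, map_add, Finsupp.degree_single, Finsupp.degree_single,
    Finsupp.degree_single, degree_fin_two]
  ring

theorem coeff_leadingExponent_prod (d c : Fin 2 →₀ ℕ) :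
    coeff (leadingExponent d) (c.prod fun i e => invariants i ^ e) = if c = d then 1 else 0 := by
  classical
  have h1 : (c.prod fun i e => invariants i ^ e) =
      ((J₁ : Poly) : Series) ^ c 0 * ((J₂ : Poly) : Series) ^ c 1 := by
    rw [Finsupp.prod_fintype _ _ (by simp), Fin.prod_univ_two]
    rfl
  let x : Coord → Series := MvPowerSeries.X
  have hx : ∀ a n, x a ^ n = MvPowerSeries.monomial (Finsupp.single a n) 1 :=
    fun a n => MvPowerSeries.X_pow_eq a n
  have h2 : x (Sum.inl 1) ∣ ((J₁ : Poly) : Series) ^ c 0 * ((J₂ : Poly) : Series) ^ c 1 -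
      (x (Sum.inl 0) * x (Sum.inr 0)) ^ c 0 * (x (Sum.inl 0) * x (Sum.inr 1)) ^ c 1 := by
    have h3 : x (Sum.inl 1) ∣ ((J₁ : Poly) : Series) ^ c 0 - (x (Sum.inl 0) * x (Sum.inr 0)) ^ c 0 :=
      dvd_trans ⟨x (Sum.inr 1), by rw [coe_J₁]; ring⟩ (sub_dvd_pow_sub_pow _ _ _)
    have h4 : x (Sum.inl 1) ∣ ((J₂ : Poly) : Series) ^ c 1 - (x (Sum.inl 0) * x (Sum.inr 1)) ^ c 1 :=
      dvd_trans ⟨-x (Sum.inr 0), by rw [coe_J₂]; ring⟩ (sub_dvd_pow_sub_pow _ _ _)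
    have := dvd_add (h3.mul_right (((J₂ : Poly) : Series) ^ c 1))
      (h4.mul_left ((x (Sum.inl 0) * x (Sum.inr 0)) ^ c 0))
    rwa [show (((J₁ : Poly) : Series) ^ c 0 - (x (Sum.inl 0) * x (Sum.inr 0)) ^ c 0) *
      ((J₂ : Poly) : Series) ^ c 1 + (x (Sum.inl 0) * x (Sum.inr 0)) ^ c 0 *
      (((J₂ : Poly) : Series) ^ c 1 - (x (Sum.inl 0) * x (Sum.inr 1)) ^ c 1) =
      ((J₁ : Poly) : Series) ^ c 0 * ((J₂ : Poly) : Series) ^ c 1 -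
      (x (Sum.inl 0) * x (Sum.inr 0)) ^ c 0 * (x (Sum.inl 0) * x (Sum.inr 1)) ^ c 1 by ring] at this
  have h5 := MvPowerSeries.X_dvd_iff.1 h2 (leadingExponent d) (by simp [leadingExponent])
  rw [map_sub, sub_eq_zero] at h5
  rw [h1, h5, mul_pow, mul_pow, hx, hx, hx, hx]
  simp only [MvPowerSeries.monomial_mul_monomial, MvPowerSeries.coeff_monomial, mul_one]
  congr 1
  rw [eq_iff_iff]
  constructor
  · intro h
    have e1 := DFunLike.congr_fun h (Sum.inr 0)
    have e2 := DFunLike.congr_fun h (Sum.inr 1)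
    simp [leadingExponent] at e1 e2
    ext i
    fin_cases i
    · exact e1.symm
    · exact e2.symm
  · rintro rfl
    rw [leadingExponent, Finsupp.single_add]
    abel

theorem coeff_leadingExponent_inJ (N : MvPowerSeries (Fin 2) ℝ) (d : Fin 2 →₀ ℕ) :
    coeff (leadingExponent d) (inJ N) = coeff d N := by
  rw [inJ_eq, MvPowerSeries.coeff_subst hasSubst_invariants,
    finsum_eq_single _ d fun c hc => by rw [coeff_leadingExponent_prod, if_neg hc, smul_zero],
    coeff_leadingExponent_prod, if_pos rfl, smul_eq_mul, mul_one]

theorem inJ_sub (N N' : MvPowerSeries (Fin 2) ℝ) : inJ (N - N') = inJ N - inJ N' :=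
  MvPowerSeries.subst_sub hasSubst_invariants _ _

theorem mem_orderIdeal_of_inJ {N : MvPowerSeries (Fin 2) ℝ} {k r : ℕ}
    (h : inJ N ∈ orderIdeal Coord k) (hr : 2 * r ≤ k + 1) : N ∈ orderIdeal (Fin 2) r :=
  mem_orderIdeal.2 fun d hd => by
    rw [← coeff_leadingExponent_inJ]
    exact mem_orderIdeal.1 h _ (by rw [degree_leadingExponent]; omega)

/-! ### Deformations of `J₁` and `J₂` -/

theorem poisson_X_inl (u : Series) (j : Fin 2) :
    poisson ∂ u (MvPowerSeries.X (Sum.inl j)) = ∂ (Sum.inr j) u := by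
  rw [poisson_apply]
  fin_cases j <;> simp [MvPowerSeries.pderiv_X, Pi.single_apply]

theorem poisson_X_inr (u : Series) (j : Fin 2) :
    poisson ∂ u (MvPowerSeries.X (Sum.inr j)) = -∂ (Sum.inl j) u := by
  rw [poisson_apply]
  fin_cases j <;> simp [MvPowerSeries.pderiv_X, Pi.single_apply]

/-- If `J₁ + u` has eigenfunctions close to the coordinates with the eigenvalues of `J₁`, then the
lowest-order part of `u` has no terms of weight zero. -/
theorem coeff_eq_zero_of_eigenfunctions {m : ℕ} (hm : 1 ≤ m) {u : Series} {f : Coord → Series}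
    (hu : u ∈ orderIdeal Coord m) (hf : ∀ a, f a - MvPowerSeries.X a ∈ orderIdeal Coord 2)
    (hq : ∀ j, poisson ∂ (((J₁ : Poly) : Series) + u) (f (Sum.inl j)) = f (Sum.inl j))
    (hp : ∀ j, poisson ∂ (((J₁ : Poly) : Series) + u) (f (Sum.inr j)) = -f (Sum.inr j))
    {e : Coord →₀ ℕ} (he : e.degree = m) (hw : hypWeight e = 0) : coeff e u = 0 := by
  have key : ∀ a e', Finsupp.degree e' + 1 = m →
      coeff e' (poisson ∂ u (f a)) = coeff e' (poisson ∂ u (MvPowerSeries.X a)) := by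
    intro a e' he'
    obtain ⟨k, rfl⟩ : ∃ k, m = k + 1 := ⟨m - 1, by omega⟩
    have := mem_orderIdeal.1 (poisson_mem_orderIdeal (hf a) hu) e' (by omega)
    rwa [map_sub, map_sub, sub_eq_zero] at this
  have hne : ∃ b, e b ≠ 0 := by
    by_contra! h
    have : e = 0 := Finsupp.ext h
    simp [this] at he
    omega
  obtain ⟨b, hb⟩ := hne
  obtain ⟨e', rfl⟩ := exists_eq_single_add hb
  have he' : Finsupp.degree e' + 1 = m := by
    rw [← he, map_add, Finsupp.degree_single, add_comm]
  have hnz : ((e' b : ℝ) + 1) ≠ 0 := by positivity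
  rcases b with j | j
  · have h1 := congrArg (coeff e') (hp j)
    rw [poisson_add_right, map_add, coeff_poisson_J₁, key _ _ he', poisson_X_inr] at h1
    have hw' : hypWeight e' = -1 := by
      revert hw; fin_cases j <;> simp [hypWeight] <;> omega
    rw [hw', map_neg, map_neg, MvPowerSeries.coeff_pderiv] at h1
    push_cast at h1
    have h2 : coeff (e' + Finsupp.single (Sum.inl j) 1) u * ((e' (Sum.inl j) : ℝ) + 1) = 0 := by
      linarith
    rw [add_comm]
    exact (mul_eq_zero.1 h2).resolve_right hnz
  · have h1 := congrArg (coeff e') (hq j)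
    rw [poisson_add_right, map_add, coeff_poisson_J₁, key _ _ he', poisson_X_inl] at h1
    have hw' : hypWeight e' = 1 := by
      revert hw; fin_cases j <;> simp [hypWeight] <;> omega
    rw [hw', MvPowerSeries.coeff_pderiv] at h1
    push_cast at h1
    have h2 : coeff (e' + Finsupp.single (Sum.inr j) 1) u * ((e' (Sum.inr j) : ℝ) + 1) = 0 := by
      linarith
    rw [add_comm]
    exact (mul_eq_zero.1 h2).resolve_right hnz

/-- The flow of `J₂`, a simultaneous rotation of positions and momenta. -/
def rotate (t : ℝ) (x : Coord → ℝ) : Coord → ℝ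
  | Sum.inl 0 => Real.cos t * x (Sum.inl 0) - Real.sin t * x (Sum.inl 1)
  | Sum.inl 1 => Real.sin t * x (Sum.inl 0) + Real.cos t * x (Sum.inl 1)
  | Sum.inr 0 => Real.cos t * x (Sum.inr 0) - Real.sin t * x (Sum.inr 1)
  | Sum.inr 1 => Real.sin t * x (Sum.inr 0) + Real.cos t * x (Sum.inr 1)

theorem hasDerivAt_rotate (g : Poly) (x : Coord → ℝ) (t : ℝ) :
    HasDerivAt (fun s => MvPolynomial.eval (rotate s x) g)
      (MvPolynomial.eval (rotate t x) (bracket g J₂)) t := by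
  simp only [bracket_eq_poisson]
  induction g using MvPolynomial.induction_on with
  | C r =>
    have : poisson MvPolynomial.pderiv J₂ (MvPolynomial.C r : Poly) = 0 := by
      simp
    simpa [this] using hasDerivAt_const t r
  | add f g hf hg => simpa only [map_add] using hf.fun_add hg
  | mul_X f a hf =>
    have hX : HasDerivAt (fun s => rotate s x a) (MvPolynomial.eval (rotate t x)
        (poisson MvPolynomial.pderiv J₂ (MvPolynomial.X a))) t := by
      have hc := Real.hasDerivAt_cos t
      have hs := Real.hasDerivAt_sin t
      rcases a with j | j <;> fin_cases j
      · refine ((hc.mul_const (x (Sum.inl 0))).fun_sub (hs.mul_const (x (Sum.inl 1)))).congr_deriv ?_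
        simp [poisson_apply, J₂, q, p, MvPolynomial.pderiv_X, Pi.single_apply, rotate]
        ring
      · refine ((hs.mul_const (x (Sum.inl 0))).fun_add (hc.mul_const (x (Sum.inl 1)))).congr_deriv ?_
        simp [poisson_apply, J₂, q, p, MvPolynomial.pderiv_X, Pi.single_apply, rotate]
        ring
      · refine ((hc.mul_const (x (Sum.inr 0))).fun_sub (hs.mul_const (x (Sum.inr 1)))).congr_deriv ?_
        simp [poisson_apply, J₂, q, p, MvPolynomial.pderiv_X, Pi.single_apply, rotate]
        ring
      · refine ((hs.mul_const (x (Sum.inr 0))).fun_add (hc.mul_const (x (Sum.inr 1)))).congr_deriv ?_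
        simp [poisson_apply, J₂, q, p, MvPolynomial.pderiv_X, Pi.single_apply, rotate]
        ring
    simp only [map_mul, MvPolynomial.eval_X, Derivation.leibniz, smul_eq_mul, map_add]
    refine (hf.fun_mul hX).congr_deriv ?_
    ring

/-- `{·, J₂}` is semisimple at the eigenvalue zero, because its orbits are periodic. -/
theorem bracket_J₂_eq_zero {g : Poly} (h : bracket (bracket g J₂) J₂ = 0) : bracket g J₂ = 0 := by
  apply MvPolynomial.funext
  intro x
  have hconst : ∀ t, MvPolynomial.eval (rotate t x) (bracket g J₂) =
      MvPolynomial.eval (rotate 0 x) (bracket g J₂) := fun t =>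
    is_const_of_deriv_eq_zero (fun s => (hasDerivAt_rotate (bracket g J₂) x s).differentiableAt)
      (fun s => by rw [(hasDerivAt_rotate (bracket g J₂) x s).deriv, h, map_zero]) t 0
  have h0 : rotate 0 x = x := by
    funext a; rcases a with j | j <;> fin_cases j <;> simp [rotate]
  have h1 : rotate (2 * Real.pi) x = x := by
    funext a; rcases a with j | j <;> fin_cases j <;> simp [rotate]
  obtain ⟨c, -, hc⟩ := exists_hasDerivAt_eq_zero (a := 0) (b := 2 * Real.pi)
    (f := fun s => MvPolynomial.eval (rotate s x) g) (by positivity)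
    (fun s _ => (hasDerivAt_rotate g x s).continuousAt.continuousWithinAt)
    (by simp only [h0, h1]) (fun s _ => hasDerivAt_rotate g x s)
  rw [hconst, h0] at hc
  rw [hc, map_zero]

/-- The homogeneous part of degree `m` of a formal power series, as a polynomial. -/
def homogeneousPart (m : ℕ) (f : Series) : Poly :=
  MvPolynomial.homogeneousComponent m (MvPowerSeries.truncTotal (m + 1) f)

theorem coeff_homogeneousPart (m : ℕ) (f : Series) (e : Coord →₀ ℕ) :
    MvPolynomial.coeff e (homogeneousPart m f) = if e.degree = m then coeff e f else 0 := by
  rw [homogeneousPart, MvPolynomial.coeff_homogeneousComponent]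
  split_ifs with h
  · rw [MvPowerSeries.coeff_truncTotal _ (by omega)]
  · rfl

theorem coeff_X_mul_pderiv_congr {f g : Series} {m : ℕ}
    (h : ∀ e : Coord →₀ ℕ, e.degree = m → coeff e f = coeff e g) (a b : Coord)
    {e : Coord →₀ ℕ} (he : e.degree = m) :
    coeff e (MvPowerSeries.X a * ∂ b f) = coeff e (MvPowerSeries.X a * ∂ b g) := by
  by_cases ha : e a = 0
  · rw [coeff_X_mul_of_eq_zero a ha, coeff_X_mul_of_eq_zero a ha]
  · obtain ⟨e', rfl⟩ := exists_eq_single_add ha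
    rw [coeff_single_add_X_mul, coeff_single_add_X_mul, MvPowerSeries.coeff_pderiv,
      MvPowerSeries.coeff_pderiv, h]
    rw [← he]
    simp [add_comm]

theorem homogeneousPart_poisson_J₂ (m : ℕ) (f : Series) :
    homogeneousPart (m + 1) (poisson ∂ (J₂ : Poly) f) = bracket (homogeneousPart (m + 1) f) J₂ := by
  have hcoe : ((bracket (homogeneousPart (m + 1) f) J₂ : Poly) : Series) =
      poisson ∂ (J₂ : Poly) (homogeneousPart (m + 1) f : Poly) := by
    rw [bracket_eq_poisson]
    exact map_poisson _ ∂ (MvPolynomial.coeToMvPowerSeries.ringHom)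
      (fun a x => (MvPowerSeries.pderiv_coe x).symm) _ _
  have hhom : (bracket (homogeneousPart (m + 1) f) J₂).IsHomogeneous (m + 1) := by
    have h1 : (homogeneousPart (m + 1) f).IsHomogeneous (m + 1) :=
      MvPolynomial.homogeneousComponent_isHomogeneous _ _
    have h2 : (J₂ : Poly).IsHomogeneous (1 + 1) :=
      ((MvPolynomial.isHomogeneous_X ℝ _).mul (MvPolynomial.isHomogeneous_X ℝ _)).sub
        ((MvPolynomial.isHomogeneous_X ℝ _).mul (MvPolynomial.isHomogeneous_X ℝ _))
    exact isHomogeneous_bracket h1 h2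
  ext e
  rw [coeff_homogeneousPart]
  split_ifs with he
  · rw [← MvPolynomial.coeff_coe, hcoe, poisson_J₂, poisson_J₂]
    have hpart : ∀ e : Coord →₀ ℕ, e.degree = m + 1 →
        coeff e f = coeff e ((homogeneousPart (m + 1) f : Poly) : Series) := fun e he => by
      rw [MvPolynomial.coeff_coe, coeff_homogeneousPart, if_pos he]
    simp only [map_add, map_sub]
    rw [coeff_X_mul_pderiv_congr hpart _ _ he, coeff_X_mul_pderiv_congr hpart _ _ he,
      coeff_X_mul_pderiv_congr hpart _ _ he, coeff_X_mul_pderiv_congr hpart _ _ he]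
  · rw [hhom.coeff_eq_zero he]

/-- If the Hamiltonian flow of `J₂ + v` rotates functions close to the position coordinates, and
the lowest-order part of `v` Poisson commutes with `J₁` and `J₂`, then that part vanishes: it is a
multiple of a function in the kernel and in the range of `{·, J₂}`. -/
theorem mem_orderIdeal_of_rotation {m : ℕ} {v : Series} {f : Fin 2 → Series}
    (hv : v ∈ orderIdeal Coord (m + 1))
    (hf : ∀ j, f j - MvPowerSeries.X (Sum.inl j) ∈ orderIdeal Coord 2)
    (h0 : poisson ∂ (((J₂ : Poly) : Series) + v) (f 0) = -f 1)
    (h1 : poisson ∂ (((J₂ : Poly) : Series) + v) (f 1) = f 0)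
    (hw : ∀ e : Coord →₀ ℕ, e.degree = m + 1 → hypWeight e ≠ 0 → coeff e v = 0)
    (hJ : poisson ∂ (J₂ : Poly) v ∈ orderIdeal Coord (m + 2)) :
    v ∈ orderIdeal Coord (m + 2) := by
  let x : Coord → Series := MvPowerSeries.X
  let G : Series := x (Sum.inr 0) * f 0 + x (Sum.inr 1) * f 1
  have hG : poisson ∂ (J₂ : Poly) G + (x (Sum.inr 0) * ∂ (Sum.inr 0) v +
      x (Sum.inr 1) * ∂ (Sum.inr 1) v) ∈ orderIdeal Coord (m + 2) := by
    have hJp : poisson ∂ (J₂ : Poly) (x (Sum.inr 0)) = -x (Sum.inr 1) ∧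
        poisson ∂ (J₂ : Poly) (x (Sum.inr 1)) = x (Sum.inr 0) := by
      simp [x, poisson_J₂]
    rw [poisson_add_right] at h0 h1
    have hs : ∀ j, x (Sum.inr j) * (poisson ∂ v (f j) - ∂ (Sum.inr j) v) ∈
        orderIdeal Coord (m + 2) := fun j => by
      rw [← poisson_X_inl, ← map_sub]
      have := mul_mem_orderIdeal (X_mem_orderIdeal (Sum.inr j)) (poisson_mem_orderIdeal (hf j) hv)
      rwa [show 1 + (1 + m) = m + 2 by ring] at this
    have := neg_mem (add_mem (hs 0) (hs 1))
    convert this using 1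
    simp only [G, map_add, Derivation.leibniz, smul_eq_mul, hJp]
    rw [eq_sub_of_add_eq h0, eq_sub_of_add_eq h1]
    ring
  have hpart : homogeneousPart (m + 1) (poisson ∂ (J₂ : Poly) G) =
      (-((m + 1 : ℝ) / 2)) • homogeneousPart (m + 1) v := by
    ext e
    rw [MvPolynomial.coeff_smul, coeff_homogeneousPart, coeff_homogeneousPart]
    split_ifs with he
    · have h2 := mem_orderIdeal.1 hG e (by omega)
      rw [map_add (coeff e), map_add (coeff e), coeff_X_mul_pderiv, coeff_X_mul_pderiv] at h2
      by_cases hwe : hypWeight e = 0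
      · have h3 : (2 * (e (Sum.inr 0) + e (Sum.inr 1)) : ℝ) = m + 1 := by
          have := degree_coord e
          rw [hypWeight] at hwe
          have : 2 * (e (Sum.inr 0) + e (Sum.inr 1)) = m + 1 := by omega
          exact_mod_cast this
        rw [smul_eq_mul, ← h3]
        linarith
      · rw [hw e he hwe] at h2 ⊢
        simpa using h2
    · rw [smul_zero]
  have hLv : bracket (homogeneousPart (m + 1) v) J₂ = 0 := by
    rw [← homogeneousPart_poisson_J₂]
    ext e
    rw [coeff_homogeneousPart]
    split_ifs with he
    · exact mem_orderIdeal.1 hJ e (by omega)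
    · rfl
  rw [homogeneousPart_poisson_J₂] at hpart
  have hzero : bracket (homogeneousPart (m + 1) G) J₂ = 0 := by
    apply bracket_J₂_eq_zero
    rw [hpart, bracket_eq_poisson, Derivation.map_smul, ← bracket_eq_poisson, hLv, smul_zero]
  rw [hzero] at hpart
  have hvz : homogeneousPart (m + 1) v = 0 :=
    (smul_eq_zero.1 hpart.symm).resolve_left (by
      have : (0 : ℝ) < m + 1 := by positivity
      intro h; linarith)
  refine mem_orderIdeal.2 fun e he => ?_
  by_cases he' : e.degree < m + 1
  · exact mem_orderIdeal.1 hv e he'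
  · have h2 := congrArg (MvPolynomial.coeff e) hvz
    rwa [coeff_homogeneousPart, if_pos (by omega), MvPolynomial.coeff_zero] at h2

/-! ### Uniqueness of the normal form -/

theorem mem_orderIdeal_of_J₂_mul {f : Series} {n : ℕ}
    (h : ((J₂ : Poly) : Series) * f ∈ orderIdeal Coord (n + 2)) : f ∈ orderIdeal Coord n := by
  have horder : (((J₂ : Poly) : Series)).order ≤ 2 := by
    have h1 : coeff (Finsupp.single (Sum.inl 0) 1 + Finsupp.single (Sum.inr 1) 1)
        ((J₂ : Poly) : Series) ≠ 0 := by
      rw [coe_J₂, map_sub, coeff_single_add_X_mul, MvPowerSeries.coeff_index_single_self_X,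
        coeff_X_mul_of_eq_zero _ (by simp)]
      norm_num
    refine (MvPowerSeries.order_le h1).trans ?_
    rw [map_add, Finsupp.degree_single, Finsupp.degree_single]
    norm_num
  have h2 : ((n + 2 : ℕ) : ℕ∞) ≤ (((J₂ : Poly) : Series) * f).order := h
  rw [MvPowerSeries.order_mul] at h2
  have h3 : ((n + 2 : ℕ) : ℕ∞) ≤ 2 + f.order := h2.trans (add_le_add_left horder _)
  rw [Nat.cast_add, add_comm] at h3
  exact (ENat.add_le_add_iff_left (by norm_num)).1 h3

theorem smul_mem_orderIdeal_iff {σ : Type*} {n : ℕ} {c : ℝ} (hc : c ≠ 0)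
    {f : MvPowerSeries σ ℝ} : c • f ∈ orderIdeal σ n ↔ f ∈ orderIdeal σ n :=
  ⟨fun h => by simpa [smul_smul, inv_mul_cancel₀ hc] using smul_mem_orderIdeal c⁻¹ h,
    smul_mem_orderIdeal c⟩

theorem coeff_inJ_of_hypWeight_ne_zero (N : MvPowerSeries (Fin 2) ℝ) {e : Coord →₀ ℕ}
    (he : hypWeight e ≠ 0) : coeff e (inJ N) = 0 := by
  have := coeff_poisson_J₁ (inJ N) e
  rw [poisson_inJ_J₁, map_zero, eq_comm, mul_eq_zero] at this
  exact this.resolve_left (by exact_mod_cast he)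

section Uniqueness

variable {χ : Coord → Series} (hχ : IsCanonical χ) {N N' : MvPowerSeries (Fin 2) ℝ}
  (hN : subst χ (inJ N') = inJ N)

include hχ

theorem eigenfunctions_J₁ :
    (∀ j, poisson ∂ (((J₁ : Poly) : Series) + (subst χ ((J₁ : Poly) : Series) - (J₁ : Poly)))
      (χ (Sum.inl j)) = χ (Sum.inl j)) ∧
    (∀ j, poisson ∂ (((J₁ : Poly) : Series) + (subst χ ((J₁ : Poly) : Series) - (J₁ : Poly)))
      (χ (Sum.inr j)) = -χ (Sum.inr j)) := by
  have hX : ∀ a, χ a = subst χ (MvPowerSeries.X a : Series) := fun a =>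
    (MvPowerSeries.subst_X hχ.hasSubst a).symm
  have hneg : ∀ f : Series, subst χ (-f) = -subst χ f := fun f => by
    rw [← MvPowerSeries.coe_substAlgHom hχ.hasSubst, map_neg]
  rw [add_sub_cancel]
  constructor <;> intro j <;> rw [hX, ← hχ.subst_poisson, poisson_J₁] <;>
    fin_cases j <;> simp [hneg]

theorem rotation_J₂ :
    poisson ∂ (((J₂ : Poly) : Series) + (subst χ ((J₂ : Poly) : Series) - (J₂ : Poly)))
      (χ (Sum.inl 0)) = -χ (Sum.inl 1) ∧
    poisson ∂ (((J₂ : Poly) : Series) + (subst χ ((J₂ : Poly) : Series) - (J₂ : Poly)))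
      (χ (Sum.inl 1)) = χ (Sum.inl 0) := by
  have hX : ∀ a, χ a = subst χ (MvPowerSeries.X a : Series) := fun a =>
    (MvPowerSeries.subst_X hχ.hasSubst a).symm
  have hneg : ∀ f : Series, subst χ (-f) = -subst χ f := fun f => by
    rw [← MvPowerSeries.coe_substAlgHom hχ.hasSubst, map_neg]
  rw [add_sub_cancel]
  constructor <;> rw [hX, hX, ← hχ.subst_poisson, poisson_J₂] <;>
    simp [hneg]

theorem commute_deformed :
    poisson ∂ (((J₂ : Poly) : Series) + (subst χ ((J₂ : Poly) : Series) - (J₂ : Poly)))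
      (((J₁ : Poly) : Series) + (subst χ ((J₁ : Poly) : Series) - (J₁ : Poly))) = 0 := by
  rw [add_sub_cancel, add_sub_cancel, ← hχ.subst_poisson, poisson_antisymm, poisson_J₁_J₂,
    neg_zero, ← MvPowerSeries.coe_substAlgHom hχ.hasSubst, map_zero]

include hN

/-- First-order Taylor expansion of a normal form with a given beginning `P`. -/
theorem taylor_normalForm (P : MvPolynomial (Fin 2) ℝ) {m r : ℕ}
    (hP : N' - (P : MvPowerSeries (Fin 2) ℝ) ∈ orderIdeal (Fin 2) r)
    (hu : subst χ ((J₁ : Poly) : Series) - (J₁ : Poly) ∈ orderIdeal Coord (m + 3))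
    (hv : subst χ ((J₂ : Poly) : Series) - (J₂ : Poly) ∈ orderIdeal Coord (m + 3)) :
    inJ N - inJ N' - (MvPolynomial.aeval (fun i => subst χ (invariants i)) P -
      MvPolynomial.aeval invariants P) ∈ orderIdeal Coord (2 * r + (m + 1)) := by
  have huv : ∀ i, subst χ (invariants i) - invariants i ∈ orderIdeal Coord (2 + (m + 1)) := by
    rw [show 2 + (m + 1) = m + 3 by ring]
    intro i
    fin_cases i
    exacts [hu, hv]
  have hB : ∀ i, subst χ (invariants i) ∈ orderIdeal Coord 2 := fun i => by
    have := add_mem (orderIdeal_mono (by omega) (huv i)) (invariants_mem i)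
    rwa [sub_add_cancel] at this
  have hBs : MvPowerSeries.HasSubst fun i => subst χ (invariants i) := hasSubst_of_mem one_le_two hB
  have h1 : inJ N = subst (fun i => subst χ (invariants i)) N' := by
    rw [← hN, inJ_eq, MvPowerSeries.subst_comp_subst_apply hasSubst_invariants hχ.hasSubst]
  have h2 := subst_sub_subst_mem_orderIdeal one_le_two invariants_mem hB huv hP
  rw [MvPowerSeries.subst_sub hBs, MvPowerSeries.subst_sub hasSubst_invariants,
    MvPowerSeries.subst_coe, MvPowerSeries.subst_coe, ← h1, ← inJ_eq] at h2
  convert h2 using 1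
  ring

/-- The inductive step: `J₁`, `J₂` and the normal form are unchanged to one order more. -/
theorem normalForm_step {m : ℕ}
    (hlow : N - ((MvPolynomial.C √2 * MvPolynomial.X 0 + MvPolynomial.C (1 / 4) *
      (3 * MvPolynomial.X 0 ^ 2 + MvPolynomial.X 1 ^ 2) : MvPolynomial (Fin 2) ℝ) :
      MvPowerSeries (Fin 2) ℝ) ∈ orderIdeal (Fin 2) 3)
    (hn : inJ N - inJ N' ∈ orderIdeal Coord (m + 3))
    (hu : subst χ ((J₁ : Poly) : Series) - (J₁ : Poly) ∈ orderIdeal Coord (m + 3))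
    (hv : subst χ ((J₂ : Poly) : Series) - (J₂ : Poly) ∈ orderIdeal Coord (m + 3)) :
    inJ N - inJ N' ∈ orderIdeal Coord (m + 4) ∧
    subst χ ((J₁ : Poly) : Series) - (J₁ : Poly) ∈ orderIdeal Coord (m + 4) ∧
    subst χ ((J₂ : Poly) : Series) - (J₂ : Poly) ∈ orderIdeal Coord (m + 4) := by
  have hs2 : (√2 : ℝ) ≠ 0 := by positivity
  obtain ⟨hq, hp⟩ := eigenfunctions_J₁ hχ
  obtain ⟨hr0, hr1⟩ := rotation_J₂ hχ
  have hcomm := commute_deformed hχ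
  have hinv0 : subst χ ((J₁ : Poly) : Series) = ((J₁ : Poly) : Series) +
    (subst χ ((J₁ : Poly) : Series) - (J₁ : Poly)) := by rw [add_sub_cancel]
  have hinv1 : subst χ ((J₂ : Poly) : Series) = ((J₂ : Poly) : Series) +
    (subst χ ((J₂ : Poly) : Series) - (J₂ : Poly)) := by rw [add_sub_cancel]
  have taylor := fun P r hP => taylor_normalForm (r := r) hχ hN P hP hu hv
  have hi0 : invariants 0 = ((J₁ : Poly) : Series) := rfl
  have hi1 : invariants 1 = ((J₂ : Poly) : Series) := rfl
  generalize subst χ ((J₁ : Poly) : Series) - (J₁ : Poly) = u at *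
  generalize subst χ ((J₂ : Poly) : Series) - (J₂ : Poly) = v at *
  have hwt : ∀ e, hypWeight e ≠ 0 → coeff e (inJ N - inJ N') = 0 := fun e he => by
    rw [map_sub, coeff_inJ_of_hypWeight_ne_zero N he, coeff_inJ_of_hypWeight_ne_zero N' he, sub_zero]
  have hlead : ∀ k, 1 ≤ k → u ∈ orderIdeal Coord k → ∀ e : Coord →₀ ℕ, e.degree = k →
      hypWeight e = 0 → coeff e u = 0 := fun k hk huk e he hw =>
    coeff_eq_zero_of_eigenfunctions hk huk hχ.sub_mem hq hp he hw
  -- The linear part of the normal form transfers the order of `inJ N - inJ N'` to `u`.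
  have hN'2 : N' - ((MvPolynomial.C √2 * MvPolynomial.X 0 : MvPolynomial (Fin 2) ℝ) :
      MvPowerSeries (Fin 2) ℝ) ∈ orderIdeal (Fin 2) 2 := by
    have h1 : N - N' ∈ orderIdeal (Fin 2) 2 :=
      mem_orderIdeal_of_inJ (k := m + 3) (by rwa [inJ_sub]) (by omega)
    have h2 : ((MvPolynomial.C (1 / 4) * (3 * MvPolynomial.X 0 ^ 2 + MvPolynomial.X 1 ^ 2) :
        MvPolynomial (Fin 2) ℝ) : MvPowerSeries (Fin 2) ℝ) ∈ orderIdeal (Fin 2) 2 := by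
      have hX : ∀ i, (MvPowerSeries.X i : MvPowerSeries (Fin 2) ℝ) ^ 2 ∈ orderIdeal (Fin 2) 2 :=
        fun i => pow_mem_orderIdeal (X_mem_orderIdeal i) 2
      push_cast
      exact Ideal.mul_mem_left _ _ (add_mem (Ideal.mul_mem_left _ _ (hX 0)) (hX 1))
    have h3 := add_mem (sub_mem (orderIdeal_mono (by omega) hlow) h1) h2
    convert h3 using 1
    push_cast
    ring
  have hE1 : inJ N - inJ N' - √2 • u ∈ orderIdeal Coord (m + 5) := by
    have := taylor _ _ hN'2
    rw [show 2 * 2 + (m + 1) = m + 5 by ring] at this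
    convert this using 2
    simp only [map_mul, MvPolynomial.aeval_X, MvPolynomial.aeval_C, hinv0, hi0]
    rw [Algebra.smul_def]
    ring
  have hgain : ∀ k, 1 ≤ k → k + 1 ≤ m + 5 → u ∈ orderIdeal Coord k →
      u ∈ orderIdeal Coord (k + 1) := fun k hk hkm huk => by
    refine mem_orderIdeal.2 fun e he => ?_
    by_cases he' : e.degree < k
    · exact mem_orderIdeal.1 huk e he'
    · by_cases hw : hypWeight e = 0
      · exact hlead k hk huk e (by omega) hw
      · have := mem_orderIdeal.1 hE1 e (by omega)
        rw [map_sub, hwt e hw, MvPowerSeries.coeff_smul, zero_sub, neg_eq_zero] at this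
        exact (mul_eq_zero.1 this).resolve_left hs2
  have hu5 : u ∈ orderIdeal Coord (m + 5) :=
    hgain (m + 4) (by omega) le_rfl (hgain (m + 3) (by omega) (by omega) hu)
  have hn5 : inJ N - inJ N' ∈ orderIdeal Coord (m + 5) := by
    have := add_mem hE1 (smul_mem_orderIdeal √2 hu5)
    rwa [sub_add_cancel] at this
  -- The quadratic part of the normal form relates the order of `inJ N - inJ N'` to `v`.
  have hN'3 : N' - ((MvPolynomial.C √2 * MvPolynomial.X 0 + MvPolynomial.C (1 / 4) *
      (3 * MvPolynomial.X 0 ^ 2 + MvPolynomial.X 1 ^ 2) : MvPolynomial (Fin 2) ℝ) :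
      MvPowerSeries (Fin 2) ℝ) ∈ orderIdeal (Fin 2) 3 := by
    have h1 : N - N' ∈ orderIdeal (Fin 2) 3 :=
      mem_orderIdeal_of_inJ (k := m + 5) (by rwa [inJ_sub]) (by omega)
    have := sub_mem hlow h1
    convert this using 1
    ring
  have hE2 : inJ N - inJ N' - √2 • u - (1 / 2 : ℝ) • (((J₂ : Poly) : Series) * v) ∈
      orderIdeal Coord (m + 6) := by
    have h1 := orderIdeal_mono (n := m + 6) (by omega) (taylor _ _ hN'3)
    have h2 : (3 / 4 : ℝ) • (2 * (((J₁ : Poly) : Series) * u) + u * u) + (1 / 4 : ℝ) • (v * v) ∈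
        orderIdeal Coord (m + 6) := by
      refine add_mem (smul_mem_orderIdeal _ (add_mem (Ideal.mul_mem_left _ _ ?_) ?_))
        (smul_mem_orderIdeal _ ?_)
      · exact orderIdeal_mono (by omega) (mul_mem_orderIdeal J₁_mem hu5)
      · exact orderIdeal_mono (by omega) (mul_mem_orderIdeal hu5 hu5)
      · exact orderIdeal_mono (by omega) (mul_mem_orderIdeal hv hv)
    have h3 := add_mem h1 h2
    convert h3 using 1
    simp only [map_mul, map_add, map_pow, map_ofNat, MvPolynomial.aeval_X, MvPolynomial.aeval_C,
      hinv0, hi0, hinv1, hi1, Algebra.smul_def]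
    have e1 : algebraMap ℝ Series (1 / 2) = 2 * algebraMap ℝ Series (1 / 4) := by
      rw [← map_ofNat (algebraMap ℝ Series) 2, ← map_mul]; norm_num
    have e2 : algebraMap ℝ Series (3 / 4) = 3 * algebraMap ℝ Series (1 / 4) := by
      rw [← map_ofNat (algebraMap ℝ Series) 3, ← map_mul]; norm_num
    rw [e1, e2]
    ring
  have hJ1v : poisson ∂ (J₁ : Poly) v ∈ orderIdeal Coord (m + 5) := by
    have hJ2v : ((J₂ : Poly) : Series) + v ∈ orderIdeal Coord 2 :=
      add_mem J₂_mem (orderIdeal_mono (by omega) hv)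
    have h1 := poisson_mem_orderIdeal (a := m + 4) (b := 1) hu5 hJ2v
    rw [map_add, poisson_add_right, poisson_antisymm ∂ ((J₁ : Poly) : Series), poisson_J₁_J₂,
      neg_zero, zero_add, poisson_antisymm ∂ ((J₁ : Poly) : Series), neg_add_eq_zero] at hcomm
    rw [hcomm]
    exact h1
  have hwv : ∀ e : Coord →₀ ℕ, e.degree = m + 3 → hypWeight e ≠ 0 → coeff e v = 0 := by
    intro e he hw
    have := mem_orderIdeal.1 hJ1v e (by omega)
    rw [coeff_poisson_J₁] at this
    exact (mul_eq_zero.1 this).resolve_left (by exact_mod_cast hw)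
  have hu6 : u ∈ orderIdeal Coord (m + 6) := by
    refine mem_orderIdeal.2 fun e he => ?_
    by_cases he' : e.degree < m + 5
    · exact mem_orderIdeal.1 hu5 e he'
    · by_cases hw : hypWeight e = 0
      · exact hlead _ (by omega) hu5 e (by omega) hw
      · have h1 := mem_orderIdeal.1 hE2 e he
        have h2 : coeff e (((J₂ : Poly) : Series) * v) = 0 := by
          have h3 : poisson ∂ (J₁ : Poly) (((J₂ : Poly) : Series) * v) ∈
              orderIdeal Coord (m + 7) := by
            rw [Derivation.leibniz, poisson_J₁_J₂, smul_zero, add_zero, smul_eq_mul]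
            exact orderIdeal_mono (by omega) (mul_mem_orderIdeal J₂_mem hJ1v)
          have := mem_orderIdeal.1 h3 e (by omega)
          rw [coeff_poisson_J₁] at this
          exact (mul_eq_zero.1 this).resolve_left (by exact_mod_cast hw)
        rw [map_sub, map_sub, hwt e hw, MvPowerSeries.coeff_smul, MvPowerSeries.coeff_smul, h2,
          mul_zero, sub_zero, zero_sub, neg_eq_zero] at h1
        exact (mul_eq_zero.1 h1).resolve_left hs2
  have hJ2v : poisson ∂ (J₂ : Poly) v ∈ orderIdeal Coord (m + 4) := by
    have h1 : inJ N - inJ N' - (1 / 2 : ℝ) • (((J₂ : Poly) : Series) * v) ∈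
        orderIdeal Coord (m + 6) := by
      have := add_mem hE2 (smul_mem_orderIdeal √2 hu6)
      convert this using 1
      ring
    have h2 := poisson_mem_orderIdeal (a := m + 5) (b := 1) h1 J₂_mem
    have hJJ : poisson ∂ ((J₂ : Poly) : Series) ((J₂ : Poly) : Series) = 0 := by
      rw [poisson_apply]; simp [mul_comm]
    rw [map_sub, map_sub, poisson_inJ_J₂, poisson_inJ_J₂, sub_zero, zero_sub, neg_mem_iff,
      Derivation.map_smul, smul_mem_orderIdeal_iff (by norm_num), Derivation.leibniz, hJJ,
      smul_zero, add_zero, smul_eq_mul] at h2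
    exact mem_orderIdeal_of_J₂_mul h2
  exact ⟨orderIdeal_mono (by omega) hn5, orderIdeal_mono (by omega) hu5,
    mem_orderIdeal_of_rotation (f := fun j => χ (Sum.inl j)) hv (fun j => hχ.sub_mem _) hr0 hr1
      hwv hJ2v⟩

/-- A normal form whose quadratic part is that of the champagne bottle is determined by its class
under formal symplectic changes of variables. -/
theorem normalForm_unique
    (hlow : N - ((MvPolynomial.C √2 * MvPolynomial.X 0 + MvPolynomial.C (1 / 4) *
      (3 * MvPolynomial.X 0 ^ 2 + MvPolynomial.X 1 ^ 2) : MvPolynomial (Fin 2) ℝ) :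
      MvPowerSeries (Fin 2) ℝ) ∈ orderIdeal (Fin 2) 3)
    (hn : inJ N - inJ N' ∈ orderIdeal Coord 3) : N' = N := by
  have key : ∀ m, inJ N - inJ N' ∈ orderIdeal Coord (m + 3) ∧
      subst χ ((J₁ : Poly) : Series) - (J₁ : Poly) ∈ orderIdeal Coord (m + 3) ∧
      subst χ ((J₂ : Poly) : Series) - (J₂ : Poly) ∈ orderIdeal Coord (m + 3) := by
    intro m
    induction m with
    | zero => exact ⟨hn, hχ.subst_sub_mem J₁_mem, hχ.subst_sub_mem J₂_mem⟩
    | succ m ih => exact normalForm_step hχ hN hlow ih.1 ih.2.1 ih.2.2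
  symm
  apply eq_of_forall_sub_mem_orderIdeal
  intro r
  exact mem_orderIdeal_of_inJ (k := 2 * r + 3) (by rw [inJ_sub]; exact (key (2 * r)).1) (by omega)

end Uniqueness

end SeriesInvariants

/-! ### Rotation-invariant polynomials -/

/-- The squared length `q₁² + q₂²` of the position. -/
def positionSq : Poly := q 0 ^ 2 + q 1 ^ 2

/-- The squared length `p₁² + p₂²` of the momentum. -/
def momentumSq : Poly := p 0 ^ 2 + p 1 ^ 2

/-- The relation between the four generators of the rotation-invariant polynomials. -/
theorem positionSq_mul_momentumSq : positionSq * momentumSq = J₁ ^ 2 + J₂ ^ 2 := by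
  simp only [positionSq, momentumSq, J₁, J₂]; ring

theorem bracket_antisymm (f g : Poly) : bracket f g = -bracket g f := by
  rw [bracket_eq_poisson, bracket_eq_poisson, poisson_antisymm]

theorem bracket_self (f : Poly) : bracket f f = 0 := by
  simp [bracket, mul_comm]

theorem bracket_mul_left (f g h : Poly) :
    bracket (f * g) h = f * bracket g h + g * bracket f h := by
  simp only [bracket_eq_poisson, Derivation.leibniz, smul_eq_mul]

theorem bracket_mul_right (f g h : Poly) :
    bracket f (g * h) = g * bracket f h + h * bracket f g := by
  simp only [bracket_eq_poisson, poisson_mul_right]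

theorem bracket_add_left (f g h : Poly) : bracket (f + g) h = bracket f h + bracket g h := by
  simp only [bracket_eq_poisson, map_add]

theorem bracket_add_right (f g h : Poly) : bracket f (g + h) = bracket f g + bracket f h := by
  simp only [bracket_eq_poisson, poisson_add_right]

theorem bracket_smul_left (c : ℝ) (f g : Poly) : bracket (c • f) g = c • bracket f g := by
  simp only [bracket_eq_poisson, Derivation.map_smul]

theorem bracket_smul_right (c : ℝ) (f g : Poly) : bracket f (c • g) = c • bracket f g := by
  rw [bracket_antisymm, bracket_smul_left, bracket_antisymm g, smul_neg, neg_neg]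

@[simp]
theorem bracket_zero_left (f : Poly) : bracket 0 f = 0 := by
  simp only [bracket_eq_poisson, map_zero]

@[simp]
theorem bracket_zero_right (f : Poly) : bracket f 0 = 0 := by
  rw [bracket_antisymm, bracket_zero_left, neg_zero]

theorem bracket_pow_left (f g : Poly) (n : ℕ) :
    bracket (f ^ n) g = n * f ^ (n - 1) * bracket f g := by
  simp only [bracket_eq_poisson, Derivation.leibniz_pow, smul_eq_mul, nsmul_eq_mul, mul_assoc]

theorem bracket_positionSq_J₁ : bracket positionSq J₁ = (2 : ℝ) • positionSq := by
  have hC : (MvPolynomial.C 2 : Poly) = 2 := map_ofNat _ _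
  simp [bracket, positionSq, J₁, q, p, Fin.sum_univ_two, MvPolynomial.pderiv_X,
    Derivation.leibniz, Derivation.leibniz_pow, Pi.single_apply, MvPolynomial.smul_eq_C_mul, hC]
  ring

theorem bracket_momentumSq_J₁ : bracket momentumSq J₁ = (-2 : ℝ) • momentumSq := by
  have hC : (MvPolynomial.C 2 : Poly) = 2 := map_ofNat _ _
  simp [bracket, momentumSq, J₁, q, p, Fin.sum_univ_two, MvPolynomial.pderiv_X,
    Derivation.leibniz, Derivation.leibniz_pow, Pi.single_apply, MvPolynomial.smul_eq_C_mul, hC]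
  ring

theorem bracket_positionSq_momentumSq : bracket positionSq momentumSq = (4 : ℝ) • J₁ := by
  have hC : (MvPolynomial.C 4 : Poly) = 4 := map_ofNat _ _
  simp [bracket, momentumSq, positionSq, J₁, q, p, Fin.sum_univ_two, MvPolynomial.pderiv_X,
    Derivation.leibniz_pow, Pi.single_apply, MvPolynomial.smul_eq_C_mul, hC]
  ring

theorem bracket_J₁_J₂ : bracket J₁ J₂ = 0 := by
  simp [bracket, J₁, J₂, q, p, Fin.sum_univ_two, MvPolynomial.pderiv_X,
    Derivation.leibniz, Pi.single_apply]
  ring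

theorem bracket_positionSq_J₂ : bracket positionSq J₂ = 0 := by
  simp [bracket, positionSq, J₂, q, p, Fin.sum_univ_two, MvPolynomial.pderiv_X,
    Derivation.leibniz, Derivation.leibniz_pow, Pi.single_apply]
  ring

theorem bracket_momentumSq_J₂ : bracket momentumSq J₂ = 0 := by
  simp [bracket, momentumSq, J₂, q, p, Fin.sum_univ_two, MvPolynomial.pderiv_X,
    Derivation.leibniz, Derivation.leibniz_pow, Pi.single_apply]
  ring

/-- The space of rotation-invariant quadratic forms; its powers are the spaces of
rotation-invariant polynomials of even degree. -/
def invariantForms : Submodule ℝ Poly :=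
  Submodule.span ℝ {positionSq, momentumSq, J₁, J₂}

theorem positionSq_mem : positionSq ∈ invariantForms := Submodule.subset_span (by simp)

theorem momentumSq_mem : momentumSq ∈ invariantForms := Submodule.subset_span (by simp)

theorem J₁_mem_invariantForms : J₁ ∈ invariantForms := Submodule.subset_span (by simp)

theorem J₂_mem_invariantForms : J₂ ∈ invariantForms := Submodule.subset_span (by simp)

theorem bracket_mem_invariantForms {f g : Poly} (hf : f ∈ invariantForms)
    (hg : g ∈ invariantForms) : bracket f g ∈ invariantForms := by
  have h1 := Submodule.smul_mem _ (2 : ℝ) positionSq_mem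
  have h2 := Submodule.smul_mem _ (-2 : ℝ) momentumSq_mem
  have h3 := Submodule.smul_mem _ (4 : ℝ) J₁_mem_invariantForms
  induction hf using Submodule.span_induction with
  | zero => rw [bracket_zero_left]; exact zero_mem _
  | add x y _ _ hx hy => rw [bracket_add_left]; exact add_mem hx hy
  | smul c x _ hx => rw [bracket_smul_left]; exact Submodule.smul_mem _ c hx
  | mem x hx =>
    induction hg using Submodule.span_induction with
    | zero => rw [bracket_zero_right]; exact zero_mem _
    | add x y _ _ hx hy => rw [bracket_add_right]; exact add_mem hx hy
    | smul c x _ hx => rw [bracket_smul_right]; exact Submodule.smul_mem _ c hx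
    | mem y hy =>
      have hz := zero_mem invariantForms
      rcases hx with rfl | rfl | rfl | rfl <;> rcases hy with rfl | rfl | rfl | rfl <;>
      first
      | (rw [bracket_self]; exact hz)
      | (simp only [bracket_positionSq_J₁, bracket_momentumSq_J₁, bracket_positionSq_momentumSq,
          bracket_J₁_J₂, bracket_positionSq_J₂, bracket_momentumSq_J₂]; assumption)
      | (rw [bracket_antisymm, neg_mem_iff]; simp only [bracket_positionSq_J₁,
          bracket_momentumSq_J₁, bracket_positionSq_momentumSq,
          bracket_J₁_J₂, bracket_positionSq_J₂, bracket_momentumSq_J₂]; assumption)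

theorem mul_mem_pow {V : Submodule ℝ Poly} {a b : ℕ} {f g : Poly} (hf : f ∈ V ^ a)
    (hg : g ∈ V ^ b) : f * g ∈ V ^ (a + b) :=
  pow_add V a b ▸ Submodule.mul_mem_mul hf hg

theorem bracket_mem_pow {a b : ℕ} {f g : Poly} (hf : f ∈ invariantForms ^ (a + 1))
    (hg : g ∈ invariantForms ^ (b + 1)) : bracket f g ∈ invariantForms ^ (a + b + 1) := by
  have key : ∀ {a : ℕ} {f g : Poly}, f ∈ invariantForms ^ (a + 1) → g ∈ invariantForms →
      bracket f g ∈ invariantForms ^ (a + 1) := by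
    intro a f g hf hg
    induction a generalizing f with
    | zero => simpa using bracket_mem_invariantForms (by simpa using hf) hg
    | succ a ih =>
      rw [pow_succ] at hf
      induction hf using Submodule.mul_induction_on' with
      | mem_mul_mem x hx y hy =>
        rw [bracket_mul_left]
        refine add_mem ?_ ?_
        · have := mul_mem_pow (b := 1) hx (by simpa using bracket_mem_invariantForms hy hg)
          exact this
        · have := mul_mem_pow (a := 1) (by simpa using hy) (ih hx)
          rwa [add_comm 1] at this
      | add x _ y _ hx hy => rw [bracket_add_left]; exact add_mem hx hy
  induction b generalizing g with
  | zero => exact key hf (by simpa using hg)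
  | succ b ih =>
    rw [pow_succ] at hg
    induction hg using Submodule.mul_induction_on' with
    | mem_mul_mem x hx y hy =>
      rw [bracket_mul_right]
      refine add_mem ?_ ?_
      · have := mul_mem_pow hx (key hf hy)
        rwa [show b + 1 + (a + 1) = a + (b + 1) + 1 by ring] at this
      · have := mul_mem_pow (a := 1) (by simpa using hy) (ih hx)
        rwa [show 1 + (a + b + 1) = a + (b + 1) + 1 by ring] at this
    | add x _ y _ hx hy => rw [bracket_add_right]; exact add_mem hx hy

/-- The products of powers of the four generators. -/
def invariantMonomial (a b i j : ℕ) : Poly :=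
  positionSq ^ a * momentumSq ^ b * J₁ ^ i * J₂ ^ j

theorem pow_le_span_invariantMonomial (n : ℕ) : invariantForms ^ n ≤ Submodule.span ℝ
    {f | ∃ a b i j, a + b + i + j = n ∧ f = invariantMonomial a b i j} := by
  induction n with
  | zero =>
    rw [pow_zero, Submodule.one_le]
    exact Submodule.subset_span ⟨0, 0, 0, 0, rfl, by simp [invariantMonomial]⟩
  | succ n ih =>
    rw [pow_succ]
    refine (mul_le_mul' ih le_rfl).trans ?_
    rw [invariantForms, Submodule.span_mul_span, Submodule.span_le]
    rintro _ ⟨_, ⟨a, b, i, j, h, rfl⟩, y, hy, rfl⟩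
    apply Submodule.subset_span
    rcases hy with rfl | rfl | rfl | rfl
    · exact ⟨a + 1, b, i, j, by omega, by simp only [invariantMonomial]; ring⟩
    · exact ⟨a, b + 1, i, j, by omega, by simp only [invariantMonomial]; ring⟩
    · exact ⟨a, b, i + 1, j, by omega, by simp only [invariantMonomial]; ring⟩
    · exact ⟨a, b, i, j + 1, by omega, by simp only [invariantMonomial]; ring⟩

theorem bracket_invariantMonomial_J₁ (a b i j : ℕ) : bracket (invariantMonomial a b i j) J₁ =
    (2 * ((a : ℝ) - b)) • invariantMonomial a b i j := by
  have h2 : bracket J₂ J₁ = 0 := by rw [bracket_antisymm, bracket_J₁_J₂, neg_zero]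
  have hp : ∀ (f : Poly) (c : ℝ) (n : ℕ), bracket f J₁ = c • f →
      bracket (f ^ n) J₁ = (n * c) • f ^ n := by
    intro f c n h
    cases n with
    | zero => rw [bracket_pow_left]; simp
    | succ n =>
      rw [bracket_pow_left, h, Nat.add_sub_cancel, MvPolynomial.smul_eq_C_mul,
        MvPolynomial.smul_eq_C_mul, map_mul, map_natCast]
      ring
  rw [invariantMonomial, bracket_mul_left, bracket_mul_left, bracket_mul_left,
    hp _ _ _ bracket_positionSq_J₁, hp _ _ _ bracket_momentumSq_J₁,
    hp J₁ 0 i (by rw [bracket_self, zero_smul]), hp J₂ 0 j (by rw [h2, zero_smul])]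
  simp only [MvPolynomial.smul_eq_C_mul, map_mul, map_sub, map_neg, map_natCast, map_zero]
  ring

/-- The rotation-invariant polynomials that are homogeneous of degree `d`; there are none of odd
degree except zero. -/
def invariantSubmodule (d : ℕ) : Submodule ℝ Poly :=
  if Even d then invariantForms ^ (d / 2) else ⊥

theorem invariantSubmodule_even (n : ℕ) : invariantSubmodule (2 * n) = invariantForms ^ n := by
  rw [invariantSubmodule, if_pos (even_two_mul n), Nat.mul_div_cancel_left _ two_pos]

theorem invariantSubmodule_odd (n : ℕ) : invariantSubmodule (2 * n + 1) = ⊥ := by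
  rw [invariantSubmodule, if_neg (by simp)]

theorem bracket_mem_invariantSubmodule {a b : ℕ} {f g : Poly}
    (hf : f ∈ invariantSubmodule (a + 2)) (hg : g ∈ invariantSubmodule (b + 2)) :
    bracket f g ∈ invariantSubmodule (a + b + 2) := by
  rcases Nat.even_or_odd' a with ⟨m, rfl | rfl⟩
  · rcases Nat.even_or_odd' b with ⟨n, rfl | rfl⟩
    · rw [show 2 * m + 2 = 2 * (m + 1) by ring, invariantSubmodule_even] at hf
      rw [show 2 * n + 2 = 2 * (n + 1) by ring, invariantSubmodule_even] at hg
      rw [show 2 * m + 2 * n + 2 = 2 * (m + n + 1) by ring, invariantSubmodule_even]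
      exact bracket_mem_pow hf hg
    · rw [show 2 * n + 1 + 2 = 2 * (n + 1) + 1 by ring, invariantSubmodule_odd,
        Submodule.mem_bot] at hg
      rw [hg, bracket_zero_right]
      exact zero_mem _
  · rw [show 2 * m + 1 + 2 = 2 * (m + 1) + 1 by ring, invariantSubmodule_odd,
      Submodule.mem_bot] at hf
    rw [hf, bracket_zero_left]
    exact zero_mem _

theorem isHomogeneous_of_mem_invariantSubmodule {d : ℕ} {f : Poly}
    (hf : f ∈ invariantSubmodule d) : f.IsHomogeneous d := by
  have hX : ∀ a : Coord, (MvPolynomial.X a : Poly).IsHomogeneous 1 :=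
    fun a => MvPolynomial.isHomogeneous_X ℝ a
  have h1 : invariantForms ≤ MvPolynomial.homogeneousSubmodule Coord ℝ 2 := by
    rw [invariantForms, Submodule.span_le]
    rintro x (rfl | rfl | rfl | rfl)
    · exact ((hX _).pow 2).add ((hX _).pow 2)
    · exact ((hX _).pow 2).add ((hX _).pow 2)
    · exact ((hX _).mul (hX _)).add ((hX _).mul (hX _))
    · exact ((hX _).mul (hX _)).sub ((hX _).mul (hX _))
  rcases Nat.even_or_odd' d with ⟨n, rfl | rfl⟩
  · rw [invariantSubmodule_even] at hf
    induction n generalizing f with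
    | zero =>
      rw [pow_zero, Submodule.mem_one] at hf
      obtain ⟨c, rfl⟩ := hf
      exact MvPolynomial.isHomogeneous_C _ c
    | succ n ih =>
      rw [pow_succ] at hf
      induction hf using Submodule.mul_induction_on' with
      | mem_mul_mem x hx y hy => exact (ih hx).mul (h1 hy)
      | add x _ y _ hx hy => exact hx.add hy
  · rw [invariantSubmodule_odd, Submodule.mem_bot] at hf
    rw [hf]
    exact MvPolynomial.isHomogeneous_zero _ _ _

theorem bracket_J₂_of_mem_invariantSubmodule {d : ℕ} {f : Poly}
    (hf : f ∈ invariantSubmodule d) : bracket J₂ f = 0 := by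
  rw [bracket_antisymm, neg_eq_zero]
  rcases Nat.even_or_odd' d with ⟨n, rfl | rfl⟩
  · rw [invariantSubmodule_even] at hf
    induction n generalizing f with
    | zero =>
      rw [pow_zero, Submodule.mem_one] at hf
      obtain ⟨c, rfl⟩ := hf
      rw [bracket_eq_poisson, Derivation.map_algebraMap]
    | succ n ih =>
      rw [pow_succ] at hf
      induction hf using Submodule.mul_induction_on' with
      | mem_mul_mem x hx y hy =>
        rw [bracket_mul_left, ih hx, mul_zero, add_zero]
        have : bracket y J₂ = 0 := by
          induction hy using Submodule.span_induction with
          | zero => exact bracket_zero_left _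
          | add x y _ _ hx hy => rw [bracket_add_left, hx, hy, add_zero]
          | smul c x _ hx => rw [bracket_smul_left, hx, smul_zero]
          | mem y hy =>
            rcases hy with rfl | rfl | rfl | rfl
            exacts [bracket_positionSq_J₂, bracket_momentumSq_J₂, bracket_J₁_J₂, bracket_self _]
        rw [this, mul_zero]
      | add x _ y _ hx hy => rw [bracket_add_left, hx, hy, add_zero]
  · rw [invariantSubmodule_odd, Submodule.mem_bot] at hf
    rw [hf, bracket_zero_left]

theorem bracket_C_mul_left (c : ℝ) (f g : Poly) :
    bracket (MvPolynomial.C c * f) g = c • bracket f g := by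
  rw [← MvPolynomial.smul_eq_C_mul, bracket_smul_left]

theorem invariantMonomial_mem_pow (a b i j : ℕ) :
    invariantMonomial a b i j ∈ invariantForms ^ (a + b + i + j) :=
  mul_mem_pow (mul_mem_pow (mul_mem_pow (Submodule.pow_mem_pow _ positionSq_mem a)
    (Submodule.pow_mem_pow _ momentumSq_mem b)) (Submodule.pow_mem_pow _ J₁_mem_invariantForms i))
    (Submodule.pow_mem_pow _ J₂_mem_invariantForms j)

theorem span_invariantMonomial_le_pow (n : ℕ) : Submodule.span ℝ
    {f | ∃ a b i j, a + b + i + j = n ∧ f = invariantMonomial a b i j} ≤ invariantForms ^ n := by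
  rw [Submodule.span_le]
  rintro _ ⟨a, b, i, j, rfl, rfl⟩
  exact invariantMonomial_mem_pow a b i j

/-- The homological equation: modulo the range of the square of `{√2 J₁, ·}`, a rotation-invariant
polynomial is a polynomial in `J₁` and `J₂`. -/
theorem exists_homological {n : ℕ} {f : Poly} (hf : f ∈ invariantForms ^ n) :
    ∃ V ∈ invariantForms ^ n, ∃ P : MvPolynomial (Fin 2) ℝ, P.IsHomogeneous n ∧
      f + bracket (MvPolynomial.C √2 * J₁) (bracket (MvPolynomial.C √2 * J₁) V) =
        MvPolynomial.aeval ![J₁, J₂] P := by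
  induction pow_le_span_invariantMonomial n hf using Submodule.span_induction with
  | zero =>
    exact ⟨0, zero_mem _, 0, MvPolynomial.isHomogeneous_zero _ _ _, by simp⟩
  | add x y hx hy ihx ihy =>
    have hle := span_invariantMonomial_le_pow n
    obtain ⟨V, hV, P, hP, h⟩ := ihx (hle hx)
    obtain ⟨V', hV', P', hP', h'⟩ := ihy (hle hy)
    refine ⟨V + V', add_mem hV hV', P + P', hP.add hP', ?_⟩
    rw [bracket_add_right, bracket_add_right, map_add, ← h, ← h']
    ring
  | smul c x hx ih =>
    have hle := span_invariantMonomial_le_pow n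
    obtain ⟨V, hV, P, hP, h⟩ := ih (hle hx)
    refine ⟨c • V, Submodule.smul_mem _ c hV, c • P,
      (MvPolynomial.homogeneousSubmodule (Fin 2) ℝ n).smul_mem c hP, ?_⟩
    rw [bracket_smul_right, bracket_smul_right, map_smul, ← h, smul_add]
  | mem x hx =>
    obtain ⟨a, b, i, j, h, rfl⟩ := hx
    by_cases hab : a = b
    · subst hab
      refine ⟨0, zero_mem _, (MvPolynomial.X 0 ^ 2 + MvPolynomial.X 1 ^ 2) ^ a *
        MvPolynomial.X 0 ^ i * MvPolynomial.X 1 ^ j, ?_, ?_⟩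
      · have hX : ∀ (c : Fin 2) (k : ℕ),
            (MvPolynomial.X c ^ k : MvPolynomial (Fin 2) ℝ).IsHomogeneous k :=
          fun c k => by simpa using (MvPolynomial.isHomogeneous_X ℝ c).pow k
        have := ((((hX 0 2).add (hX 1 2)).pow a).mul (hX 0 i)).mul (hX 1 j)
        rwa [show 2 * a + i + j = n by omega] at this
      · simp [invariantMonomial, ← positionSq_mul_momentumSq, mul_pow]
    · -- `{√2 J₁, ·}` multiplies the monomial by `-2 √2 (a - b)`.
      have hne : ((a : ℝ) - b) ≠ 0 := sub_ne_zero.2 (by exact_mod_cast hab)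
      refine ⟨(-(8 * ((a : ℝ) - b) ^ 2)⁻¹) • invariantMonomial a b i j,
        Submodule.smul_mem _ _ (h ▸ invariantMonomial_mem_pow a b i j), 0,
        MvPolynomial.isHomogeneous_zero _ _ _, ?_⟩
      have hJ : bracket J₁ (invariantMonomial a b i j) =
          (-(2 * ((a : ℝ) - b))) • invariantMonomial a b i j := by
        rw [bracket_antisymm, bracket_invariantMonomial_J₁, neg_smul]
      simp only [bracket_C_mul_left, bracket_smul_right, hJ]
      simp only [smul_smul, map_zero]
      rw [← one_smul ℝ (invariantMonomial a b i j), smul_smul, ← add_smul]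
      convert zero_smul ℝ (invariantMonomial a b i j) using 2
      have h2 : √2 * √2 = (2 : ℝ) := Real.mul_self_sqrt (by norm_num)
      field_simp
      linear_combination (-4 : ℝ) * h2

/-! ### The Hamiltonian -/

/-- The Hamiltonian in terms of the generators of the rotation-invariant polynomials. -/
theorem H_eq : H = MvPolynomial.C √2 * J₁ +
    MvPolynomial.C (1 / 8) * (positionSq + momentumSq - 2 * J₁) ^ 2 := by
  have h2 : √2 ^ 2 = (2 : ℝ) := Real.sq_sqrt (by norm_num)
  have h4 : √√2 ^ 2 = √2 := Real.sq_sqrt (by positivity)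
  have hx : ((√√2)⁻¹ * (√2)⁻¹) ^ 2 = √2 / 4 := by
    rw [mul_pow, inv_pow, inv_pow, h2, h4]
    field_simp
    rw [h2]; norm_num
  have hy : (√√2 * (√2)⁻¹) ^ 2 = √2 / 2 := by
    rw [mul_pow, inv_pow, h2, h4]
    ring
  have hx4 : (√2 / 4) ^ 2 = 1 / 8 := by rw [div_pow, h2]; norm_num
  have hC : ∀ c : ℝ, ∀ f : Poly, (MvPolynomial.C c * f) ^ 2 = MvPolynomial.C (c ^ 2) * f ^ 2 :=
    fun c f => by rw [mul_pow, map_pow]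
  have e1 : (MvPolynomial.C (1 / 2) : Poly) * MvPolynomial.C (√2 / 2) = MvPolynomial.C (√2 / 4) := by
    rw [← map_mul]; congr 1; ring
  have e2 : (MvPolynomial.C √2 : Poly) = MvPolynomial.C (√2 / 4) * 4 := by
    rw [show (4 : Poly) = MvPolynomial.C 4 from (map_ofNat _ _).symm, ← map_mul]; congr 1; ring
  have e3 : (MvPolynomial.C (1 / 8) : Poly) = MvPolynomial.C (√2 / 4) ^ 2 := by
    rw [← map_pow, hx4]
  simp only [H, hamiltonian, q, p, map_add, map_sub, map_mul, map_pow, MvPolynomial.aeval_X,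
    MvPolynomial.aeval_C, williamson, positionSq, momentumSq, J₁]
  simp only [MvPolynomial.algebraMap_eq, ← map_mul, hC, hx, hy]
  rw [← mul_add, ← mul_assoc, e1, e2, e3]
  ring

/-- The quartic part of the Hamiltonian. -/
def quarticPart : Poly := MvPolynomial.C (1 / 8) * (positionSq + momentumSq - 2 * J₁) ^ 2

theorem quarticPart_mem : quarticPart ∈ invariantForms ^ 2 := by
  rw [quarticPart, ← MvPolynomial.smul_eq_C_mul, two_mul]
  exact Submodule.smul_mem _ _ (Submodule.pow_mem_pow _ (sub_mem (add_mem positionSq_mem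
    momentumSq_mem) (add_mem J₁_mem_invariantForms J₁_mem_invariantForms)) 2)

theorem homogeneousComponent_H (n : ℕ) : MvPolynomial.homogeneousComponent n H =
    if n = 2 then MvPolynomial.C √2 * J₁ else if n = 4 then quarticPart else 0 := by
  have h1 : (MvPolynomial.C √2 * J₁ : Poly) ∈ MvPolynomial.homogeneousSubmodule Coord ℝ 2 := by
    rw [← MvPolynomial.smul_eq_C_mul]
    refine Submodule.smul_mem _ _ (isHomogeneous_of_mem_invariantSubmodule ?_)
    rw [show 2 = 2 * 1 from rfl, invariantSubmodule_even, pow_one]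
    exact J₁_mem_invariantForms
  have h2 : quarticPart ∈ MvPolynomial.homogeneousSubmodule Coord ℝ 4 := by
    refine isHomogeneous_of_mem_invariantSubmodule ?_
    rw [show 4 = 2 * 2 from rfl, invariantSubmodule_even]
    exact quarticPart_mem
  rw [H_eq, ← quarticPart, map_add, MvPolynomial.homogeneousComponent_of_mem h1,
    MvPolynomial.homogeneousComponent_of_mem h2]
  split_ifs with h h' <;> first | omega | simp

theorem scaled_H_zero : scaled H 0 = MvPolynomial.C √2 * J₁ := by
  simp [scaled, homogeneousComponent_H]

theorem scaled_H_two : scaled H 2 = (2 : ℝ) • quarticPart := by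
  simp [scaled, homogeneousComponent_H]

theorem scaled_H_of_ne {n : ℕ} (h0 : n ≠ 0) (h2 : n ≠ 2) : scaled H n = 0 := by
  rw [scaled, homogeneousComponent_H, if_neg (by omega), if_neg (by omega), smul_zero]

theorem scaled_H_mem (n : ℕ) : scaled H n ∈ invariantSubmodule (n + 2) := by
  by_cases h0 : n = 0
  · subst h0
    rw [scaled_H_zero, ← MvPolynomial.smul_eq_C_mul, show 0 + 2 = 2 * 1 from rfl,
      invariantSubmodule_even, pow_one]
    exact Submodule.smul_mem _ _ J₁_mem_invariantForms
  · by_cases h2 : n = 2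
    · subst h2
      rw [scaled_H_two, show 2 + 2 = 2 * 2 from rfl, invariantSubmodule_even]
      exact Submodule.smul_mem _ _ quarticPart_mem
    · rw [scaled_H_of_ne h0 h2]
      exact zero_mem _

/-! ### The Lie–Deprit algorithm -/

theorem triangle_mem {F W : ℕ → Poly} (hF : ∀ i, F i ∈ invariantSubmodule (i + 2)) {n : ℕ}
    (hW : ∀ k, 1 ≤ k → k ≤ n → W k ∈ invariantSubmodule (k + 2)) (i j : ℕ) (hij : i + j ≤ n) :
    triangle F W i j ∈ invariantSubmodule (i + j + 2) := by
  induction i generalizing j with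
  | zero => simpa [triangle] using hF j
  | succ i ih =>
    rw [triangle]
    refine add_mem ?_ (sum_mem fun k hk => Submodule.smul_mem _ _ ?_)
    · have := ih (j + 1) (by omega)
      rwa [show i + (j + 1) + 2 = i + 1 + j + 2 by ring] at this
    · have hk' : k ≤ j := by simpa [Nat.lt_succ_iff] using hk
      have := bracket_mem_invariantSubmodule (ih (j - k) (by omega))
        (hW (k + 1) (by omega) (by omega))
      rwa [show i + (j - k) + (k + 1) + 2 = i + 1 + j + 2 by omega] at this

theorem triangle_succ (F W : ℕ → Poly) (i j : ℕ) : triangle F W (i + 1) j =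
    triangle F W i (j + 1) + ∑ k ∈ Finset.range (j + 1),
      (j.choose k : ℝ) • bracket (triangle F W i (j - k)) (W (k + 1)) := rfl

theorem triangle_congr {F W W' : ℕ → Poly} (i j : ℕ)
    (h : ∀ k, 1 ≤ k → k ≤ i + j → W k = W' k) : triangle F W i j = triangle F W' i j := by
  induction i generalizing j with
  | zero => rfl
  | succ i ih =>
    rw [triangle_succ, triangle_succ, ih (j + 1) fun k h1 h2 => h k h1 (by omega)]
    refine congrArg (triangle F W' i (j + 1) + ·) (Finset.sum_congr rfl fun k hk => ?_)
    have hk' : k ≤ j := by simpa [Nat.lt_succ_iff] using hk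
    rw [ih (j - k) fun l h1 h2 => h l h1 (by omega), h (k + 1) (by omega) (by omega)]

/-- The last term `W n` of the generating function enters the entries with `i + j = n` only through
its bracket with `F 0`. -/
theorem triangle_update {F W : ℕ → Poly} (i j : ℕ) (w : Poly) (hW : W (i + 1 + j) = 0) :
    triangle F (Function.update W (i + 1 + j) w) (i + 1) j =
      triangle F W (i + 1) j + bracket (F 0) w := by
  induction i generalizing j with
  | zero =>
    have h1 : 0 + 1 + j = j + 1 := by ring
    rw [h1] at hW ⊢
    simp only [triangle, Finset.sum_range_succ, Function.update_self, hW, Nat.choose_self,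
      Nat.cast_one, one_smul, Nat.sub_self, bracket_zero_right, add_zero]
    rw [add_assoc]
    refine congrArg (fun x => F (j + 1) + (x + bracket (F 0) w))
      (Finset.sum_congr rfl fun k hk => ?_)
    rw [Function.update_of_ne]
    have := Finset.mem_range.1 hk
    omega
  | succ i ih =>
    have h1 : i + 1 + (j + 1) = i + 1 + 1 + j := by ring
    have h2 := ih (j + 1) (by rwa [h1])
    rw [h1] at h2
    rw [triangle_succ _ _ (i + 1), triangle_succ _ _ (i + 1), h2, add_right_comm]
    refine congrArg (fun x => triangle F W (i + 1) (j + 1) + x + bracket (F 0) w)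
      (Finset.sum_congr rfl fun k hk => ?_)
    have hk' : k ≤ j := by simpa [Nat.lt_succ_iff] using hk
    have h3 : triangle F (Function.update W (i + 1 + 1 + j) w) (i + 1) (j - k) =
        triangle F W (i + 1) (j - k) :=
      triangle_congr _ _ fun l _ hl => Function.update_of_ne (show l ≠ i + 1 + 1 + j by omega) w W
    rw [Function.update_of_ne (show k + 1 ≠ i + 1 + 1 + j by omega), h3]

theorem exists_homological_invariantSubmodule {d : ℕ} {f : Poly} (hf : f ∈ invariantSubmodule d) :
    ∃ V ∈ invariantSubmodule d, ∃ P : MvPolynomial (Fin 2) ℝ, P.IsHomogeneous (d / 2) ∧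
      f + bracket (MvPolynomial.C √2 * J₁) (bracket (MvPolynomial.C √2 * J₁) V) =
        MvPolynomial.aeval ![J₁, J₂] P := by
  rcases Nat.even_or_odd' d with ⟨n, rfl | rfl⟩
  · rw [Nat.mul_div_cancel_left _ two_pos]
    rw [invariantSubmodule_even] at hf ⊢
    exact exists_homological hf
  · rw [invariantSubmodule_odd, Submodule.mem_bot] at hf
    exact ⟨0, zero_mem _, 0, MvPolynomial.isHomogeneous_zero _ _ _, by simp [hf]⟩

/-- The Lie–Deprit algorithm finds a generating function without resonant terms that brings the
Hamiltonian to normal form. -/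
theorem exists_generator : ∃ V : ℕ → Poly, (∀ k, V k ∈ invariantSubmodule (k + 2)) ∧
    ∀ n, ∃ P : MvPolynomial (Fin 2) ℝ, P.IsHomogeneous ((n + 2) / 2) ∧
      triangle (scaled H) (fun k => bracket (MvPolynomial.C √2 * J₁) (V k)) n 0 =
        MvPolynomial.aeval ![J₁, J₂] P := by
  classical
  have hsol : ∀ (n : ℕ) (f : Poly), ∃ V ∈ invariantSubmodule (n + 2),
      f ∈ invariantSubmodule (n + 2) → ∃ P : MvPolynomial (Fin 2) ℝ,
        P.IsHomogeneous ((n + 2) / 2) ∧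
        f + bracket (MvPolynomial.C √2 * J₁) (bracket (MvPolynomial.C √2 * J₁) V) =
          MvPolynomial.aeval ![J₁, J₂] P := by
    intro n f
    by_cases hf : f ∈ invariantSubmodule (n + 2)
    · obtain ⟨V, hV, h⟩ := exists_homological_invariantSubmodule hf
      exact ⟨V, hV, fun _ => h⟩
    · exact ⟨0, zero_mem _, fun h => absurd h hf⟩
  choose sol hsol_mem hsol using hsol
  have had : ∀ n V, V ∈ invariantSubmodule (n + 2) →
      bracket (MvPolynomial.C √2 * J₁) V ∈ invariantSubmodule (n + 2) := fun n V hV => by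
    have := bracket_mem_invariantSubmodule (scaled_H_mem 0) hV
    rwa [scaled_H_zero, zero_add] at this
  -- `W n` is the generating function with the terms up to index `n - 1`, and zero from there on.
  let W : ℕ → ℕ → Poly := fun n => Nat.rec 0 (fun n W => Function.update W n
    (bracket (MvPolynomial.C √2 * J₁) (sol n (triangle (scaled H) W n 0)))) n
  let V : ℕ → Poly := fun n => sol n (triangle (scaled H) (W n) n 0)
  have hW : ∀ n, W (n + 1) = Function.update (W n) n (bracket (MvPolynomial.C √2 * J₁) (V n)) :=
    fun n => rfl
  have hWlt : ∀ n k, W n k = if k < n then bracket (MvPolynomial.C √2 * J₁) (V k) else 0 := by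
    intro n
    induction n with
    | zero => intro k; rfl
    | succ n ih =>
      intro k
      rw [hW]
      by_cases hk : k = n
      · subst hk; simp
      · rw [Function.update_of_ne hk, ih]
        congr 1
        rw [eq_iff_iff]
        omega
  have hVmem : ∀ k, V k ∈ invariantSubmodule (k + 2) := fun k => hsol_mem _ _
  refine ⟨V, hVmem, fun n => ?_⟩
  have hmem : triangle (scaled H) (W n) n 0 ∈ invariantSubmodule (n + 2) := by
    refine triangle_mem scaled_H_mem (n := n) (fun k _ _ => ?_) n 0 le_rfl
    rw [hWlt]
    split_ifs
    · exact had k _ (hVmem k)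
    · exact zero_mem _
  cases n with
  | zero =>
    refine ⟨MvPolynomial.C √2 * MvPolynomial.X 0, ?_, ?_⟩
    · simpa using (MvPolynomial.isHomogeneous_C (Fin 2) √2).mul (MvPolynomial.isHomogeneous_X ℝ 0)
    · rw [triangle, scaled_H_zero]
      simp
  | succ n =>
    obtain ⟨P, hP, h⟩ := hsol (n + 1) _ hmem
    refine ⟨P, hP, ?_⟩
    have h2 := triangle_update (F := scaled H) (W := W (n + 1)) n 0
      (bracket (MvPolynomial.C √2 * J₁) (V (n + 1)))
      ((hWlt (n + 1) (n + 1 + 0)).trans (if_neg (by omega)))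
    rw [← h, ← scaled_H_zero]
    rw [scaled_H_zero] at h2 ⊢
    refine Eq.trans ?_ h2
    refine triangle_congr _ _ fun k _ hk => ?_
    by_cases hk' : k = n + 1
    · subst hk'; simp
    · rw [Function.update_of_ne (by omega)]
      exact ((hWlt (n + 1) k).trans (if_pos (by omega))).symm

theorem coeff_inJ_congr {N N' : MvPowerSeries (Fin 2) ℝ} {m : Coord →₀ ℕ}
    (h : ∀ d : Fin 2 →₀ ℕ, 2 * d.degree = m.degree →
      MvPowerSeries.coeff d N = MvPowerSeries.coeff d N') :
    MvPowerSeries.coeff m (inJ N) = MvPowerSeries.coeff m (inJ N') := by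
  have hhom : ∀ d : Fin 2 →₀ ℕ, 2 * d.degree ≠ m.degree →
      MvPowerSeries.coeff m (d.prod fun i e => invariants i ^ e) = 0 := by
    intro d hd
    have h1 : (d.prod fun i e => invariants i ^ e) =
        ((J₁ ^ d 0 * J₂ ^ d 1 : Poly) : Series) := by
      rw [Finsupp.prod_fintype _ _ (by simp), Fin.prod_univ_two]
      simp [invariants]
    have h2 : (J₁ ^ d 0 * J₂ ^ d 1 : Poly).IsHomogeneous (2 * d.degree) := by
      refine isHomogeneous_of_mem_invariantSubmodule ?_
      rw [invariantSubmodule_even, degree_fin_two]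
      exact mul_mem_pow (Submodule.pow_mem_pow _ J₁_mem_invariantForms _)
        (Submodule.pow_mem_pow _ J₂_mem_invariantForms _)
    rw [h1, MvPolynomial.coeff_coe, h2.coeff_eq_zero (Ne.symm hd)]
  rw [inJ_eq, inJ_eq, MvPowerSeries.coeff_subst hasSubst_invariants,
    MvPowerSeries.coeff_subst hasSubst_invariants]
  refine finsum_congr fun d => ?_
  by_cases hd : 2 * d.degree = m.degree
  · rw [h d hd]
  · rw [hhom d hd, smul_zero, smul_zero]

theorem inJ_coe (P : MvPolynomial (Fin 2) ℝ) : inJ (P : MvPowerSeries (Fin 2) ℝ) =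
    ((MvPolynomial.aeval ![J₁, J₂] P : Poly) : Series) := by
  rw [inJ_eq, MvPowerSeries.subst_coe]
  have h1 : invariants = fun i => MvPolynomial.coeToMvPowerSeries.algHom ℝ
      ((![J₁, J₂] : Fin 2 → Poly) i) := by
    funext i
    fin_cases i <;> simp [invariants, MvPolynomial.coeToMvPowerSeries.algHom_apply]
  rw [h1, ← MvPolynomial.comp_aeval_apply]
  simp [MvPolynomial.coeToMvPowerSeries.algHom_apply]

theorem lieTransform_scaled_coeff {K : Poly} {W : ℕ → Poly} (hW : IsGenerator W)
    (m : Coord →₀ ℕ) : MvPowerSeries.coeff m (lieTransform (scaled K) W) =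
      if 2 ≤ m.degree then (((m.degree - 2).factorial : ℝ))⁻¹ *
        MvPolynomial.coeff m (triangle (scaled K) W (m.degree - 2) 0) else 0 := by
  have h := coeff_coeff_dilate (lieTransform (scaled K) W) m.degree m
  rw [if_pos rfl, dilate_lieTransform (isHomogeneous_scaled K) hW,
    PowerSeries.coeff_X_pow_mul'] at h
  rw [← h]
  split_ifs
  · rw [coeff_coeffCoe, coeff_depritTransform_expSeries, MvPolynomial.coeff_coe,
      MvPolynomial.coeff_smul, smul_eq_mul]
  · rw [map_zero]

/-- The normal form computed by the Lie–Deprit algorithm; `P n` is its homogeneous part of degree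
`n + 1` in `(J₁, J₂)`. -/
theorem exists_normalization : ∃ (W : ℕ → Poly) (N : MvPowerSeries (Fin 2) ℝ)
    (P : ℕ → MvPolynomial (Fin 2) ℝ), IsGenerator W ∧ IsNonresonant W ∧
    (∀ k, W k ∈ invariantSubmodule (k + 2)) ∧
    lieTransform (scaled H) W = inJ N ∧
    (∀ n, (P n).IsHomogeneous (n + 1)) ∧
    (∀ n, ((2 * n).factorial : ℝ)⁻¹ • triangle (scaled H) W (2 * n) 0 =
      MvPolynomial.aeval ![J₁, J₂] (P n)) ∧
    MvPowerSeries.coeff 0 N = 0 ∧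
    ∀ d n, d.degree = n + 1 → MvPowerSeries.coeff d N = MvPolynomial.coeff d (P n) := by
  obtain ⟨V, hV, h⟩ := exists_generator
  have hWmem : ∀ k, bracket (MvPolynomial.C √2 * J₁) (V k) ∈ invariantSubmodule (k + 2) :=
    fun k => by
      have := bracket_mem_invariantSubmodule (scaled_H_mem 0) (hV k)
      rwa [scaled_H_zero, zero_add] at this
  set W : ℕ → Poly := fun k => bracket (MvPolynomial.C √2 * J₁) (V k) with hWdef
  have hgen : IsGenerator W := fun i _ => isHomogeneous_of_mem_invariantSubmodule (hWmem i)
  choose Q hQ hQt using h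
  let P : ℕ → MvPolynomial (Fin 2) ℝ := fun n => ((2 * n).factorial : ℝ)⁻¹ • Q (2 * n)
  let N : MvPowerSeries (Fin 2) ℝ := fun d =>
    if d.degree = 0 then 0 else MvPolynomial.coeff d (P (d.degree - 1))
  have hPt : ∀ n, ((2 * n).factorial : ℝ)⁻¹ • triangle (scaled H) W (2 * n) 0 =
      MvPolynomial.aeval ![J₁, J₂] (P n) := fun n => by rw [hQt, map_smul]
  have hPh : ∀ n, (P n).IsHomogeneous (n + 1) := fun n => by
    have := hQ (2 * n)
    rw [show (2 * n + 2) / 2 = n + 1 by omega] at this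
    exact (MvPolynomial.homogeneousSubmodule (Fin 2) ℝ (n + 1)).smul_mem _ this
  have hN0 : MvPowerSeries.coeff 0 N = 0 := by
    change (if (0 : Fin 2 →₀ ℕ).degree = 0 then (0 : ℝ) else
      MvPolynomial.coeff 0 (P ((0 : Fin 2 →₀ ℕ).degree - 1))) = _
    exact if_pos (map_zero _)
  have hN : ∀ d n, d.degree = n + 1 →
      MvPowerSeries.coeff d N = MvPolynomial.coeff d (P n) := fun d n hd => by
    change (if d.degree = 0 then (0 : ℝ) else MvPolynomial.coeff d (P (d.degree - 1))) = _
    rw [if_neg (by omega), hd, Nat.add_sub_cancel]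
  refine ⟨W, N, P, hgen, fun i _ => ⟨V i, isHomogeneous_of_mem_invariantSubmodule (hV i),
    bracket_J₂_of_mem_invariantSubmodule (hV i), rfl⟩, hWmem, ?_, hPh, hPt, hN0, hN⟩
  ext m
  rw [lieTransform_scaled_coeff hgen]
  rcases Nat.even_or_odd' m.degree with ⟨n, hn | hn⟩
  · cases n with
    | zero =>
      rw [if_neg (by omega), coeff_inJ_congr (N' := ((0 : MvPolynomial (Fin 2) ℝ) :
        MvPowerSeries (Fin 2) ℝ)), inJ_coe]
      · simp
      · intro d hd
        have : d = 0 := by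
          rw [← Finsupp.degree_eq_zero_iff]
          omega
        rw [this, hN0]
        simp
    | succ n =>
      rw [if_pos (by omega), coeff_inJ_congr (N' := (P n : MvPowerSeries (Fin 2) ℝ)), inJ_coe,
        ← hPt, MvPolynomial.coeff_coe, MvPolynomial.coeff_smul, smul_eq_mul,
        show m.degree - 2 = 2 * n by omega]
      intro d hd
      rw [hN d n (by omega), MvPolynomial.coeff_coe]
  · rw [coeff_inJ_congr (N' := ((0 : MvPolynomial (Fin 2) ℝ) : MvPowerSeries (Fin 2) ℝ))
      (fun d hd => by omega), inJ_coe, map_zero, MvPolynomial.coe_zero, map_zero]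
    split_ifs with h2
    · have := triangle_mem scaled_H_mem (n := m.degree - 2) (fun k _ _ => hWmem k)
        (m.degree - 2) 0 (by omega)
      rw [show m.degree - 2 + 0 + 2 = 2 * n + 1 by omega, invariantSubmodule_odd,
        Submodule.mem_bot] at this
      rw [this, MvPolynomial.coeff_zero, mul_zero]
    · rfl

/-! ### A moment functional on polynomials in one variable -/

/-- The integral of a polynomial over the segment from `-i` to `i` in the complex plane (up to the
factor `i`). -/
def segmentIntegral : Polynomial ℝ →ₗ[ℝ] ℂ where
  toFun g := ∫ σ in (-1 : ℝ)..1, Polynomial.aeval (Complex.I * (σ : ℂ)) g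
  map_add' f g := by
    simp only [map_add]
    exact intervalIntegral.integral_add
      (Continuous.intervalIntegrable (by fun_prop) _ _)
      (Continuous.intervalIntegrable (by fun_prop) _ _)
  map_smul' c g := by
    simp only [map_smul, RingHom.id_apply]
    exact intervalIntegral.integral_smul c _

theorem segmentIntegral_apply (g : Polynomial ℝ) : segmentIntegral g =
    ∫ σ in (-1 : ℝ)..1, Polynomial.aeval (Complex.I * (σ : ℂ)) g := rfl

/-- The boundary term vanishes because `1 + X ^ 2` has the zeros `i` and `-i`. -/
theorem segmentIntegral_derivative (g : Polynomial ℝ) :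
    segmentIntegral (Polynomial.derivative ((Polynomial.X ^ 2 + 1) * g)) = 0 := by
  set f := (Polynomial.X ^ 2 + 1) * g with hf
  have hderiv : ∀ σ : ℝ, HasDerivAt (fun σ : ℝ => -Complex.I *
      Polynomial.aeval (Complex.I * (σ : ℂ)) f)
      (Polynomial.aeval (Complex.I * (σ : ℂ)) (Polynomial.derivative f)) σ := by
    intro σ
    have h1 : HasDerivAt (fun z : ℂ => Complex.I * z) (Complex.I * 1) (σ : ℂ) :=
      (hasDerivAt_id (σ : ℂ)).const_mul Complex.I
    have h2 := ((f.hasDerivAt_aeval (Complex.I * (σ : ℂ))).comp (σ : ℂ) h1).comp_ofReal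
    have h3 := h2.const_mul (-Complex.I)
    refine h3.congr_deriv ?_
    linear_combination (-(Polynomial.aeval (Complex.I * (σ : ℂ)) (Polynomial.derivative f))) *
      Complex.I_mul_I
  rw [segmentIntegral_apply, intervalIntegral.integral_eq_sub_of_hasDerivAt
    (fun σ _ => hderiv σ) (Continuous.intervalIntegrable (by fun_prop) _ _)]
  simp [hf]

/-- A polynomial all of whose moments, from some order on, vanish is zero. -/
theorem eq_zero_of_segmentIntegral (g : Polynomial ℝ) (c : ℕ)
    (h : ∀ j, segmentIntegral (Polynomial.X ^ (j + c) * g) = 0) : g = 0 := by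
  set f := Polynomial.X ^ c * g with hf
  have h1 : ∀ r : Polynomial ℝ, segmentIntegral (r * f) = 0 := by
    intro r
    induction r using Polynomial.induction_on' with
    | add r s hr hs => rw [add_mul, map_add, hr, hs, add_zero]
    | monomial n a =>
      rw [← Polynomial.C_mul_X_pow_eq_monomial, mul_assoc, ← Polynomial.smul_eq_C_mul, map_smul,
        hf, ← mul_assoc, ← pow_add, h, smul_zero]
  have hconj : ∀ σ : ℝ, Polynomial.aeval (Complex.I * (σ : ℂ)) (f.comp (-Polynomial.X) * f) =
      ((Complex.normSq (Polynomial.aeval (Complex.I * (σ : ℂ)) f) : ℝ) : ℂ) := by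
    intro σ
    rw [map_mul, Polynomial.aeval_comp, map_neg, Polynomial.aeval_X, Complex.normSq_eq_conj_mul_self]
    congr 1
    rw [← Polynomial.aeval_conj]
    simp
  have h2 := h1 (f.comp (-Polynomial.X))
  rw [segmentIntegral_apply] at h2
  simp only [hconj] at h2
  rw [intervalIntegral.integral_ofReal, Complex.ofReal_eq_zero] at h2
  have hcont : Continuous fun σ : ℝ =>
      Complex.normSq (Polynomial.aeval (Complex.I * (σ : ℂ)) f) :=
    Complex.continuous_normSq.comp (by fun_prop)
  have h3 : ∀ σ ∈ Set.Icc (-1 : ℝ) 1, Polynomial.aeval (Complex.I * (σ : ℂ)) f = 0 := by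
    intro σ hσ
    by_contra hne
    have := intervalIntegral.integral_pos (show (-1 : ℝ) < 1 by norm_num) hcont.continuousOn
      (fun x _ => Complex.normSq_nonneg _) ⟨σ, hσ, Complex.normSq_pos.2 hne⟩
    exact this.ne' h2
  have h4 : f.map (algebraMap ℝ ℂ) = 0 := by
    refine Polynomial.eq_zero_of_infinite_isRoot _ ?_
    refine Set.Infinite.mono (s := (fun σ : ℝ => Complex.I * (σ : ℂ)) '' Set.Icc (-1) 1) ?_ ?_
    · rintro _ ⟨σ, hσ, rfl⟩
      rw [Set.mem_ofPred_eq, Polynomial.IsRoot, Polynomial.eval_map_algebraMap]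
      exact h3 σ hσ
    · refine (Set.Icc_infinite (by norm_num)).image fun a _ b _ hab => ?_
      exact Complex.ofReal_injective (mul_left_cancel₀ Complex.I_ne_zero hab)
  have h5 : f = 0 := (Polynomial.map_eq_zero_iff (algebraMap ℝ ℂ).injective).1 h4
  exact (mul_eq_zero.1 (hf ▸ h5)).resolve_left (pow_ne_zero _ Polynomial.X_ne_zero)

/-! ### A trace on rotation-invariant polynomials -/

/-- The restriction of a polynomial to the plane of points `q = (T, 0)`, `p = (s, 1)`, as a
polynomial in `T` over the polynomials in `s`. -/
def restrict : Poly →ₐ[ℝ] Polynomial (Polynomial ℝ) :=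
  MvPolynomial.aeval (Sum.elim ![Polynomial.X, 0] ![Polynomial.C Polynomial.X, 1])

theorem restrict_positionSq : restrict positionSq = Polynomial.X ^ 2 := by
  simp [restrict, positionSq, q]

theorem restrict_momentumSq :
    restrict momentumSq = Polynomial.C (Polynomial.X ^ 2 + 1) := by
  simp [restrict, momentumSq, p]

theorem restrict_J₁ : restrict J₁ = Polynomial.C Polynomial.X * Polynomial.X := by
  simp [restrict, J₁, q, p]

theorem restrict_J₂ : restrict J₂ = Polynomial.X := by
  simp [restrict, J₂, q, p]

/-- A linear functional on the rotation-invariant polynomials of degree `d` that vanishes on Poisson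
brackets. The coefficient of `T ^ (d / 2)` selects the terms with equally many factors `|q|²` and
`|p|²`; these are polynomials in `J₁` and `J₂`, evaluated at `(s, 1)` and integrated. On the real
form `J₁ ∈ iℝ` of the generic symplectic leaf, which is a sphere, this is the integral against the
invariant measure. -/
def leafIntegral (d : ℕ) : Poly →ₗ[ℝ] ℂ :=
  segmentIntegral ∘ₗ ((Polynomial.lcoeff (Polynomial ℝ) (d / 2)).restrictScalars ℝ) ∘ₗ
    restrict.toLinearMap

theorem leafIntegral_apply (d : ℕ) (f : Poly) :
    leafIntegral d f = segmentIntegral ((restrict f).coeff (d / 2)) := rfl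

theorem restrict_invariantMonomial (a b i j : ℕ) : restrict (invariantMonomial a b i j) =
    Polynomial.C ((Polynomial.X ^ 2 + 1) ^ b * Polynomial.X ^ i) *
      Polynomial.X ^ (2 * a + i + j) := by
  rw [invariantMonomial, map_mul, map_mul, map_mul, map_pow, map_pow, map_pow, map_pow,
    restrict_positionSq, restrict_momentumSq, restrict_J₁, restrict_J₂, mul_pow, map_mul, map_pow,
    map_pow]
  ring

theorem coeff_restrict_invariantMonomial (a b i j : ℕ) :
    (restrict (invariantMonomial a b i j)).coeff (a + b + i + j) =
      if a = b then (Polynomial.X ^ 2 + 1) ^ b * Polynomial.X ^ i else 0 := by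
  rw [restrict_invariantMonomial, Polynomial.coeff_C_mul, Polynomial.coeff_X_pow]
  by_cases h : a = b
  · rw [if_pos h, if_pos (by omega), mul_one]
  · rw [if_neg h, if_neg (by omega), mul_zero]

theorem bracket_pow_right (f g : Poly) (n : ℕ) :
    bracket f (g ^ n) = n * g ^ (n - 1) * bracket f g := by
  rw [bracket_antisymm, bracket_pow_left, bracket_antisymm g]; ring

theorem segmentIntegral_exact (b i : ℕ) :
    (4 * (b + 1) : ℝ) • segmentIntegral ((Polynomial.X ^ 2 + 1) ^ b * Polynomial.X ^ (i + 1)) +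
      (2 * i : ℝ) • segmentIntegral ((Polynomial.X ^ 2 + 1) ^ (b + 1) * Polynomial.X ^ (i - 1))
      = 0 := by
  rw [← map_smul, ← map_smul, ← map_add]
  have h := segmentIntegral_derivative ((Polynomial.X ^ 2 + 1) ^ b * (2 * Polynomial.X ^ i))
  rw [← mul_assoc, ← pow_succ'] at h
  convert h using 2
  have h2 : (Polynomial.C 2 : Polynomial ℝ) = 2 := map_ofNat _ _
  have h4 : (Polynomial.C 4 : Polynomial ℝ) = 4 := map_ofNat _ _
  simp [Polynomial.derivative_mul, Polynomial.derivative_pow, Polynomial.smul_eq_C_mul, h2, h4]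
  ring

theorem bracket_positionSq_invariantMonomial (a b i j : ℕ) :
    bracket positionSq (invariantMonomial a b i j) =
      (4 * b : ℝ) • invariantMonomial a (b - 1) (i + 1) j +
        (2 * i : ℝ) • invariantMonomial (a + 1) b (i - 1) j := by
  have h4 : (MvPolynomial.C 4 : Poly) = 4 := map_ofNat _ _
  have h2 : (MvPolynomial.C 2 : Poly) = 2 := map_ofNat _ _
  simp only [invariantMonomial, bracket_mul_right, bracket_pow_right, bracket_self,
    bracket_positionSq_momentumSq, bracket_positionSq_J₁, bracket_positionSq_J₂,
    MvPolynomial.smul_eq_C_mul, map_mul, map_natCast, h2, h4]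
  ring

theorem bracket_momentumSq_invariantMonomial (a b i j : ℕ) :
    bracket momentumSq (invariantMonomial a b i j) =
      -((4 * a : ℝ) • invariantMonomial (a - 1) b (i + 1) j +
        (2 * i : ℝ) • invariantMonomial a (b + 1) (i - 1) j) := by
  have h4 : (MvPolynomial.C 4 : Poly) = 4 := map_ofNat _ _
  have h2 : (MvPolynomial.C 2 : Poly) = 2 := map_ofNat _ _
  have h3 : bracket momentumSq positionSq = -(4 : ℝ) • J₁ := by
    rw [bracket_antisymm, bracket_positionSq_momentumSq, neg_smul]
  simp only [invariantMonomial, bracket_mul_right, bracket_pow_right, bracket_self, h3,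
    bracket_momentumSq_J₁, bracket_momentumSq_J₂, neg_smul,
    MvPolynomial.smul_eq_C_mul, map_mul, map_natCast, h2, h4]
  ring

theorem leafIntegral_smul_invariantMonomial {a b i j n : ℕ} (c : ℝ)
    (h : c ≠ 0 → a + b + i + j = n) :
    leafIntegral (2 * n) (c • invariantMonomial a b i j) =
      c • if a = b then segmentIntegral ((Polynomial.X ^ 2 + 1) ^ b * Polynomial.X ^ i)
        else 0 := by
  by_cases hc : c = 0
  · simp [hc]
  · rw [map_smul, leafIntegral_apply, Nat.mul_div_cancel_left _ two_pos, ← h hc,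
      coeff_restrict_invariantMonomial]
    split_ifs <;> simp

/-- The brackets with the generators of the invariants are exact derivatives on the leaf. -/
theorem leafIntegral_bracket_invariantMonomial {f : Poly}
    (hf : f ∈ ({positionSq, momentumSq, J₁, J₂} : Set Poly)) (a b i j : ℕ) :
    leafIntegral (2 * (a + b + i + j)) (bracket f (invariantMonomial a b i j)) = 0 := by
  have hb : ∀ n : ℕ, (4 * n : ℝ) ≠ 0 → n ≠ 0 := fun n h h0 => h (by simp [h0])
  have hi : ∀ n : ℕ, (2 * n : ℝ) ≠ 0 → n ≠ 0 := fun n h h0 => h (by simp [h0])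
  rcases hf with rfl | rfl | rfl | rfl
  · rw [bracket_positionSq_invariantMonomial, map_add,
      leafIntegral_smul_invariantMonomial _ fun h => by have := hb _ h; omega,
      leafIntegral_smul_invariantMonomial _ fun h => by have := hi _ h; omega]
    by_cases hab : a + 1 = b
    · subst hab
      simpa using segmentIntegral_exact a i
    · rw [if_neg hab, smul_zero, add_zero]
      rcases b with _ | b
      · simp
      · rw [if_neg (by omega), smul_zero]
  · rw [bracket_momentumSq_invariantMonomial, map_neg, map_add,
      leafIntegral_smul_invariantMonomial _ fun h => by have := hb _ h; omega,
      leafIntegral_smul_invariantMonomial _ fun h => by have := hi _ h; omega, neg_eq_zero]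
    by_cases hab : a = b + 1
    · subst hab
      simpa using segmentIntegral_exact b i
    · rw [if_neg hab, smul_zero, add_zero]
      rcases a with _ | a
      · simp
      · rw [if_neg (by omega), smul_zero]
  · rw [bracket_antisymm, bracket_invariantMonomial_J₁, map_neg,
      leafIntegral_smul_invariantMonomial _ fun _ => rfl, neg_eq_zero]
    split_ifs with h
    · simp [h]
    · rw [smul_zero]
  · have h := invariantMonomial_mem_pow a b i j
    rw [← invariantSubmodule_even] at h
    rw [bracket_J₂_of_mem_invariantSubmodule h, map_zero]

/-- The leaf integral is a trace: it vanishes on brackets. -/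
theorem leafIntegral_bracket_pow {a b : ℕ} {f g : Poly} (hf : f ∈ invariantForms ^ (a + 1))
    (hg : g ∈ invariantForms ^ b) : leafIntegral (2 * (a + b)) (bracket f g) = 0 := by
  have key : ∀ {b : ℕ} {f g : Poly}, f ∈ invariantForms → g ∈ invariantForms ^ b →
      leafIntegral (2 * b) (bracket f g) = 0 := by
    intro b f g hf hg
    induction hf using Submodule.span_induction with
    | zero => rw [bracket_zero_left, map_zero]
    | add x y _ _ hx hy => rw [bracket_add_left, map_add, hx, hy, add_zero]
    | smul c x _ hx => rw [bracket_smul_left, map_smul, hx, smul_zero]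
    | mem x hx =>
      induction pow_le_span_invariantMonomial b hg using Submodule.span_induction with
      | zero => rw [bracket_zero_right, map_zero]
      | add y z hy hz ihy ihz =>
        rw [bracket_add_right, map_add, ihy (span_invariantMonomial_le_pow b hy),
          ihz (span_invariantMonomial_le_pow b hz), add_zero]
      | smul c y hy ih =>
        rw [bracket_smul_right, map_smul, ih (span_invariantMonomial_le_pow b hy), smul_zero]
      | mem y hy =>
        obtain ⟨a, b, i, j, rfl, rfl⟩ := hy
        exact leafIntegral_bracket_invariantMonomial hx a b i j
  induction a generalizing b f g with
  | zero =>
    rw [zero_add] at hf ⊢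
    exact key (by simpa using hf) hg
  | succ a ih =>
    rw [pow_succ] at hf
    induction hf using Submodule.mul_induction_on' with
    | mem_mul_mem x hx y hy =>
      have h1 : bracket (x * y) g = bracket x (y * g) + bracket y (x * g) := by
        simp only [bracket_mul_left, bracket_mul_right, bracket_antisymm y x]
        ring
      have h2 := ih hx (mul_mem_pow (a := 1) (by simpa using hy) hg)
      have h3 := key hy (mul_mem_pow hx hg)
      rw [h1, map_add, show a + 1 + b = a + (1 + b) by ring, h2,
        show a + (1 + b) = a + 1 + b by ring, h3, add_zero]
    | add x _ y _ hx hy => rw [bracket_add_left, map_add, hx, hy, add_zero]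

theorem leafIntegral_bracket {a b : ℕ} {f g : Poly} (hf : f ∈ invariantSubmodule (a + 2))
    (hg : g ∈ invariantSubmodule (b + 2)) : leafIntegral (a + b + 2) (bracket f g) = 0 := by
  rcases Nat.even_or_odd' a with ⟨m, rfl | rfl⟩
  · rcases Nat.even_or_odd' b with ⟨n, rfl | rfl⟩
    · rw [show 2 * m + 2 = 2 * (m + 1) by ring, invariantSubmodule_even] at hf
      rw [show 2 * n + 2 = 2 * (n + 1) by ring, invariantSubmodule_even] at hg
      rw [show 2 * m + 2 * n + 2 = 2 * (m + (n + 1)) by ring]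
      exact leafIntegral_bracket_pow hf hg
    · rw [show 2 * n + 1 + 2 = 2 * (n + 1) + 1 by ring, invariantSubmodule_odd,
        Submodule.mem_bot] at hg
      rw [hg, bracket_zero_right, map_zero]
  · rw [show 2 * m + 1 + 2 = 2 * (m + 1) + 1 by ring, invariantSubmodule_odd,
      Submodule.mem_bot] at hf
    rw [hf, bracket_zero_left, map_zero]

theorem mul_mem_invariantSubmodule {a b : ℕ} {f g : Poly} (hf : f ∈ invariantSubmodule a)
    (hg : g ∈ invariantSubmodule b) : f * g ∈ invariantSubmodule (a + b) := by
  rcases Nat.even_or_odd' a with ⟨m, rfl | rfl⟩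
  · rcases Nat.even_or_odd' b with ⟨n, rfl | rfl⟩
    · rw [invariantSubmodule_even] at hf hg
      rw [← mul_add, invariantSubmodule_even]
      exact mul_mem_pow hf hg
    · rw [invariantSubmodule_odd, Submodule.mem_bot] at hg
      rw [hg, mul_zero]
      exact zero_mem _
  · rw [invariantSubmodule_odd, Submodule.mem_bot] at hf
    rw [hf, zero_mul]
    exact zero_mem _

/-- The coefficient of `ε ^ n` is a rotation-invariant polynomial of degree `n + m`. -/
def IsInvariantSeries (m : ℕ) (F : PowerSeries Poly) : Prop :=
  ∀ n, PowerSeries.coeff n F ∈ invariantSubmodule (n + m)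

theorem IsInvariantSeries.mul {m m' : ℕ} {F G : PowerSeries Poly} (hF : IsInvariantSeries m F)
    (hG : IsInvariantSeries m' G) : IsInvariantSeries (m + m') (F * G) := by
  intro n
  rw [PowerSeries.coeff_mul]
  refine sum_mem fun x hx => ?_
  have := mul_mem_invariantSubmodule (hF x.1) (hG x.2)
  rw [Finset.HasAntidiagonal.mem_antidiagonal] at hx
  rwa [show x.1 + m + (x.2 + m') = n + (m + m') by omega] at this

theorem IsInvariantSeries.pow {m : ℕ} {F : PowerSeries Poly} (hF : IsInvariantSeries m F)
    (k : ℕ) : IsInvariantSeries (k * m) (F ^ k) := by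
  induction k with
  | zero =>
    intro n
    rw [pow_zero, PowerSeries.coeff_one, zero_mul]
    split_ifs with h
    · rw [h, show 0 + 0 = 2 * 0 from rfl, invariantSubmodule_even, pow_zero]
      exact Submodule.one_le.1 le_rfl
    · exact zero_mem _
  | succ k ih => rw [pow_succ, Nat.succ_mul]; exact ih.mul hF

theorem coeff_depritDerivation (w F : PowerSeries Poly) (n : ℕ) :
    PowerSeries.coeff n (depritDerivation MvPolynomial.pderiv w F) =
      ((n : ℝ) + 1) • PowerSeries.coeff (n + 1) F +
        ∑ x ∈ Finset.HasAntidiagonal.antidiagonal n,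
          bracket (PowerSeries.coeff x.1 F) (PowerSeries.coeff x.2 w) := by
  rw [depritDerivation_apply, map_add, PowerSeries.coeff_derivative,
    coeff_poisson_coeffDerivation, Algebra.smul_def, mul_comm]
  simp [bracket_eq_poisson]

theorem IsInvariantSeries.depritDerivation {w : PowerSeries Poly} (hw : IsInvariantSeries 3 w)
    {m : ℕ} {F : PowerSeries Poly} (hF : IsInvariantSeries (m + 2) F) :
    IsInvariantSeries (m + 1 + 2) (depritDerivation MvPolynomial.pderiv w F) := by
  intro n
  rw [coeff_depritDerivation]
  refine add_mem (Submodule.smul_mem _ _ ?_) (sum_mem fun x hx => ?_)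
  · have := hF (n + 1)
    rwa [show n + 1 + (m + 2) = n + (m + 1 + 2) by ring] at this
  · rw [Finset.HasAntidiagonal.mem_antidiagonal] at hx
    rw [show n + (m + 1 + 2) = x.1 + m + (x.2 + 1) + 2 by omega]
    exact bracket_mem_invariantSubmodule (hF x.1) (hw x.2)

/-- The leaf integral of a series of invariants does not change under a Lie transform. -/
theorem leafIntegral_depritTransform {w : PowerSeries Poly} (hw : IsInvariantSeries 3 w) {m : ℕ}
    {F : PowerSeries Poly} (hF : IsInvariantSeries (m + 2) F) (n : ℕ) :
    leafIntegral (n + (m + 2)) (PowerSeries.coeff n (depritTransform MvPolynomial.pderiv w F)) =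
      leafIntegral (n + (m + 2)) (PowerSeries.coeff n F) := by
  induction n generalizing m F with
  | zero => rw [coeff_zero_depritTransform]
  | succ n ih =>
    have h1 := ih (IsInvariantSeries.depritDerivation hw hF)
    have h2 : ∑ x ∈ Finset.HasAntidiagonal.antidiagonal n, leafIntegral (n + (m + 1 + 2))
        (bracket (PowerSeries.coeff x.1 F) (PowerSeries.coeff x.2 w)) = 0 := by
      refine Finset.sum_eq_zero fun x hx => ?_
      rw [Finset.HasAntidiagonal.mem_antidiagonal] at hx
      rw [show n + (m + 1 + 2) = x.1 + m + (x.2 + 1) + 2 by omega]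
      exact leafIntegral_bracket (hF x.1) (hw x.2)
    rw [← coeff_succ_depritTransform, coeff_depritDerivation, map_add, map_sum, h2, add_zero,
      map_smul, map_smul, show n + (m + 1 + 2) = n + 1 + (m + 2) by ring] at h1
    exact smul_right_injective ℂ (show (n : ℝ) + 1 ≠ 0 by positivity) h1

/-! ### The moments of the normal form -/

theorem expSeries_scaled_H : expSeries (scaled H) =
    PowerSeries.C (MvPolynomial.C √2 * J₁) + PowerSeries.X ^ 2 * PowerSeries.C quarticPart := by
  ext1 n
  rw [coeff_expSeries, map_add, PowerSeries.coeff_C, PowerSeries.coeff_mul_C,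
    PowerSeries.coeff_X_pow]
  by_cases h0 : n = 0
  · subst h0; simp [scaled_H_zero]
  · by_cases h2 : n = 2
    · subst h2; simp [scaled_H_two, smul_smul]
    · rw [scaled_H_of_ne h0 h2, if_neg h0, if_neg h2]; simp

theorem isInvariantSeries_expSeries_scaled_H : IsInvariantSeries 2 (expSeries (scaled H)) :=
  fun n => by rw [coeff_expSeries]; exact Submodule.smul_mem _ _ (scaled_H_mem n)

theorem coeff_expSeries_scaled_H_pow (k l : ℕ) :
    PowerSeries.coeff (2 * l) (expSeries (scaled H) ^ k) =
      k.choose l • ((MvPolynomial.C √2 * J₁) ^ (k - l) * quarticPart ^ l) := by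
  rw [expSeries_scaled_H, add_comm, add_pow, map_sum]
  have h : ∀ j ∈ Finset.range (k + 1), PowerSeries.coeff (2 * l)
      ((PowerSeries.X ^ 2 * PowerSeries.C quarticPart) ^ j *
        PowerSeries.C (MvPolynomial.C √2 * J₁) ^ (k - j) * (k.choose j : PowerSeries Poly)) =
      if j = l then k.choose l • ((MvPolynomial.C √2 * J₁) ^ (k - l) * quarticPart ^ l)
        else 0 := by
    intro j _
    have : (PowerSeries.X ^ 2 * PowerSeries.C quarticPart) ^ j *
        PowerSeries.C (MvPolynomial.C √2 * J₁) ^ (k - j) * (k.choose j : PowerSeries Poly) =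
        PowerSeries.X ^ (2 * j) * PowerSeries.C (k.choose j •
          ((MvPolynomial.C √2 * J₁) ^ (k - j) * quarticPart ^ j)) := by
      simp only [mul_pow, ← pow_mul, nsmul_eq_mul, map_mul, map_pow, map_natCast]
      ring
    rw [this, PowerSeries.coeff_mul_C, PowerSeries.coeff_X_pow]
    by_cases hj : j = l
    · subst hj; simp
    · rw [if_neg (by omega), if_neg hj, zero_mul]
  rw [Finset.sum_congr rfl h, Finset.sum_ite_eq']
  split_ifs with hl
  · rfl
  · rw [Nat.choose_eq_zero_of_lt (by simpa using hl), zero_smul]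

/-- The moments of the Hamiltonian are computed from the powers of
`|q|² + |p|² - 2 J₁ = (T - s)² + 1`. -/
theorem coeff_restrict_quarticPart_pow (l : ℕ) : (restrict (quarticPart ^ l)).coeff (2 * l) =
    Polynomial.C ((1 / 8) ^ l) * ∑ j ∈ Finset.range (2 * l + 1),
      (-Polynomial.X) ^ (2 * j - 2 * l) * ((2 * j).choose (2 * l) : Polynomial ℝ) *
        ((2 * l).choose j : Polynomial ℝ) := by
  have h : restrict (quarticPart ^ l) = Polynomial.C (Polynomial.C ((1 / 8) ^ l)) *
      ((Polynomial.X + Polynomial.C (-Polynomial.X)) ^ 2 + 1) ^ (2 * l) := by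
    rw [quarticPart, mul_pow, ← pow_mul, ← map_pow, map_mul, ← MvPolynomial.algebraMap_eq,
      AlgHom.commutes]
    simp only [map_add, map_sub, map_mul, map_pow, map_one, map_neg, map_ofNat,
      restrict_positionSq, restrict_momentumSq, restrict_J₁, Polynomial.algebraMap_apply,
      Polynomial.algebraMap_eq]
    congr 2
    ring
  rw [h, Polynomial.coeff_C_mul, add_pow, Polynomial.finsetSum_coeff]
  congr 1
  refine Finset.sum_congr rfl fun j _ => ?_
  rw [one_pow, mul_one, ← pow_mul, ← Polynomial.C_eq_natCast, Polynomial.coeff_mul_C,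
    Polynomial.coeff_X_add_C_pow]

/-- The dehomogenization of a polynomial in `(J₁, J₂)`, at `J₂ = 1`. -/
def dehomogenize : MvPolynomial (Fin 2) ℝ →ₐ[ℝ] Polynomial ℝ :=
  MvPolynomial.aeval ![Polynomial.X, 1]

theorem restrict_aeval {P : MvPolynomial (Fin 2) ℝ} {n : ℕ} (hP : P.IsHomogeneous n) :
    restrict (MvPolynomial.aeval ![J₁, J₂] P) =
      Polynomial.X ^ n * Polynomial.C (dehomogenize P) := by
  rw [MvPolynomial.aeval_def, MvPolynomial.eval₂_eq', dehomogenize, MvPolynomial.aeval_def,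
    MvPolynomial.eval₂_eq', map_sum, map_sum, Finset.mul_sum]
  refine Finset.sum_congr rfl fun d hd => ?_
  have hdeg : d 0 + d 1 = n := by
    have := hP (MvPolynomial.mem_support_iff.1 hd)
    rwa [← degree_fin_two, Finsupp.degree_eq_weight_one]
  simp only [Fin.prod_univ_two, Matrix.cons_val_zero, Matrix.cons_val_one, map_mul, map_pow,
    restrict_J₁, restrict_J₂, AlgHom.commutes, one_pow, mul_one, ← hdeg, pow_add, mul_pow]
  rw [Polynomial.algebraMap_apply]
  ring

theorem coeff_dehomogenize {P : MvPolynomial (Fin 2) ℝ} {n : ℕ} (hP : P.IsHomogeneous n)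
    {d : Fin 2 →₀ ℕ} (hd : d.degree = n) :
    (dehomogenize P).coeff (d 0) = MvPolynomial.coeff d P := by
  rw [dehomogenize, MvPolynomial.aeval_def, MvPolynomial.eval₂_eq', Polynomial.finsetSum_coeff]
  have h : ∀ e ∈ P.support, (algebraMap ℝ (Polynomial ℝ) (MvPolynomial.coeff e P) *
      ∏ i, (![Polynomial.X, 1] : Fin 2 → Polynomial ℝ) i ^ e i).coeff (d 0) =
      if e = d then MvPolynomial.coeff d P else 0 := by
    intro e he
    have hdeg : e 0 + e 1 = d 0 + d 1 := by
      have := hP (MvPolynomial.mem_support_iff.1 he)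
      rw [← degree_fin_two, ← degree_fin_two, hd, Finsupp.degree_eq_weight_one]
      exact this
    simp only [Fin.prod_univ_two, Matrix.cons_val_zero, Matrix.cons_val_one, one_pow, mul_one,
      Polynomial.algebraMap_eq, Polynomial.coeff_C_mul, Polynomial.coeff_X_pow]
    by_cases hed : e = d
    · subst hed; simp
    · rw [if_neg hed, if_neg, mul_zero]
      intro h0
      refine hed (Finsupp.ext fun i => ?_)
      fin_cases i
      · exact h0.symm
      · change e 1 = d 1
        omega
  rw [Finset.sum_congr rfl h, Finset.sum_ite_eq']
  split_ifs with hs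
  · rfl
  · exact (MvPolynomial.notMem_support_iff.1 hs).symm

/-- The moments of the powers of a normal form coincide with those of the powers of the
Hamiltonian. -/
theorem segmentIntegral_normalForm {W : ℕ → Poly} {P : ℕ → MvPolynomial (Fin 2) ℝ}
    (hW : ∀ k, W k ∈ invariantSubmodule (k + 2)) (hP : ∀ n, (P n).IsHomogeneous (n + 1))
    (hWP : ∀ n, ((2 * n).factorial : ℝ)⁻¹ • triangle (scaled H) W (2 * n) 0 =
      MvPolynomial.aeval ![J₁, J₂] (P n)) {k : ℕ} (hk : k ≠ 0) (l : ℕ) :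
    segmentIntegral (PowerSeries.coeff l ((PowerSeries.mk fun n => dehomogenize (P n)) ^ k)) =
      segmentIntegral (k.choose l • (Polynomial.C (√2 ^ (k - l)) * Polynomial.X ^ (k - l) *
        (Polynomial.C ((1 / 8) ^ l) * ∑ j ∈ Finset.range (2 * l + 1),
          (-Polynomial.X) ^ (2 * j - 2 * l) * ((2 * j).choose (2 * l) : Polynomial ℝ) *
            ((2 * l).choose j : Polynomial ℝ)))) := by
  set B : PowerSeries (Polynomial ℝ) := PowerSeries.mk fun n => dehomogenize (P n) with hB
  set w : PowerSeries Poly := expSeries fun k => W (k + 1) with hw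
  have hinv : IsInvariantSeries 3 w := fun n => by
    rw [hw, coeff_expSeries]
    exact Submodule.smul_mem _ _ (hW (n + 1))
  have hmap : PowerSeries.map (restrict : Poly →+* Polynomial (Polynomial ℝ))
      (depritTransform MvPolynomial.pderiv w (expSeries (scaled H))) =
      PowerSeries.C Polynomial.X * PowerSeries.expand 2 two_ne_zero
        (PowerSeries.rescale Polynomial.X (PowerSeries.map Polynomial.C B)) := by
    ext1 n
    rw [PowerSeries.coeff_map, coeff_depritTransform_expSeries, PowerSeries.coeff_C_mul]
    rcases Nat.even_or_odd' n with ⟨i, rfl | rfl⟩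
    · rw [hWP, PowerSeries.coeff_expand_mul, PowerSeries.coeff_rescale, PowerSeries.coeff_map, hB,
        PowerSeries.coeff_mk]
      exact (restrict_aeval (hP i)).trans (by ring)
    · have := triangle_mem scaled_H_mem (n := 2 * i + 1) (fun k _ _ => hW k) (2 * i + 1) 0
        (by omega)
      rw [show 2 * i + 1 + 0 + 2 = 2 * (i + 1) + 1 by ring, invariantSubmodule_odd,
        Submodule.mem_bot] at this
      rw [this, smul_zero, map_zero, PowerSeries.coeff_expand_of_not_dvd _ _ _ (by omega), mul_zero]
  obtain ⟨m, hm⟩ : ∃ m, k * 2 = m + 2 := ⟨k * 2 - 2, by omega⟩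
  have h := leafIntegral_depritTransform hinv
    (hm ▸ isInvariantSeries_expSeries_scaled_H.pow k) (2 * l)
  rw [← hm, leafIntegral_apply, leafIntegral_apply, show (2 * l + k * 2) / 2 = k + l by omega] at h
  rw [← depritHom_apply, map_pow, depritHom_apply] at h
  have h1 := congrArg (fun F => PowerSeries.coeff (2 * l) (F ^ k)) hmap
  simp only [← map_pow, mul_pow, PowerSeries.coeff_map, PowerSeries.coeff_C_mul,
    PowerSeries.coeff_expand_mul, PowerSeries.coeff_rescale] at h1
  have h2 : restrict (PowerSeries.coeff (2 * l)
      (depritTransform MvPolynomial.pderiv w (expSeries (scaled H)) ^ k)) =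
      Polynomial.X ^ (k + l) * Polynomial.C (PowerSeries.coeff l (B ^ k)) := by
    rw [pow_add, mul_assoc]
    exact h1
  rw [h2, Polynomial.coeff_mul_C, Polynomial.coeff_X_pow, if_pos rfl, one_mul] at h
  rw [h, coeff_expSeries_scaled_H_pow]
  by_cases hkl : l ≤ k
  · have h3 : restrict (MvPolynomial.C √2 * J₁) =
        Polynomial.C (Polynomial.C √2 * Polynomial.X) * Polynomial.X := by
      rw [map_mul, restrict_J₁, ← MvPolynomial.algebraMap_eq, AlgHom.commutes, map_mul]
      exact (mul_assoc _ _ _).symm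
    rw [map_nsmul, map_mul, map_pow, h3, mul_pow, ← map_pow, Polynomial.coeff_smul, mul_assoc,
      Polynomial.coeff_C_mul, show k + l = 2 * l + (k - l) by omega, Polynomial.coeff_X_pow_mul,
      coeff_restrict_quarticPart_pow, mul_pow, ← map_pow]
  · rw [Nat.choose_eq_zero_of_lt (not_le.1 hkl)]
    simp

/-! ### The coefficients of the normal form -/

/-- The polynomial whose segment integral is, up to a power of `√2`, the leaf integral of the terms
of order `2 l` above the lowest one in the `k`-th power of the Hamiltonian. -/
def hamiltonianMoment (k l : ℕ) : Polynomial ℝ :=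
  (k.choose l : Polynomial ℝ) * (Polynomial.X ^ (k - l) * (Polynomial.C ((1 / 8) ^ l) *
    ∑ j ∈ Finset.range (2 * l + 1), (-Polynomial.X) ^ (2 * j - 2 * l) *
      ((2 * j).choose (2 * l) : Polynomial ℝ) * ((2 * l).choose j : Polynomial ℝ)))

theorem coeff_mk_pow {A : Type*} [CommRing A] (c : ℕ → A) {k l : ℕ} (hl : l ≤ k) :
    PowerSeries.coeff l ((PowerSeries.mk c) ^ k) = ∑ j ∈ Finset.range (l + 1),
      c 0 ^ (k - j) * PowerSeries.coeff (l - j) ((PowerSeries.mk fun n => c (n + 1)) ^ j) *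
        (k.choose j : A) := by
  have h : PowerSeries.mk c =
      PowerSeries.X * (PowerSeries.mk fun n => c (n + 1)) + PowerSeries.C (c 0) := by
    ext n
    cases n <;> simp
  rw [h, add_pow, map_sum]
  have h2 : ∀ j, PowerSeries.coeff l ((PowerSeries.X * PowerSeries.mk fun n => c (n + 1)) ^ j *
      PowerSeries.C (c 0) ^ (k - j) * (k.choose j : PowerSeries A)) =
      if j ≤ l then c 0 ^ (k - j) * PowerSeries.coeff (l - j)
        ((PowerSeries.mk fun n => c (n + 1)) ^ j) * (k.choose j : A) else 0 := by
    intro j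
    rw [mul_pow, ← map_pow, ← map_natCast (PowerSeries.C (R := A)), PowerSeries.coeff_mul_C,
      PowerSeries.coeff_mul_C, PowerSeries.coeff_X_pow_mul']
    split_ifs <;> ring
  simp only [h2]
  rw [← Finset.sum_subset (Finset.range_mono (Nat.succ_le_succ hl)) fun j _ hj => if_neg (by
    simpa using hj)]
  exact Finset.sum_congr rfl fun j hj => if_pos (by simpa [Nat.lt_succ_iff] using hj)

theorem coeff_mk_sq {A : Type*} [CommRing A] (v : ℕ → A) (n : ℕ) :
    PowerSeries.coeff n ((PowerSeries.mk v) ^ 2) =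
      ∑ x ∈ Finset.HasAntidiagonal.antidiagonal n, v x.1 * v x.2 := by
  simp [pow_two, PowerSeries.coeff_mul]

theorem coeff_mk_cube {A : Type*} [CommRing A] (v : ℕ → A) :
    PowerSeries.coeff 1 ((PowerSeries.mk v) ^ 3) = 3 * v 0 ^ 2 * v 1 := by
  simp [pow_succ, PowerSeries.coeff_mul, Finset.Nat.antidiagonal_succ]
  ring

theorem cast_choose_three (m : ℕ) :
    (((m + 3).choose 3 : ℕ) : ℝ) = (m + 3) * (m + 2) * (m + 1) / 6 := by
  have h := Nat.descFactorial_eq_factorial_mul_choose (m + 3) 3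
  have h2 : (((m + 3).descFactorial 3 : ℕ) : ℝ) = 6 * ((m + 3).choose 3 : ℕ) := by
    rw [h]; norm_num [Nat.factorial]
  simp [Nat.descFactorial] at h2
  linarith

theorem cast_choose_four (m : ℕ) :
    (((m + 4).choose 4 : ℕ) : ℝ) = (m + 4) * (m + 3) * (m + 2) * (m + 1) / 24 := by
  have h := Nat.descFactorial_eq_factorial_mul_choose (m + 4) 4
  have h2 : (((m + 4).descFactorial 4 : ℕ) : ℝ) = 24 * ((m + 4).choose 4 : ℕ) := by
    rw [h]; norm_num [Nat.factorial]
  simp [Nat.descFactorial] at h2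
  linarith

/-- A coefficient `c` that enters the moments linearly, multiplied by `X ^ (m + l)`, is determined
by them: `c'` has the same moments if the discrepancies are derivatives of multiples of
`X ^ 2 + 1`. -/
theorem eq_of_moments {c c' : Polynomial ℝ} {l : ℕ} {R S : ℕ → Polynomial ℝ}
    (h : ∀ m, segmentIntegral (Polynomial.X ^ (m + l) * c * ((m + l + 1 : ℕ) : Polynomial ℝ) + R m) =
      segmentIntegral (S m)) (g : ℕ → Polynomial ℝ)
    (hg : ∀ m, Polynomial.X ^ (m + l) * c' * ((m + l + 1 : ℕ) : Polynomial ℝ) + R m - S m =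
      Polynomial.derivative ((Polynomial.X ^ 2 + 1) * g m)) : c = c' := by
  rw [← sub_eq_zero]
  refine eq_zero_of_segmentIntegral _ l fun m => ?_
  have h1 := congrArg segmentIntegral (hg m)
  rw [segmentIntegral_derivative, map_sub, ← h m, ← map_sub] at h1
  have h2 : ((m + l + 1 : ℕ) : ℝ) • (Polynomial.X ^ (m + l) * (c - c')) =
      -(Polynomial.X ^ (m + l) * c' * ((m + l + 1 : ℕ) : Polynomial ℝ) + R m -
        (Polynomial.X ^ (m + l) * c * ((m + l + 1 : ℕ) : Polynomial ℝ) + R m)) := by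
    rw [Polynomial.smul_eq_C_mul, map_natCast]
    ring
  have h3 := congrArg segmentIntegral h2
  rw [map_neg, h1, neg_zero, map_smul] at h3
  exact (smul_eq_zero.1 h3).resolve_left (Nat.cast_ne_zero.2 (Nat.succ_ne_zero _))

/-- The powers of the series `∑ n, c n * t ^ n` have the same moments as the Hamiltonian. For
`c 0 = X`, the moments with the index `l` determine `c l` from `c 1, …, c (l - 1)`. In the
lemmas below, the polynomials in the role of `g` in `eq_of_moments` come from integrating the
discrepancy from its lowest power of `X` upwards; their coefficients are polynomials in `m`. -/
def HasHamiltonianMoments (c : ℕ → Polynomial ℝ) : Prop :=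
  ∀ k l, k ≠ 0 → l ≤ k → segmentIntegral (PowerSeries.coeff l ((PowerSeries.mk c) ^ k)) =
    segmentIntegral (hamiltonianMoment k l)

theorem HasHamiltonianMoments.coeff_one {c : ℕ → Polynomial ℝ} (h : HasHamiltonianMoments c)
    (h0 : c 0 = Polynomial.X) :
    c 1 = Polynomial.C (1 / 4) * (3 * Polynomial.X ^ 2 + 1) := by
  refine eq_of_moments (l := 0) (R := fun m => 0) (S := fun m => hamiltonianMoment (m + 1) 1)
    (fun m => ?_) (fun m => 0) fun m => ?_
  · rw [← h (m + 1) 1 (by omega) (by omega), coeff_mk_pow c (by omega)]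
    simp [Finset.sum_range_succ, h0]
  · refine Polynomial.funext fun x => ?_
    simp [hamiltonianMoment, Finset.sum_range_succ, Nat.choose]
    ring

theorem HasHamiltonianMoments.coeff_two {c : ℕ → Polynomial ℝ} (h : HasHamiltonianMoments c)
    (h0 : c 0 = Polynomial.X) :
    c 2 = Polynomial.C (-1 / 16) * Polynomial.X * (17 * Polynomial.X ^ 2 + 9) := by
  have h1 := h.coeff_one h0
  refine eq_of_moments (l := 1) (R := fun m => Polynomial.X ^ m * c 1 ^ 2 *
      ((m + 2).choose 2 : Polynomial ℝ)) (S := fun m => hamiltonianMoment (m + 2) 2)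
    (fun m => ?_) (fun m => Polynomial.X ^ (m + 1) * Polynomial.C (-((m : ℝ) + 2) / 64) *
      (1 + 17 * Polynomial.X ^ 2)) fun m => ?_
  · rw [← h (m + 2) 2 (by omega) (by omega), coeff_mk_pow c (by omega)]
    simp [Finset.sum_range_succ, h0, add_assoc]
  · refine Polynomial.funext fun x => ?_
    simp [hamiltonianMoment, Finset.sum_range_succ, Nat.choose, h1, Nat.cast_choose_two]
    ring

theorem HasHamiltonianMoments.coeff_three {c : ℕ → Polynomial ℝ} (h : HasHamiltonianMoments c)
    (h0 : c 0 = Polynomial.X) :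
    c 3 = Polynomial.C (1 / 128) * (375 * Polynomial.X ^ 4 + 258 * Polynomial.X ^ 2 + 11) := by
  have h1 := h.coeff_one h0
  have h2 := h.coeff_two h0
  refine eq_of_moments (l := 2)
    (R := fun m => Polynomial.X ^ (m + 1) * (2 * c 1 * c 2) * ((m + 3).choose 2 : Polynomial ℝ) +
      Polynomial.X ^ m * c 1 ^ 3 * ((m + 3).choose 3 : Polynomial ℝ))
    (S := fun m => hamiltonianMoment (m + 3) 3) (fun m => ?_)
    (fun m => Polynomial.X ^ (m + 1) * (Polynomial.C (-((m : ℝ) ^ 2 + 5 * m + 6) / 256) +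
      Polynomial.C (-(28 * (m : ℝ) ^ 2 + 118 * m + 102) / 256) * Polynomial.X ^ 2 +
      Polynomial.C (-(59 * (m : ℝ) ^ 2 + 145 * m - 96) / 256) * Polynomial.X ^ 4)) fun m => ?_
  · rw [← h (m + 3) 3 (by omega) (by omega), coeff_mk_pow c (by omega)]
    simp [Finset.sum_range_succ, h0, add_assoc, coeff_mk_sq, Finset.Nat.antidiagonal_succ]
    ring_nf
  · refine Polynomial.funext fun x => ?_
    simp [hamiltonianMoment, Finset.sum_range_succ, h1, h2, Nat.cast_choose_two,
      cast_choose_three]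
    simp [Nat.choose]
    ring

theorem HasHamiltonianMoments.coeff_four {c : ℕ → Polynomial ℝ} (h : HasHamiltonianMoments c)
    (h0 : c 0 = Polynomial.X) :
    c 4 = Polynomial.C (-1 / 1024) * Polynomial.X *
      (10689 * Polynomial.X ^ 4 + 8910 * Polynomial.X ^ 2 + 909) := by
  have h1 := h.coeff_one h0
  have h2 := h.coeff_two h0
  have h3 := h.coeff_three h0
  refine eq_of_moments (l := 3)
    (R := fun m => Polynomial.X ^ (m + 2) * (2 * c 1 * c 3 + c 2 ^ 2) *
        ((m + 4).choose 2 : Polynomial ℝ) +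
      Polynomial.X ^ (m + 1) * (3 * c 1 ^ 2 * c 2) * ((m + 4).choose 3 : Polynomial ℝ) +
      Polynomial.X ^ m * c 1 ^ 4 * ((m + 4).choose 4 : Polynomial ℝ))
    (S := fun m => hamiltonianMoment (m + 4) 4) (fun m => ?_)
    (fun m => Polynomial.X ^ (m + 1) *
      (Polynomial.C (-(9 * (m : ℝ) ^ 3 + 81 * m ^ 2 + 234 * m + 216) / 16384) +
      Polynomial.C (-(379 * (m : ℝ) ^ 3 + 2923 * m ^ 2 + 6574 * m + 3784) / 16384) *
        Polynomial.X ^ 2 +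
      Polynomial.C (-(1787 * (m : ℝ) ^ 3 + 10179 * m ^ 2 + 12270 * m + 584) / 16384) *
        Polynomial.X ^ 4 +
      Polynomial.C (-(1929 * (m : ℝ) ^ 3 + 6825 * m ^ 2 + 4906 * m + 33880) / 16384) *
        Polynomial.X ^ 6)) fun m => ?_
  · rw [← h (m + 4) 4 (by omega) (by omega), coeff_mk_pow c (by omega)]
    simp [Finset.sum_range_succ, h0, add_assoc, coeff_mk_sq, coeff_mk_cube,
      Finset.Nat.antidiagonal_succ]
    ring_nf
  · refine Polynomial.funext fun x => ?_
    have h43 : (((m + 4).choose 3 : ℕ) : ℝ) = (m + 4) * (m + 3) * (m + 2) / 6 := by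
      rw [show m + 4 = m + 1 + 3 by ring, cast_choose_three]; push_cast; ring
    simp [hamiltonianMoment, Finset.sum_range_succ, h1, h2, h3, Nat.cast_choose_two,
      h43, cast_choose_four]
    simp [Nat.choose]
    ring

/-- The homogeneous part of degree `n + 1` of the polynomial `normalFormPoly`. -/
def normalFormPart : ℕ → MvPolynomial (Fin 2) ℝ
  | 0 => MvPolynomial.C √2 * MvPolynomial.X 0
  | 1 => MvPolynomial.C (1 / 4) * (3 * MvPolynomial.X 0 ^ 2 + MvPolynomial.X 1 ^ 2)
  | 2 => MvPolynomial.C (-(√2 / 32)) * (MvPolynomial.X 0 *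
      (17 * MvPolynomial.X 0 ^ 2 + 9 * MvPolynomial.X 1 ^ 2))
  | 3 => MvPolynomial.C (1 / 256) * (375 * MvPolynomial.X 0 ^ 4 +
      258 * (MvPolynomial.X 0 ^ 2 * MvPolynomial.X 1 ^ 2) + 11 * MvPolynomial.X 1 ^ 4)
  | 4 => MvPolynomial.C (-(√2 / 4096)) * (MvPolynomial.X 0 * (10689 * MvPolynomial.X 0 ^ 4 +
      8910 * (MvPolynomial.X 0 ^ 2 * MvPolynomial.X 1 ^ 2) + 909 * MvPolynomial.X 1 ^ 4))
  | _ => 0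

theorem normalFormPoly_eq_sum : normalFormPoly = ∑ n ∈ Finset.range 5, normalFormPart n := by
  simp [normalFormPoly, normalFormPart, Finset.sum_range_succ]
  ring

theorem isHomogeneous_normalFormPart (n : ℕ) : (normalFormPart n).IsHomogeneous (n + 1) := by
  have hX : ∀ (i : Fin 2) (k : ℕ), (MvPolynomial.X i ^ k : MvPolynomial (Fin 2) ℝ).IsHomogeneous k :=
    fun i k => by simpa using (MvPolynomial.isHomogeneous_X ℝ i).pow k
  have hX1 : (MvPolynomial.X 0 : MvPolynomial (Fin 2) ℝ).IsHomogeneous 1 :=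
    MvPolynomial.isHomogeneous_X ℝ 0
  have hC : ∀ {P : MvPolynomial (Fin 2) ℝ} {k : ℕ} (a : ℝ), P.IsHomogeneous k →
      (MvPolynomial.C a * P).IsHomogeneous k := fun a hP => by
    simpa using (MvPolynomial.isHomogeneous_C (Fin 2) a).mul hP
  have hn : ∀ {P : MvPolynomial (Fin 2) ℝ} {k : ℕ} (a : ℕ) [a.AtLeastTwo], P.IsHomogeneous k →
      (OfNat.ofNat a * P).IsHomogeneous k := fun a _ hP => by
    have := hC (OfNat.ofNat a) hP
    rwa [map_ofNat] at this
  match n with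
  | 0 => exact hC _ hX1
  | 1 => exact hC _ ((hn 3 (hX 0 2)).add (hX 1 2))
  | 2 =>
    have := hX1.mul ((hn 17 (hX 0 2)).add (hn 9 (hX 1 2)))
    exact hC _ this
  | 3 => exact hC _ (((hn 375 (hX 0 4)).add (hn 258 ((hX 0 2).mul (hX 1 2)))).add (hn 11 (hX 1 4)))
  | 4 =>
    have := hX1.mul (((hn 10689 (hX 0 4)).add (hn 8910 ((hX 0 2).mul (hX 1 2)))).add
      (hn 909 (hX 1 4)))
    exact hC _ this
  | n + 5 => exact MvPolynomial.isHomogeneous_zero _ _ _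

theorem coeff_normalFormPoly {d : Fin 2 →₀ ℕ} {n : ℕ} (hd : d.degree = n + 1) (hn : n < 5) :
    MvPolynomial.coeff d normalFormPoly = MvPolynomial.coeff d (normalFormPart n) := by
  rw [normalFormPoly_eq_sum, MvPolynomial.coeff_sum]
  refine Finset.sum_eq_single n (fun j _ hj => ?_) fun h => absurd (Finset.mem_range.2 hn) h
  exact (isHomogeneous_normalFormPart j).coeff_eq_zero (by omega)

theorem coeff_zero_normalFormPoly : MvPolynomial.coeff 0 normalFormPoly = 0 := by
  rw [normalFormPoly_eq_sum, MvPolynomial.coeff_sum]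
  refine Finset.sum_eq_zero fun j _ => ?_
  exact (isHomogeneous_normalFormPart j).coeff_eq_zero (by simp)

/-- The normal form agrees with `normalFormPoly` up to order five, because its moments determine
its coefficients. -/
theorem dehomogenize_normalFormPart {W : ℕ → Poly} {P : ℕ → MvPolynomial (Fin 2) ℝ}
    (hW : ∀ k, W k ∈ invariantSubmodule (k + 2)) (hP : ∀ n, (P n).IsHomogeneous (n + 1))
    (hWP : ∀ n, ((2 * n).factorial : ℝ)⁻¹ • triangle (scaled H) W (2 * n) 0 =
      MvPolynomial.aeval ![J₁, J₂] (P n)) {n : ℕ} (hn : n < 5) :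
    dehomogenize (P n) = dehomogenize (normalFormPart n) := by
  have h2 : √2 * √2 = (2 : ℝ) := Real.mul_self_sqrt (by norm_num)
  have hr : (√2 : ℝ) ≠ 0 := by positivity
  -- the normalization `c` removes the powers of `√2`
  set c : ℕ → Polynomial ℝ := fun n => Polynomial.C ((√2)⁻¹ * √2 ^ n) * dehomogenize (P n) with hc
  have hb0 : dehomogenize (P 0) = Polynomial.C √2 * Polynomial.X := by
    have h := congrArg restrict (hWP 0)
    rw [restrict_aeval (hP 0), mul_zero, triangle, scaled_H_zero, Nat.factorial_zero, Nat.cast_one,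
      inv_one, one_smul, map_mul, restrict_J₁, ← MvPolynomial.algebraMap_eq, AlgHom.commutes,
      Polynomial.algebraMap_apply, ← mul_assoc, mul_comm, zero_add, pow_one,
      Polynomial.algebraMap_eq, ← map_mul] at h
    exact (Polynomial.C_injective (mul_left_cancel₀ Polynomial.X_ne_zero h)).symm
  have hc0 : c 0 = Polynomial.X := by
    rw [hc]
    simp only [pow_zero, mul_one, hb0]
    rw [← mul_assoc, ← map_mul, inv_mul_cancel₀ hr, map_one, one_mul]
  have hmom : HasHamiltonianMoments c := by
    intro k l hk hl
    have h := segmentIntegral_normalForm hW hP hWP hk l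
    have hmk : PowerSeries.mk c = PowerSeries.C (Polynomial.C (√2)⁻¹) *
        PowerSeries.rescale (Polynomial.C √2) (PowerSeries.mk fun n => dehomogenize (P n)) := by
      ext1 n
      simp [hc, mul_assoc]
    rw [hmk, mul_pow, ← map_pow, ← map_pow, ← map_pow, PowerSeries.coeff_C_mul,
      PowerSeries.coeff_rescale, ← map_pow, ← mul_assoc, ← map_mul, ← Polynomial.smul_eq_C_mul,
      map_smul, h, ← map_smul]
    congr 1
    have h3 : (√2)⁻¹ ^ k * √2 ^ l * √2 ^ (k - l) = 1 := by
      rw [mul_assoc, ← pow_add, Nat.add_sub_cancel' hl, ← mul_pow, inv_mul_cancel₀ hr, one_pow]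
    have h4 := congrArg (Polynomial.C : ℝ →+* Polynomial ℝ) h3
    rw [map_mul, map_one] at h4
    rw [hamiltonianMoment, Polynomial.smul_eq_C_mul, nsmul_eq_mul]
    linear_combination (k.choose l : Polynomial ℝ) * (Polynomial.X ^ (k - l) *
      (Polynomial.C ((1 / 8) ^ l) * ∑ j ∈ Finset.range (2 * l + 1),
        (-Polynomial.X) ^ (2 * j - 2 * l) * ((2 * j).choose (2 * l) : Polynomial ℝ) *
          ((2 * l).choose j : Polynomial ℝ))) * h4
  have hcancel : ∀ n, Polynomial.C ((√2)⁻¹ * √2 ^ n) * dehomogenize (normalFormPart n) = c n →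
      dehomogenize (P n) = dehomogenize (normalFormPart n) := fun n h =>
    (mul_left_cancel₀ (Polynomial.C_ne_zero.2 (by positivity)) h).symm
  refine hcancel n ?_
  have h3 : √2 ^ 3 = 2 * √2 := by rw [pow_succ, pow_two, h2]
  have h4 : √2 ^ 4 = (4 : ℝ) := by rw [pow_succ, h3, mul_assoc, h2]; norm_num
  have hi : (√2)⁻¹ = √2 / 2 := by field_simp; linarith
  refine Polynomial.funext fun x => ?_
  interval_cases n
  · rw [hc0]
    simp [normalFormPart, dehomogenize]
  · rw [hmom.coeff_one hc0]
    simp [normalFormPart, dehomogenize, hi]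
    linear_combination ((3 * x ^ 2 + 1) / 8) * h2
  · rw [hmom.coeff_two hc0]
    simp [normalFormPart, dehomogenize, hi]
    linear_combination (-(17 * x ^ 3 + 9 * x) / 32) * h2
  · rw [hmom.coeff_three hc0]
    simp [normalFormPart, dehomogenize, hi, h3]
    linear_combination ((375 * x ^ 4 + 258 * x ^ 2 + 11) / 256) * h2
  · rw [hmom.coeff_four hc0]
    simp [normalFormPart, dehomogenize, hi, h4]
    linear_combination (-(10689 * x ^ 5 + 8910 * x ^ 3 + 909 * x) / 2048) * h2

/-! ### Existence and uniqueness of the Birkhoff normal form -/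

theorem coe_H_mem : ((H : Poly) : Series) ∈ orderIdeal Coord 2 := by
  rw [mem_orderIdeal]
  intro m hm
  have h := MvPolynomial.coeff_homogeneousComponent m.degree H m
  rw [if_pos rfl, homogeneousComponent_H, if_neg (by omega), if_neg (by omega),
    MvPolynomial.coeff_zero] at h
  rw [MvPolynomial.coeff_coe, ← h]

theorem aeval_eq_subst (Φ : Coord → Series) (K : Poly) :
    MvPolynomial.aeval Φ K = MvPowerSeries.subst Φ (K : Series) :=
  (MvPowerSeries.subst_coe K).symm

theorem exists_normalForm : ∃ (W : ℕ → Poly) (N : MvPowerSeries (Fin 2) ℝ), IsGenerator W ∧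
    IsNonresonant W ∧ lieTransform (scaled H) W = inJ N ∧
    ∀ d : Fin 2 →₀ ℕ, d.degree < 6 →
      MvPowerSeries.coeff d N = MvPolynomial.coeff d normalFormPoly := by
  obtain ⟨W, N, P, hgen, hnon, hmem, hlie, hP, hWP, hN0, hN⟩ := exists_normalization
  refine ⟨W, N, hgen, hnon, hlie, fun d hd => ?_⟩
  rcases hdeg : d.degree with _ | n
  · rw [Finsupp.degree_eq_zero_iff] at hdeg
    rw [hdeg, hN0, coeff_zero_normalFormPoly]
  · rw [hN d n hdeg, coeff_normalFormPoly hdeg (by omega), ← coeff_dehomogenize (hP n) hdeg,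
      ← coeff_dehomogenize (isHomogeneous_normalFormPart n) hdeg,
      dehomogenize_normalFormPart hmem hP hWP (by omega)]

theorem lieTransform_scaled_H {W : ℕ → Poly} (hW : IsGenerator W) :
    lieTransform (scaled H) W = MvPolynomial.aeval (lieChange W) H :=
  lieTransform_scaled hW H (by rw [homogeneousComponent_H]; simp)
    (by rw [homogeneousComponent_H]; simp)

/-- Two normal forms of the Hamiltonian are related by the composition of one change of variables
with the inverse of the other, so the uniqueness theorem for normal forms applies. -/
theorem eq_of_isBirkhoffNormalForm {N N' : MvPowerSeries (Fin 2) ℝ}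
    (hcoeff : ∀ d : Fin 2 →₀ ℕ, d.degree < 6 →
      MvPowerSeries.coeff d N = MvPolynomial.coeff d normalFormPoly)
    (hN : IsBirkhoffNormalForm H N) (hN' : IsBirkhoffNormalForm H N') : N' = N := by
  obtain ⟨Φ, hΦ, h⟩ := hN
  obtain ⟨Φ', hΦ', h'⟩ := hN'
  rw [aeval_eq_subst] at h h'
  obtain ⟨χ, hχ, hcomp⟩ := hΦ'.isCanonical.exists_comp_eq hΦ.isCanonical
  refine normalForm_unique hχ (by rw [← h, ← h', hcomp]) ?_ ?_
  · rw [mem_orderIdeal]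
    intro d hd
    rw [map_sub, hcoeff d (by omega), MvPolynomial.coeff_coe, sub_eq_zero]
    have hlow : (MvPolynomial.C √2 * MvPolynomial.X 0 + MvPolynomial.C (1 / 4) *
        (3 * MvPolynomial.X 0 ^ 2 + MvPolynomial.X 1 ^ 2) : MvPolynomial (Fin 2) ℝ) =
        normalFormPart 0 + normalFormPart 1 := rfl
    rw [hlow, normalFormPoly_eq_sum, MvPolynomial.coeff_sum, MvPolynomial.coeff_add]
    rw [← Finset.sum_subset (Finset.range_mono (show 2 ≤ 5 by norm_num)) fun j _ hj =>
      (isHomogeneous_normalFormPart j).coeff_eq_zero (by rw [Finset.mem_range] at hj; omega)]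
    rw [Finset.sum_range_succ, Finset.sum_range_one]
  · rw [← h, ← h']
    have := sub_mem (hΦ.isCanonical.subst_sub_mem coe_H_mem)
      (hΦ'.isCanonical.subst_sub_mem coe_H_mem)
    rwa [sub_sub_sub_cancel_right] at this

end

end ChampagneBottle

theorem theorem3 :
    ∃ N : MvPowerSeries (Fin 2) ℝ,
      -- `N` is the Birkhoff normal form, and it is the only one
      (∀ N' : MvPowerSeries (Fin 2) ℝ,
        ChampagneBottle.IsBirkhoffNormalForm ChampagneBottle.H N' ↔ N' = N) ∧
      -- it is produced by the Lie–Deprit algorithm, with a generating function free of resonant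
      -- terms, which generates a near-identity symplectic change of variables
      (∃ W : ℕ → ChampagneBottle.Poly,
        ChampagneBottle.IsGenerator W ∧ ChampagneBottle.IsNonresonant W ∧
        ChampagneBottle.lieTransform (ChampagneBottle.scaled ChampagneBottle.H) W
          = ChampagneBottle.inJ N ∧
        ChampagneBottle.IsNearIdentitySymplectic (ChampagneBottle.lieChange W) ∧
        MvPolynomial.aeval (ChampagneBottle.lieChange W) ChampagneBottle.H
          = ChampagneBottle.inJ N) ∧
      -- every other successful choice of the generating function leads to the same series
      (∀ (W : ℕ → ChampagneBottle.Poly) (N' : MvPowerSeries (Fin 2) ℝ),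
        ChampagneBottle.IsGenerator W →
        ChampagneBottle.lieTransform (ChampagneBottle.scaled ChampagneBottle.H) W
          = ChampagneBottle.inJ N' →
        N' = N) ∧
      -- the terms of degree at most 5 in `(J₁, J₂)`
      (∀ m : Fin 2 →₀ ℕ, m.degree < 6 →
        MvPowerSeries.coeff m N = MvPolynomial.coeff m ChampagneBottle.normalFormPoly) := by
  open ChampagneBottle in
  obtain ⟨W, N, hgen, hnon, hlie, hcoeff⟩ := exists_normalForm
  have hgenerated : ∀ {W : ℕ → Poly} {N : MvPowerSeries (Fin 2) ℝ}, IsGenerator W →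
      lieTransform (scaled H) W = inJ N → IsBirkhoffNormalForm H N := fun hW h =>
    ⟨_, isNearIdentitySymplectic_lieChange hW, (lieTransform_scaled_H hW).symm.trans h⟩
  refine ⟨N, fun N' => ⟨eq_of_isBirkhoffNormalForm hcoeff (hgenerated hgen hlie), ?_⟩,
    ⟨W, hgen, hnon, hlie, isNearIdentitySymplectic_lieChange hgen,
      (lieTransform_scaled_H hgen).symm.trans hlie⟩,
    fun W' N' hW' h => eq_of_isBirkhoffNormalForm hcoeff (hgenerated hgen hlie)
      (hgenerated hW' h), hcoeff⟩
  rintro rfl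
  exact hgenerated hgen hlie
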